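/- **Setting.** Let $d\in\{2,3\}$, let $\Omega\subset\mathbb R^d$ be open and bounded with Lipschitz boundary, $T>0$, $D=\Omega\times(0,T)$, $\Gamma_S=\partial\Omega\times(0,T)$, $\Gamma_0=\bar\Omega\times\{0\}$, $\Gamma_T=\Omega\times\{T\}$. The operators $\nabla$, $\nabla\cdot$, $\Delta$ act on the space variables only. Let $K^h$ be a finite tessellation of $\bar D$ into elements $e$, each the image of the reference cube $[0,1]^{d+1}$ under a map that is a smooth diffeomorphism near the cube; the elements do not overlap, and neither do their faces $e_T=\{x:(x,T)\in e\}$ at the final time. Let $h_e$ be the diameter of $e$ and $h_{\max}=\max_e h_e$. For $k\ge1$ let $P_k(e)$ be the functions on $e$ which in reference coordinates are polynomials of degree at most $k$ in each variable. Let $V_h$ be the space of $\mathbb R^d$-valued functions in $H^1(D)$ that are continuous on $\bar D$, vanish on $\Gamma_S\cup\Gamma_0$ and have components in $P_k(e)$ on every $e$; let $Q_h$ be the space of scalar functions in $H^1(D)$ that are continuous on $\bar D$ and in $P_k(e)$ on every $e$. Write $(\cdot,\cdot)$, $\|\cdot\|$ for the $L^2(D)$ inner product and norm, $(\cdot,\cdot)_{\Gamma_T}$,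 $\|\cdot\|_{\Gamma_T}$ for those of $L^2(\Omega)$ at $t=T$, and $(\cdot,\cdot)_h=\sum_e(\cdot,\cdot)_{L^2(e)}$, $(\cdot,\cdot)_{\Gamma_T,h}=\sum_e(\cdot,\cdot)_{L^2(e_T)}$ with norms $\|\cdot\|_h$, $\|\cdot\|_{\Gamma_T,h}$ (elementwise derivatives). For a convection field $a\in V_h$ put $M[a]u=\partial_tu+a\cdot\nabla u+\tfrac12(\nabla\cdot a)u$, and on each element, with $|\tilde a|_\infty=\sup_{e}|(a,1)|$, $$\tau_m=\Big[\frac{c_1C_I^2\nu}{h_e^2}+\frac{c_2|\tilde a|_\infty}{h_e}\Big]^{-1},\qquad \tau_c=c_3C_I^2\nu+c_4|\tilde a|_\infty h_e .$$ Here $\nu>0$, $c_1>2$, $c_2,c_3,c_4>0$, and $C_I>0$ is a constant with $\|\nabla v\|_{\omega}\le \frac{C_I}{h_e}\|v\|_{\omega}$ and $\|\Delta v\|_{\omega}\le \frac{C_I}{h_e}\|\nabla v\|_{\omega}$ for all $v\in V_h$, all $e$ and $\omega\in\{e,e_T\}$ ($L^2$ norms). Let $C_\Gamma>0$ be a constant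 with $\|g\|_{L^2(e_T)}^2\le C_\Gamma\|g\|_{L^2(e)}^2$ for all $e$ and all $g=M[a]u+\nabla p$, $a,u\in V_h$, $p\in Q_h$. Let $0<\varepsilon<2/C_\Gamma$. Call $a\in V_h$ admissible if $h_{\max}<\varepsilon c_2|\tilde a|_\infty$ on every element (if $h_{\max}<\varepsilon c_2$, every $a\in V_h$ is admissible). Let $f$ be continuous on $\bar D$ with values in $\mathbb R^d$. For $\phi=(u,p)$, $\psi=(v,q)$ in $V_h\times Q_h$ let $$\begin{aligned}B_h(a;\phi,\psi)={}&-(u,M[a]v)+\nu(\nabla u,\nabla v)-(p,\nabla\cdot v)+(\nabla\cdot u,q)+(u,v)_{\Gamma_T}\\&+(\tau_m[M[a]u-\nu\Delta u+\nabla p],\,M[a]v+\nu\Delta v+\nabla q)_h+(\tau_c\nabla\cdot u,\nabla\cdot v)_h\\&-(\tau_m[M[a]u-\nu\Delta u+\nabla p],v)_{\Gamma_T,h},\\ L_h(a;\psi)={}&(f,v)+(\tau_mf,\,M[a]v-\nu\Delta v+\nabla q)_h-(\tau_mf,v)_{\Gamma_T,h},\\ |||\phi|||_a^2={}&\|u\|_{\Gamma_T}^2+\nu\|\nabla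 u\|^2+\|\tau_m^{1/2}[M[a]u+\nabla p]\|_h^2,\\ \lambda_a(f)^2={}&\|\nu^{-1}f\|^2+2\|\tau_m^{1/2}f\|_h^2+\|\tau_m^{1/2}f\|_{\Gamma_T,h}^2,\end{aligned}$$ with $\tau_m,\tau_c$ computed from $a$. For $R\in\mathbb R$ let $B_R$ be the set of all $\phi\in V_h\times Q_h$ with $|||\phi|||_b\le R$ for some $b\in V_h$. **Lemma.** There are constants $C_s,C_b>0$, independent of $f$ and of $a$, such that the following hold. 1. $B_h(a;\phi,\phi)\ge C_s|||\phi|||_a^2$ for all admissible $a$ and all $\phi\in V_h\times Q_h$. 2. For every such $f$, $(C_b/C_s)\lambda_a(f)$ is bounded over admissible $a$. For every admissible $a$ the linearized problem "find $\phi_h\in V_h\times Q_h$ with $B_h(a;\phi_h,\psi_h)=L_h(a;\psi_h)$ for all $\psi_h\in V_h\times Q_h$" has a solution $\phi_h=(u_h,p_h)$; its velocity $u_h$ and its elementwise spatial pressure gradient $\nabla p_h$ are unique; and $|||\phi_h|||_a\le (C_b/C_s)\lambda_a(f)$. 3. For every $R$ there is $\tilde C\ge0$ such that for every such $f$ with $(C_b/C_s)\lambda_a(f)\le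 R$ for all admissible $a$, the solution map $F:a\mapsto\phi_h$ (for any choice of the pressures) has these properties: if $a$ is admissible and $(a,r)\in B_R$ for some $r$, then $F(a)\in B_R$, and indeed $|||F(a)|||_a\le R$; and if $a^1,a^2$ are two such fields and $\phi_h^i=F(a^i)$, then $$|||\phi_h^1-\phi_h^2|||_{a^1}\le\frac{\tilde C}{C_s}\,\|\nabla(a^1-a^2)\| .$$ -/

import Mathlib

open MeasureTheory Set
open scoped ContDiff

namespace SpaceTimeVMS

noncomputable section

/-! ### Space-time domain -/

/-- Space `ℝ^d` with the Euclidean norm. -/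
abbrev Sp (d : ℕ) := EuclideanSpace ℝ (Fin d)

/-- Space-time; a point is `(x, t)`. Its measure is Lebesgue measure `dx dt`. -/
abbrev ST (d : ℕ) := Sp d × ℝ

/-- Lipschitz boundary: near every boundary point, `Ω` is the region lying above the graph of
a Lipschitz function over the hyperplane orthogonal to some unit vector `n`. -/
def HasLipschitzBoundary {d : ℕ} (Ω : Set (Sp d)) : Prop :=
  ∀ x ∈ frontier Ω, ∃ r > 0, ∃ n : Sp d, ‖n‖ = 1 ∧
    ∃ γ : Sp d → ℝ, (∃ C, LipschitzWith C γ) ∧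
      ∀ y ∈ Metric.ball x r, (y ∈ Ω ↔ γ (y - inner ℝ n y • n) < inner ℝ n y)

/-- The (open) space-time cylinder `Ω × (0, T)`. -/
def stDom {d : ℕ} (Ω : Set (Sp d)) (T : ℝ) : Set (ST d) := Ω ×ˢ Ioo 0 T

/-- The lateral boundary `Γ_S = ∂Ω × (0, T)`. -/
def sideBdry {d : ℕ} (Ω : Set (Sp d)) (T : ℝ) : Set (ST d) := frontier Ω ×ˢ Ioo 0 T

/-- The initial boundary `Γ_0 = closure Ω × {0}`. -/
def initBdry {d : ℕ} (Ω : Set (Sp d)) : Set (ST d) := closure Ω ×ˢ {0}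

/-! ### The Sobolev space `H¹` -/

/-- `g` is the weak derivative of `u` in direction `w` on the open set `D`. -/
def HasWeakDeriv {d : ℕ} (D : Set (ST d)) (w : ST d) (u g : ST d → ℝ) : Prop :=
  ∀ η : ST d → ℝ, ContDiff ℝ ∞ η → HasCompactSupport η → tsupport η ⊆ D →
    ∫ z in D, u z * fderiv ℝ η z w = -∫ z in D, g z * η z

/-- `u ∈ H¹(D)`. -/
def MemH1 {d : ℕ} (D : Set (ST d)) (u : ST d → ℝ) : Prop :=
  MemLp u 2 (volume.restrict D) ∧
    ∀ w : ST d, ∃ g : ST d → ℝ, MemLp g 2 (volume.restrict D) ∧ HasWeakDeriv D w u g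

/-! ### Meshes and finite element spaces -/

/-- An element: the diffeomorphic image of the reference cube `[0,1]^(d+1)` under a map which is
smooth, with smooth inverse, on a neighbourhood of the cube. -/
structure Element (d : ℕ) where
  chart : OpenPartialHomeomorph (Fin (d + 1) → ℝ) (ST d)
  cube_subset : Icc 0 1 ⊆ chart.source
  smooth : ContDiffOn ℝ ∞ chart chart.source
  smooth_symm : ContDiffOn ℝ ∞ chart.symm chart.target

namespace Element

variable {d : ℕ}

/-- The closed set occupied by the element. -/
def carrier (e : Element d) : Set (ST d) := e.chart '' Icc 0 1

/-- The part of the element in the final time slice, as a subset of `ℝ^d`. -/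
def top (e : Element d) (T : ℝ) : Set (Sp d) := {x | (x, T) ∈ e.carrier}

/-- The size `h_e`: the diameter for the Euclidean distance of `ℝ^(d+1)`. -/
def size (e : Element d) : ℝ :=
  Metric.diam ((WithLp.toLp 2 : ST d → WithLp 2 (ST d)) '' e.carrier)

/-- `p|_e ∈ P_k(e)`: on `e`, in reference coordinates, `p` is a polynomial of degree at most `k`
in each variable. -/
def PolyOn (e : Element d) (k : ℕ) (p : ST d → ℝ) : Prop :=
  ∃ q : MvPolynomial (Fin (d + 1)) ℝ, (∀ j, q.degreeOf j ≤ k) ∧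
    ∀ y ∈ Icc (0 : Fin (d + 1) → ℝ) 1, p (e.chart y) = MvPolynomial.eval y q

/-- `|ã|_∞` on the element, where `ã = (a, 1)` is the space-time convection field. -/
def convSup (e : Element d) (a : ST d → Sp d) : ℝ :=
  ⨆ z : e.carrier, √(‖a z‖ ^ 2 + 1)

end Element

/-- A tessellation `K^h` of the space-time cylinder into finitely many non-overlapping elements,
whose traces at the final time do not overlap either. -/
structure Mesh {d : ℕ} (Ω : Set (Sp d)) (T : ℝ) where
  card : ℕ
  elem : Fin card → Element d
  cover : ⋃ j, (elem j).carrier = closure (stDom Ω T)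
  nonoverlap : Pairwise fun i j => AEDisjoint volume (elem i).carrier (elem j).carrier
  nonoverlap_top : Pairwise fun i j => AEDisjoint volume ((elem i).top T) ((elem j).top T)

section Spaces

variable {d : ℕ} {Ω : Set (Sp d)} {T : ℝ}

/-- `h_max`. -/
def Mesh.maxSize (K : Mesh Ω T) : ℝ := ⨆ j, (K.elem j).size

/-- The velocity space `V_h`: vector fields in `H¹`, continuous up to the boundary, zero on
`Γ_S ∪ Γ_0`, and with components in `P_k(e)` on every element. A function on the closed cylinder
is represented by its extension by zero. -/
def Mesh.Vh (K : Mesh Ω T) (k : ℕ) : Set (ST d → Sp d) :=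
  {v | (∀ i, MemH1 (stDom Ω T) fun z => v z i) ∧
    ContinuousOn v (closure (stDom Ω T)) ∧
    (∀ z ∈ sideBdry Ω T ∪ initBdry Ω, v z = 0) ∧
    (∀ j i, (K.elem j).PolyOn k fun z => v z i) ∧
    ∀ z ∉ closure (stDom Ω T), v z = 0}

/-- The pressure space `Q_h`, with the same conventions. -/
def Mesh.Qh (K : Mesh Ω T) (k : ℕ) : Set (ST d → ℝ) :=
  {q | MemH1 (stDom Ω T) q ∧
    ContinuousOn q (closure (stDom Ω T)) ∧
    (∀ j, (K.elem j).PolyOn k q) ∧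
    ∀ z ∉ closure (stDom Ω T), q z = 0}

/-- `V_h × Q_h`. -/
def Mesh.Wh (K : Mesh Ω T) (k : ℕ) : Set ((ST d → Sp d) × (ST d → ℝ)) := K.Vh k ×ˢ K.Qh k

end Spaces

/-! ### Differential operators

All derivatives are taken within a set `S`. For `S` the open cylinder these are the classical
derivatives, which for finite element functions exist almost everywhere and are the weak ones;
for `S` an element they are the elementwise derivatives, including one-sided values on faces. -/

section Operators

variable {d : ℕ} {F : Type*} [NormedAddCommGroup F] [NormedSpace ℝ F]

/-- `∂_t u`. -/
def dt (S : Set (ST d)) (u : ST d → F) (z : ST d) : F := fderivWithin ℝ u S z (0, 1)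

/-- `∂u/∂x_i`. -/
def dx (S : Set (ST d)) (i : Fin d) (u : ST d → F) (z : ST d) : F :=
  fderivWithin ℝ u S z (EuclideanSpace.single i 1, 0)

/-- The spatial gradient of a scalar function. -/
def grad (S : Set (ST d)) (p : ST d → ℝ) (z : ST d) : Sp d :=
  WithLp.toLp 2 fun i => dx S i p z

/-- The spatial divergence. -/
def div (S : Set (ST d)) (u : ST d → Sp d) (z : ST d) : ℝ := ∑ i, dx S i u z i

/-- The spatial Laplacian. -/
def lap (S : Set (ST d)) (u : ST d → Sp d) (z : ST d) : Sp d := ∑ i, dx S i (dx S i u) z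

/-- `∇u : ∇v` for the spatial gradients. -/
def gradDot (S : Set (ST d)) (u v : ST d → Sp d) (z : ST d) : ℝ :=
  ∑ i, inner ℝ (dx S i u z) (dx S i v z)

/-- `L[a]u = a·∇u + ½ (∇·a) u`. -/
def advL (S : Set (ST d)) (a u : ST d → Sp d) (z : ST d) : Sp d :=
  ∑ i, a z i • dx S i u z + ((1 / 2 : ℝ) * div S a z) • u z

/-- `M[a]u = ∂_t u + L[a]u`. -/
def advM (S : Set (ST d)) (a u : ST d → Sp d) (z : ST d) : Sp d := dt S u z + advL S a u z

end Operators

/-! ### The stabilized forms -/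

/-- Viscosity, the constants in the stabilization parameters, and the inverse constant. -/
structure Params where
  ν : ℝ
  c₁ : ℝ
  c₂ : ℝ
  c₃ : ℝ
  c₄ : ℝ
  CI : ℝ

/-- `τ_m` on the element `e` for the convection field `a`. -/
def Params.τm {d : ℕ} (P : Params) (e : Element d) (a : ST d → Sp d) : ℝ :=
  (P.c₁ * P.CI ^ 2 * P.ν / e.size ^ 2 + P.c₂ * e.convSup a / e.size)⁻¹

/-- `τ_c` on the element `e` for the convection field `a`. -/
def Params.τc {d : ℕ} (P : Params) (e : Element d) (a : ST d → Sp d) : ℝ :=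
  P.c₃ * P.CI ^ 2 * P.ν + P.c₄ * e.convSup a * e.size

section Forms

variable {d : ℕ} {Ω : Set (Sp d)} {T : ℝ}

/-- The form `B_h(a; φ, ψ)`, with `φ = (u, p)` and `ψ = (v, q)`. -/
def Bh (K : Mesh Ω T) (P : Params) (a : ST d → Sp d)
    (φ ψ : (ST d → Sp d) × (ST d → ℝ)) : ℝ :=
  -(∫ z in stDom Ω T, inner ℝ (φ.1 z) (advM (stDom Ω T) a ψ.1 z))
    + P.ν * (∫ z in stDom Ω T, gradDot (stDom Ω T) φ.1 ψ.1 z)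
    - (∫ z in stDom Ω T, φ.2 z * div (stDom Ω T) ψ.1 z)
    + (∫ z in stDom Ω T, div (stDom Ω T) φ.1 z * ψ.2 z)
    + (∫ x in Ω, inner ℝ (φ.1 (x, T)) (ψ.1 (x, T)))
    + (∑ j, P.τm (K.elem j) a * ∫ z in (K.elem j).carrier,
        inner ℝ
          (advM (K.elem j).carrier a φ.1 z - P.ν • lap (K.elem j).carrier φ.1 z
            + grad (K.elem j).carrier φ.2 z)
          (advM (K.elem j).carrier a ψ.1 z + P.ν • lap (K.elem j).carrier ψ.1 z
            + grad (K.elem j).carrier ψ.2 z))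
    + (∑ j, P.τc (K.elem j) a * ∫ z in (K.elem j).carrier,
        div (K.elem j).carrier φ.1 z * div (K.elem j).carrier ψ.1 z)
    - (∑ j, P.τm (K.elem j) a * ∫ x in (K.elem j).top T,
        inner ℝ
          (advM (K.elem j).carrier a φ.1 (x, T) - P.ν • lap (K.elem j).carrier φ.1 (x, T)
            + grad (K.elem j).carrier φ.2 (x, T))
          (ψ.1 (x, T)))

/-- The linear form `L_h(a; ψ)`, with `ψ = (v, q)`, for the forcing `f`. -/
def Lh (K : Mesh Ω T) (P : Params) (f : ST d → Sp d) (a : ST d → Sp d)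
    (ψ : (ST d → Sp d) × (ST d → ℝ)) : ℝ :=
  (∫ z in stDom Ω T, inner ℝ (f z) (ψ.1 z))
    + (∑ j, P.τm (K.elem j) a * ∫ z in (K.elem j).carrier,
        inner ℝ (f z)
          (advM (K.elem j).carrier a ψ.1 z - P.ν • lap (K.elem j).carrier ψ.1 z
            + grad (K.elem j).carrier ψ.2 z))
    - (∑ j, P.τm (K.elem j) a * ∫ x in (K.elem j).top T, inner ℝ (f (x, T)) (ψ.1 (x, T)))

/-- The discrete norm `|||φ|||_a`, with `φ = (u, p)`. -/
def triNorm (K : Mesh Ω T) (P : Params) (a : ST d → Sp d)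
    (φ : (ST d → Sp d) × (ST d → ℝ)) : ℝ :=
  √((∫ x in Ω, ‖φ.1 (x, T)‖ ^ 2)
    + P.ν * (∫ z in stDom Ω T, gradDot (stDom Ω T) φ.1 φ.1 z)
    + ∑ j, P.τm (K.elem j) a * ∫ z in (K.elem j).carrier,
        ‖advM (K.elem j).carrier a φ.1 z + grad (K.elem j).carrier φ.2 z‖ ^ 2)

/-- `‖∇u‖` in `L²` of the cylinder. -/
def gradNorm (Ω : Set (Sp d)) (T : ℝ) (u : ST d → Sp d) : ℝ :=
  √(∫ z in stDom Ω T, gradDot (stDom Ω T) u u z)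

/-- `λ(f)`, for the parameters `τ_m` belonging to the convection field `a`. -/
def lam (K : Mesh Ω T) (P : Params) (f : ST d → Sp d) (a : ST d → Sp d) : ℝ :=
  √((∫ z in stDom Ω T, ‖P.ν⁻¹ • f z‖ ^ 2)
    + 2 * (∑ j, P.τm (K.elem j) a * ∫ z in (K.elem j).carrier, ‖f z‖ ^ 2)
    + ∑ j, P.τm (K.elem j) a * ∫ x in (K.elem j).top T, ‖f (x, T)‖ ^ 2)

/-- `φ` solves the linearized stabilized problem with convection field `a` and forcing `f`. -/
def IsSolution (K : Mesh Ω T) (k : ℕ) (P : Params) (f : ST d → Sp d) (a : ST d → Sp d)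
    (φ : (ST d → Sp d) × (ST d → ℝ)) : Prop :=
  φ ∈ K.Wh k ∧ ∀ ψ ∈ K.Wh k, Bh K P a φ ψ = Lh K P f a ψ

/-- The set `B_R` of all `φ ∈ V_h × Q_h` with `|||φ|||_b ≤ R` for some `b ∈ V_h`. -/
def discreteBall (K : Mesh Ω T) (k : ℕ) (P : Params) (R : ℝ) :
    Set ((ST d → Sp d) × (ST d → ℝ)) :=
  {φ | φ ∈ K.Wh k ∧ ∃ b ∈ K.Vh k, triNorm K P b φ ≤ R}

/-! ### Constants and admissible convection fields -/

/-- `CI` is an inverse constant of the mesh: `‖∇v‖ ≤ (CI/h_e) ‖v‖` and `‖Δv‖ ≤ (CI/h_e) ‖∇v‖` for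
all `v ∈ V_h`, in `L²` of every element and of its final time face. For each single mesh such
a constant exists, because the spaces have finite dimension. -/
def IsInverseConst (K : Mesh Ω T) (k : ℕ) (CI : ℝ) : Prop :=
  ∀ v ∈ K.Vh k, ∀ j,
    let e := K.elem j
    √(∫ z in e.carrier, gradDot e.carrier v v z) ≤
        CI / e.size * √(∫ z in e.carrier, ‖v z‖ ^ 2) ∧
    √(∫ z in e.carrier, ‖lap e.carrier v z‖ ^ 2) ≤
        CI / e.size * √(∫ z in e.carrier, gradDot e.carrier v v z) ∧
    √(∫ x in e.top T, gradDot e.carrier v v (x, T)) ≤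
        CI / e.size * √(∫ x in e.top T, ‖v (x, T)‖ ^ 2) ∧
    √(∫ x in e.top T, ‖lap e.carrier v (x, T)‖ ^ 2) ≤
        CI / e.size * √(∫ x in e.top T, gradDot e.carrier v v (x, T))

/-- `CΓ` is a discrete trace constant of the mesh: the squared `L²` norm on the final time face
of an element is at most `CΓ` times the squared `L²` norm on the element, for all functions
`M[a]u + ∇p` built from discrete `a`, `u`, `p`. For each single mesh such a constant exists. -/
def IsTraceConst (K : Mesh Ω T) (k : ℕ) (CΓ : ℝ) : Prop :=
  ∀ a ∈ K.Vh k, ∀ u ∈ K.Vh k, ∀ p ∈ K.Qh k, ∀ j,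
    let e := K.elem j
    ∫ x in e.top T, ‖advM e.carrier a u (x, T) + grad e.carrier p (x, T)‖ ^ 2 ≤
      CΓ * ∫ z in e.carrier, ‖advM e.carrier a u z + grad e.carrier p z‖ ^ 2

/-- Convection fields `a ∈ V_h` with `h_max < ε c₂ |ã|_∞` on every element. -/
def admissible (K : Mesh Ω T) (k : ℕ) (P : Params) (ε : ℝ) : Set (ST d → Sp d) :=
  {a | a ∈ K.Vh k ∧ ∀ j, K.maxSize < ε * P.c₂ * (K.elem j).convSup a}

end Forms

end

end SpaceTimeVMS

/-! The proof is an energy argument on finite-dimensional spaces. In the form tested with φ itself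
the pressure terms cancel. Since v·M[a]v = ½∂_t|v|² + ½∇·(a|v|²) and v vanishes initially and
laterally, convection leaves half of ‖u‖² at the final time. The element stabilization gives
τ_m(|M[a]u + ∇p|² − ν²|Δu|²), and the Laplacian is absorbed by the gradient because τ_m c₁C_I²ν/h² ≤
1. The delicate term lives on the final faces. There the trace constant and Young's inequality move
the residual into the element with a weight below 1, and two inverse inequalities bound the
Laplacian. What remains is τ_m‖u‖² at time T with two coefficients. The two summands of 1/τ_m pay
for one coefficient each, the convective summand thanks to admissibility, and together they cost
less than the available half (`boundary_absorption`, `coercive`).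

The triple norm is only a seminorm: it vanishes on (0, q) when ∇q = 0 on every element. As test
functions such pairs annihilate both sides, because then (∇·v, q) = 0. On a complement the form is
definite, so the problem is solvable by dimension count (`exists_solution`). Coercivity gives
uniqueness of u and ∇p, and together with boundedness of the right hand side (`rhs_le`) it gives the
a priori bound.

For two fields put χ = φ¹ − φ². Then B(a¹; χ, χ) is the change of the right hand side on χ minus the
change of the form on (φ², χ). Each is a sum of products in which one factor at a time changes by a
multiple of ‖∇(a¹ − a²)‖ (`exists_lipschitz`). Since ‖∇·‖ is a norm on V_h, it dominates every
linear or bilinear quantity (`exists_bound`), and membership in B_R bounds ∇aⁱ.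

This is carried out for `StabilizedData`, where elements enter only through Hilbert spaces.
Instantiating it needs null element boundaries and integration by parts for continuous, elementwise
smooth functions. The latter comes from Fubini and facts about Lipschitz functions on slices
(`Mesh.PiecewiseSmooth.integral_dx`, `Mesh.PiecewiseSmooth.integral_dt`), so no divergence theorem
on Ω is involved. -/

namespace SpaceTimeVMS

noncomputable section

/-! ### Geometry of the elements -/

namespace Element

variable {d : ℕ} (e : Element d)

/-- The image of the open reference cube. -/
def core : Set (ST d) := e.chart '' interior (Icc 0 1)

theorem isCompact_carrier : IsCompact e.carrier :=
  isCompact_Icc.image_of_continuousOn (e.chart.continuousOn.mono e.cube_subset)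

theorem isOpen_core : IsOpen e.core :=
  e.chart.isOpen_image_of_subset_source isOpen_interior (interior_subset.trans e.cube_subset)

theorem core_subset : e.core ⊆ e.carrier := image_mono interior_subset

theorem interior_cube_nonempty (n : ℕ) : (interior (Icc (0 : Fin n → ℝ) 1)).Nonempty := by
  refine ⟨fun _ => 1 / 2, ?_⟩
  have h : Set.pi univ (fun _ : Fin n => Ioo (0 : ℝ) 1) ⊆ Icc (0 : Fin n → ℝ) 1 := fun x hx =>
    ⟨fun i => (hx i trivial).1.le, fun i => (hx i trivial).2.le⟩
  exact interior_maximal h (isOpen_set_pi finite_univ fun _ _ => isOpen_Ioo)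
    (fun i _ => ⟨by norm_num, by norm_num⟩)

theorem core_nonempty : e.core.Nonempty := (interior_cube_nonempty _).image _

theorem carrier_subset_closure_core : e.carrier ⊆ closure e.core := by
  have h1 : closure (interior (Icc (0 : Fin (d + 1) → ℝ) 1)) = Icc 0 1 := by
    rw [(convex_Icc (𝕜 := ℝ) (0 : Fin (d + 1) → ℝ) 1).closure_interior_eq_closure_of_nonempty_interior
      (interior_cube_nonempty _), isClosed_Icc.closure_eq]
  have h2 := ContinuousOn.image_closure (f := e.chart) (s := interior (Icc 0 1))
    (by rw [h1]; exact e.chart.continuousOn.mono e.cube_subset)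
  rwa [h1] at h2

theorem differentiableAt_chart {y : Fin (d + 1) → ℝ} (hy : y ∈ e.chart.source) :
    DifferentiableAt ℝ e.chart y :=
  (e.smooth.differentiableOn (by simp)).differentiableAt (e.chart.open_source.mem_nhds hy)

/-- Chain rule for `chart ∘ chart.symm`, which is the identity near the image point. -/
theorem surjective_fderiv_chart {y : Fin (d + 1) → ℝ} (hy : y ∈ e.chart.source) :
    Function.Surjective (fderiv ℝ e.chart y) := by
  have hz : e.chart y ∈ e.chart.target := e.chart.map_source hy
  have h1 : DifferentiableAt ℝ e.chart.symm (e.chart y) :=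
    (e.smooth_symm.differentiableOn (by simp)).differentiableAt (e.chart.open_target.mem_nhds hz)
  have h2 : DifferentiableAt ℝ e.chart (e.chart.symm (e.chart y)) := by
    rw [e.chart.left_inv hy]; exact e.differentiableAt_chart hy
  have h3 : HasFDerivAt (e.chart ∘ e.chart.symm)
      ((fderiv ℝ e.chart (e.chart.symm (e.chart y))).comp (fderiv ℝ e.chart.symm (e.chart y)))
      (e.chart y) := h2.hasFDerivAt.comp _ h1.hasFDerivAt
  have h4 : HasFDerivAt (e.chart ∘ e.chart.symm) (ContinuousLinearMap.id ℝ (ST d))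
      (e.chart y) := by
    refine (hasFDerivAt_id _).congr_of_eventuallyEq ?_
    filter_upwards [e.chart.open_target.mem_nhds hz] with w hw
    exact e.chart.right_inv hw
  have h5 := h3.unique h4
  rw [e.chart.left_inv hy] at h5
  intro w
  exact ⟨fderiv ℝ e.chart.symm (e.chart y) w, by
    simpa using congrArg (fun A : ST d →L[ℝ] ST d => A w) h5⟩

/-- The cube is convex with nonempty interior, and maps with surjective derivatives preserve unique
differentiability. This makes elementwise derivatives well behaved, including one-sided ones on
faces. -/
theorem uniqueDiffOn_carrier : UniqueDiffOn ℝ e.carrier :=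
  (uniqueDiffOn_convex (convex_Icc _ _) (interior_cube_nonempty _)).image
    (f' := fun y => fderiv ℝ e.chart y)
    (fun _ hy => (e.differentiableAt_chart (e.cube_subset hy)).hasFDerivAt.hasFDerivWithinAt)
    (fun _ hy => (e.surjective_fderiv_chart (e.cube_subset hy)).denseRange)

/-- The frontier of a convex set is null, and differentiable maps send null sets to null sets.
Integrands may therefore be changed freely on the faces. -/
theorem volume_carrier_diff_core : volume (e.carrier \ e.core) = 0 := by
  have hsub : e.carrier \ e.core ⊆ e.chart '' frontier (Icc 0 1) := by
    rintro _ ⟨⟨y, hy, rfl⟩, hn⟩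
    refine ⟨y, ⟨subset_closure hy, fun hi => hn ⟨y, hi, rfl⟩⟩, rfl⟩
  refine measure_mono_null hsub ?_
  have h0 : volume (frontier (Icc (0 : Fin (d + 1) → ℝ) 1)) = 0 :=
    (convex_Icc _ _).addHaar_frontier _
  have hfr : Module.finrank ℝ (ST d) = Module.finrank ℝ (Fin (d + 1) → ℝ) := by simp
  -- The null-image theorem concerns maps of a space into itself, so the chart is followed by a
  -- linear isomorphism back to the reference space. Pushing the volume forward along it gives a
  -- multiple of Lebesgue measure.
  let A : ST d ≃L[ℝ] (Fin (d + 1) → ℝ) := ContinuousLinearEquiv.ofFinrankEq hfr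
  have hfc : frontier (Icc (0 : Fin (d + 1) → ℝ) 1) ⊆ Icc 0 1 := isClosed_Icc.frontier_subset
  have h1 : volume ((A ∘ e.chart) '' frontier (Icc 0 1)) = 0 := by
    refine addHaar_image_eq_zero_of_differentiableOn_of_addHaar_eq_zero volume ?_ h0
    intro y hy
    exact (A.differentiableAt.comp y
      (e.differentiableAt_chart (e.cube_subset (hfc hy)))).differentiableWithinAt
  have : (volume : Measure (ST d)).IsAddHaarMeasure :=
    inferInstanceAs ((volume : Measure (Sp d)).prod (volume : Measure ℝ)).IsAddHaarMeasure
  have : (volume.map A).IsAddHaarMeasure := A.isAddHaarMeasure_map volume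
  have h2 : (volume.map A) ((A ∘ e.chart) '' frontier (Icc 0 1)) = 0 := by
    rw [Measure.isAddLeftInvariant_eq_smul (volume.map A)
      (volume : Measure (Fin (d + 1) → ℝ))]
    rw [Measure.smul_apply, h1, smul_zero]
  rw [show (A : ST d → _) = A.toHomeomorph.toMeasurableEquiv from rfl,
    MeasurableEquiv.map_apply] at h2
  convert h2 using 2
  ext z
  constructor
  · rintro ⟨y, hy, rfl⟩
    exact ⟨y, hy, rfl⟩
  · rintro ⟨y, hy, hyz⟩
    exact ⟨y, hy, A.injective hyz⟩

theorem size_pos (hd : d ≠ 0) : 0 < e.size := by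
  have hc : IsCompact ((WithLp.toLp 2 : ST d → WithLp 2 (ST d)) '' e.carrier) :=
    e.isCompact_carrier.image (WithLp.prod_continuous_toLp 2 _ _)
  obtain ⟨z, hz⟩ := e.core_nonempty
  have : Nonempty (Fin d) := ⟨⟨0, Nat.pos_of_ne_zero hd⟩⟩
  obtain ⟨w, hw, hne⟩ : ∃ w ∈ e.core, w ≠ z := by
    by_contra! h
    have h1 : e.core = {z} := Subset.antisymm (fun w hw => h w hw) (by simpa using hz)
    exact not_isOpen_singleton z (h1 ▸ e.isOpen_core)
  refine lt_of_lt_of_le ?_ (Metric.dist_le_diam_of_mem hc.isBounded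
    (mem_image_of_mem _ (e.core_subset hw)) (mem_image_of_mem _ (e.core_subset hz)))
  exact dist_pos.2 fun h => hne (WithLp.toLp_injective 2 h)

/-- Functions in `P_k(e)` are smooth up to the boundary of the element. -/
theorem PolyOn.contDiffOn {e : Element d} {k : ℕ} {p : ST d → ℝ} (hp : e.PolyOn k p) :
    ContDiffOn ℝ ∞ p e.carrier := by
  obtain ⟨q, -, hq⟩ := hp
  have h1 : ContDiff ℝ ∞ fun y : Fin (d + 1) → ℝ => MvPolynomial.eval y q := by
    simp only [MvPolynomial.eval_eq]
    exact ContDiff.sum fun m _ => contDiff_const.mul <|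
      contDiff_prod fun i _ => (contDiff_apply ℝ ℝ i).pow _
  have h2 : ContDiffOn ℝ ∞ e.chart.symm e.carrier := e.smooth_symm.mono <| by
    rintro _ ⟨y, hy, rfl⟩
    exact e.chart.map_source (e.cube_subset hy)
  refine (h1.comp_contDiffOn h2).congr ?_
  rintro _ ⟨y, hy, rfl⟩
  simp [hq y hy, e.chart.left_inv (e.cube_subset hy)]

/-- A continuous function on an element whose square integral vanishes is zero. -/
theorem eq_zero_of_integral_sq {E : Type*} [NormedAddCommGroup E] {g : ST d → E}
    (hg : ContinuousOn g e.carrier) (h0 : ∫ z in e.carrier, ‖g z‖ ^ 2 = 0) :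
    ∀ z ∈ e.carrier, g z = 0 := by
  have hint : IntegrableOn (fun z => ‖g z‖ ^ 2) e.carrier :=
    (hg.norm.pow 2).integrableOn_compact e.isCompact_carrier
  rw [integral_eq_zero_iff_of_nonneg (fun z => by positivity) hint] at h0
  have h1 : (fun z => ‖g z‖ ^ 2) =ᵐ[volume.restrict e.core] 0 :=
    ae_restrict_of_ae_restrict_of_subset e.core_subset h0
  have h2 : EqOn (fun z => ‖g z‖ ^ 2) 0 e.core :=
    Measure.eqOn_open_of_ae_eq h1 e.isOpen_core
      ((hg.norm.pow 2).mono e.core_subset) continuousOn_const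
  intro z hz
  have h3 : EqOn (fun z => ‖g z‖ ^ 2) 0 e.carrier := 
    Set.EqOn.of_subset_closure h2 (hg.norm.pow 2) continuousOn_const e.core_subset
      e.carrier_subset_closure_core
  simpa using h3 hz

end Element

/-! ### The cylinder -/

section Cylinder

variable {d : ℕ} {Ω : Set (Sp d)} {T : ℝ}

/-- At a boundary point x the points x − s·n with small s > 0 lie strictly below the graph, hence
outside the closure of Ω. Slits and punctures are thereby excluded, and the open core of an element
cannot leave the open cylinder. -/
theorem interior_closure_subset_of_lipschitz (hΩo : IsOpen Ω) (hΩl : HasLipschitzBoundary Ω) :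
    interior (closure Ω) ⊆ Ω := by
  intro x hx
  by_contra hxΩ
  have hxf : x ∈ frontier Ω := ⟨interior_subset hx, by rwa [hΩo.interior_eq]⟩
  obtain ⟨r, hr, n, hn, γ, ⟨C, hγ⟩, hΩ⟩ := hΩl x hxf
  have hle : inner ℝ n x ≤ γ (x - inner ℝ n x • n) :=
    not_lt.1 fun h => hxΩ ((hΩ x (Metric.mem_ball_self hr)).2 h)
  let c : ℝ → Sp d := fun s => x - s • n
  have hc : Continuous c := by fun_prop
  have hc0 : c 0 = x := by simp [c]
  have hev : ∀ᶠ s in nhdsWithin (0 : ℝ) (Ioi 0),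
      c s ∈ Metric.ball x r ∩ interior (closure Ω) ∧ 0 < s := by
    refine Filter.Eventually.and ?_ self_mem_nhdsWithin
    refine (hc.tendsto 0).mono_left nhdsWithin_le_nhds |>.eventually ?_
    rw [hc0]
    exact Filter.inter_mem (Metric.ball_mem_nhds x hr) (isOpen_interior.mem_nhds hx)
  obtain ⟨s, ⟨hsb, hsi⟩, hs⟩ := hev.exists
  let U : Set (Sp d) := Metric.ball x r ∩
    {y | inner ℝ n y < γ (y - inner ℝ n y • n)}
  have hU : IsOpen U := Metric.isOpen_ball.inter <|
    isOpen_lt (by fun_prop) (hγ.continuous.comp (by fun_prop))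
  have hcU : c s ∈ U := by
    refine ⟨hsb, ?_⟩
    have h1 : inner ℝ n (c s) = inner ℝ n x - s := by
      simp [c, inner_sub_right, inner_smul_right, hn]
    have h2 : c s - inner ℝ n (c s) • n = x - inner ℝ n x • n := by
      rw [h1]; simp only [c, sub_smul]; abel
    rw [Set.mem_ofPred_eq, h2, h1]
    linarith
  obtain ⟨y, hyU, hyΩ⟩ := mem_closure_iff.1 (interior_subset hsi) U hU hcU
  exact lt_asymm hyU.2 ((hΩ y hyU.1).1 hyΩ)

theorem closure_stDom (hT : 0 < T) : closure (stDom Ω T) = closure Ω ×ˢ Icc 0 T := by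
  rw [stDom, closure_prod_eq, closure_Ioo hT.ne]

theorem interior_closure_stDom_subset (hΩo : IsOpen Ω) (hΩl : HasLipschitzBoundary Ω)
    (hT : 0 < T) : interior (closure (stDom Ω T)) ⊆ stDom Ω T := by
  rw [closure_stDom hT, interior_prod_eq, interior_Icc]
  exact prod_mono (interior_closure_subset_of_lipschitz hΩo hΩl) subset_rfl

variable (K : Mesh Ω T)

theorem Mesh.carrier_subset (j : Fin K.card) :
    (K.elem j).carrier ⊆ closure (stDom Ω T) :=
  K.cover ▸ subset_iUnion (fun j => (K.elem j).carrier) j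

theorem Mesh.core_subset_stDom (hΩo : IsOpen Ω) (hΩl : HasLipschitzBoundary Ω) (hT : 0 < T)
    (j : Fin K.card) : (K.elem j).core ⊆ stDom Ω T :=
  (interior_maximal ((K.elem j).core_subset.trans (K.carrier_subset j))
    (K.elem j).isOpen_core).trans (interior_closure_stDom_subset hΩo hΩl hT)

theorem Mesh.exists_mem_carrier {z : ST d} (hz : z ∈ closure (stDom Ω T)) :
    ∃ j, z ∈ (K.elem j).carrier := by
  rw [← K.cover] at hz
  simpa using hz

theorem Element.isCompact_top (e : Element d) : IsCompact (e.top T) := by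
  have h1 : e.top T = Prod.fst '' (e.carrier ∩ (univ ×ˢ {T})) := by
    ext x
    constructor
    · intro h
      exact ⟨(x, T), ⟨h, by simp⟩, rfl⟩
    · rintro ⟨⟨x', t⟩, ⟨h, h2⟩, rfl⟩
      simp only [mem_prod, mem_univ, mem_singleton_iff, true_and] at h2
      subst h2
      exact h
  rw [h1]
  exact (e.isCompact_carrier.inter_right (isClosed_univ.prod isClosed_singleton)).image
    continuous_fst

theorem Mesh.iUnion_top (hT : 0 < T) : ⋃ j, (K.elem j).top T = closure Ω := by
  ext x
  have h : (x, T) ∈ ⋃ j, (K.elem j).carrier ↔ (x, T) ∈ closure (stDom Ω T) := by rw [K.cover]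
  rw [closure_stDom hT] at h
  simp only [mem_iUnion, mem_prod, mem_Icc, hT.le, le_refl, and_true] at h
  simpa [Element.top] using h

end Cylinder

/-! ### Integration over the mesh -/

/-- A map which is `C`-Lipschitz at every point, in a neighbourhood depending on the point,
is `C`-Lipschitz. -/
theorem lipschitzWith_of_eventually {E F : Type*} [NormedAddCommGroup E] [NormedSpace ℝ E]
    [NormedAddCommGroup F] {f : E → F} {C : NNReal}
    (h : ∀ x, ∀ᶠ y in nhds x, ‖f y - f x‖ ≤ C * ‖y - x‖) : LipschitzWith C f := by
  have hf : Continuous f := by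
    refine continuous_iff_continuousAt.2 fun x => ?_
    rw [ContinuousAt, tendsto_iff_norm_sub_tendsto_zero]
    refine squeeze_zero' (Filter.Eventually.of_forall fun _ => norm_nonneg _) (h x) ?_
    have : Continuous fun y : E => (C : ℝ) * ‖y - x‖ := by fun_prop
    simpa using this.tendsto x
  refine LipschitzWith.of_dist_le_mul fun y x => ?_
  rw [dist_eq_norm, dist_eq_norm]
  let c : ℝ → E := fun s => x + s • (y - x)
  have hc : Continuous c := by fun_prop
  let S : Set ℝ := {s | ‖f (c s) - f x‖ ≤ C * (s * ‖y - x‖)}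
  have hS : IsClosed S := isClosed_le (by fun_prop) (by fun_prop)
  have hsub : Icc (0 : ℝ) 1 ⊆ S := by
    -- Continuous induction along the segment: `S` is closed, contains 0, and with each of its
    -- points a right neighbourhood of it.
    refine (hS.inter isClosed_Icc).Icc_subset_of_forall_mem_nhdsWithin (by simp [S, c]) ?_
    rintro s ⟨hs, -⟩
    have h1 := (hc.tendsto s).eventually (h (c s))
    filter_upwards [nhdsWithin_le_nhds h1, self_mem_nhdsWithin] with t ht hst
    have hst : s < t := hst
    have h2 : ‖c t - c s‖ = (t - s) * ‖y - x‖ := by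
      have : c t - c s = (t - s) • (y - x) := by simp only [c, sub_smul]; abel
      rw [this, norm_smul, Real.norm_of_nonneg (sub_pos.2 hst).le]
    rw [h2] at ht
    have hs : ‖f (c s) - f x‖ ≤ C * (s * ‖y - x‖) := hs
    calc ‖f (c t) - f x‖ ≤ ‖f (c t) - f (c s)‖ + ‖f (c s) - f x‖ :=
          norm_sub_le_norm_sub_add_norm_sub _ _ _
      _ ≤ C * ((t - s) * ‖y - x‖) + C * (s * ‖y - x‖) := add_le_add ht hs
      _ = C * (t * ‖y - x‖) := by ring
  have h1 : ‖f (c 1) - f x‖ ≤ C * (1 * ‖y - x‖) := hsub ⟨zero_le_one, le_rfl⟩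
  simpa [c] using h1

theorem ae_ae_of_ae_prod_swap {α β : Type*} [MeasurableSpace α] [MeasurableSpace β]
    {μ : Measure α} {ν : Measure β} [SFinite μ] [SFinite ν] {p : α × β → Prop}
    (h : ∀ᵐ z ∂μ.prod ν, p z) : ∀ᵐ y ∂ν, ∀ᵐ x ∂μ, p (x, y) :=
  Measure.ae_ae_of_ae_prod (Measure.measurePreserving_swap.quasiMeasurePreserving.ae h)

section Integration

variable {d : ℕ} {Ω : Set (Sp d)} {T : ℝ} (K : Mesh Ω T)

theorem Mesh.ae_mem_core :
    ∀ᵐ z : ST d, z ∈ closure (stDom Ω T) → ∃ j, z ∈ (K.elem j).core := by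
  have h : ∀ᵐ z : ST d, ∀ j, z ∉ (K.elem j).carrier \ (K.elem j).core :=
    ae_all_iff.2 fun j => measure_eq_zero_iff_ae_notMem.1 (K.elem j).volume_carrier_diff_core
  filter_upwards [h] with z hz hzD
  obtain ⟨j, hj⟩ := K.exists_mem_carrier hzD
  exact ⟨j, by_contra fun hn => hz j ⟨hj, hn⟩⟩

variable (hΩo : IsOpen Ω) (hΩl : HasLipschitzBoundary Ω) (hT : 0 < T)

/-- Only the core matters for integrals, so g may take arbitrary values on the faces, where a finite
element function need not be differentiable. -/
theorem Element.integrableOn_of_eqOn_core {e : Element d} {g g' : ST d → ℝ}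
    (hg' : ContinuousOn g' e.carrier) (h : EqOn g g' e.core) :
    IntegrableOn g e.carrier ∧ ∫ z in e.carrier, g z = ∫ z in e.carrier, g' z := by
  have hae : g' =ᵐ[volume.restrict e.carrier] g := by
    rw [Filter.EventuallyEq, ae_restrict_iff' e.isCompact_carrier.measurableSet]
    filter_upwards [measure_eq_zero_iff_ae_notMem.1 e.volume_carrier_diff_core] with z hz hzc
    exact (h (by_contra fun hn => hz ⟨hzc, hn⟩)).symm
  exact ⟨(hg'.integrableOn_compact e.isCompact_carrier).congr_fun_ae hae,
    (integral_congr_ae hae).symm⟩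

-- Almost every point of the closed cylinder lies in some core, and cores lie in the open cylinder.
-- The boundary is thus null without any measure estimate for ∂Ω.
include hΩo hΩl hT in
theorem Mesh.stDom_ae_eq : stDom Ω T =ᵐ[volume] ⋃ j, (K.elem j).carrier := by
  rw [K.cover]
  filter_upwards [K.ae_mem_core] with z hz
  refine propext ⟨fun h => subset_closure h, fun h => ?_⟩
  obtain ⟨j, hj⟩ := hz h
  exact K.core_subset_stDom hΩo hΩl hT j hj

include hΩo hΩl hT in
theorem Mesh.integral_stDom {g : ST d → ℝ} {g' : Fin K.card → ST d → ℝ}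
    (hg' : ∀ j, ContinuousOn (g' j) (K.elem j).carrier)
    (h : ∀ j, EqOn g (g' j) (K.elem j).core) :
    IntegrableOn g (stDom Ω T) ∧
      ∫ z in stDom Ω T, g z = ∑ j, ∫ z in (K.elem j).carrier, g' j z := by
  have hint : IntegrableOn g (⋃ j, (K.elem j).carrier) :=
    integrableOn_finite_iUnion.2 fun j => (Element.integrableOn_of_eqOn_core (hg' j) (h j)).1
  have hae := K.stDom_ae_eq hΩo hΩl hT
  refine ⟨hint.congr_set_ae hae, ?_⟩
  rw [setIntegral_congr_set hae, integral_iUnion_ae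
    (fun j => (K.elem j).isCompact_carrier.measurableSet.nullMeasurableSet) K.nonoverlap hint,
    tsum_fintype]
  exact Finset.sum_congr rfl fun j _ => (Element.integrableOn_of_eqOn_core (hg' j) (h j)).2

-- The final faces cover the closure of Ω. The vanishing of g on ∂Ω takes the place of knowing that
-- ∂Ω is null.
include hΩo hT in
theorem Mesh.integral_top {g : Sp d → ℝ} (hg : ContinuousOn g (closure Ω))
    (h0 : ∀ x ∈ frontier Ω, g x = 0) :
    ∫ x in Ω, g x = ∑ j, ∫ x in (K.elem j).top T, g x := by
  have hsub : ∀ j, (K.elem j).top T ⊆ closure Ω := fun j =>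
    K.iUnion_top hT ▸ subset_iUnion (fun j => (K.elem j).top T) j
  have hint : IntegrableOn g (⋃ j, (K.elem j).top T) :=
    integrableOn_finite_iUnion.2 fun j =>
      (hg.mono (hsub j)).integrableOn_compact (K.elem j).isCompact_top
  rw [← tsum_fintype (L := SummationFilter.unconditional _), ← integral_iUnion_ae
    (fun j => (K.elem j).isCompact_top.measurableSet.nullMeasurableSet) K.nonoverlap_top hint,
    K.iUnion_top hT]
  refine (setIntegral_eq_of_subset_of_forall_sdiff_eq_zero measurableSet_closure subset_closure
    ?_).symm
  rintro x ⟨hx, hn⟩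
  exact h0 x ⟨hx, by rwa [hΩo.interior_eq]⟩

/-! ### Integration by parts for continuous, elementwise smooth functions -/

/-- Functions which are continuous on the closed cylinder and smooth on every element. -/
structure Mesh.PiecewiseSmooth (G : ST d → ℝ) : Prop where
  cont : ContinuousOn G (closure (stDom Ω T))
  smooth : ∀ j, ContDiffOn ℝ ∞ G (K.elem j).carrier

variable {K}

theorem Mesh.PiecewiseSmooth.mul {G H : ST d → ℝ} (hG : K.PiecewiseSmooth G)
    (hH : K.PiecewiseSmooth H) : K.PiecewiseSmooth fun z => G z * H z :=
  ⟨hG.cont.mul hH.cont, fun j => (hG.smooth j).mul (hH.smooth j)⟩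

theorem Mesh.PiecewiseSmooth.of_contDiff {G : ST d → ℝ} (hG : ContDiff ℝ ∞ G) :
    K.PiecewiseSmooth G :=
  ⟨hG.continuous.continuousOn, fun _ => hG.contDiffOn⟩

/-- A point close to z lies only in elements containing z, these being finitely many closed sets. On
such an element the bound follows from differentiability at z and a uniform bound on the elementwise
derivatives. The constant is global while the neighbourhood depends on z, as
`lipschitzWith_of_eventually` requires. -/
theorem Mesh.PiecewiseSmooth.exists_lipschitz_bound {G : ST d → ℝ}
    (hG : K.PiecewiseSmooth G) : ∃ C : NNReal, ∀ z, ∀ᶠ w in nhds z, ∀ j,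
      w ∈ (K.elem j).carrier → z ∈ (K.elem j).carrier ∧ ‖G w - G z‖ ≤ C * ‖w - z‖ := by
  have h1 : ∀ j, ∃ C : ℝ, ∀ z ∈ (K.elem j).carrier,
      ‖fderivWithin ℝ G (K.elem j).carrier z‖ ≤ C := fun j =>
    (K.elem j).isCompact_carrier.exists_bound_of_continuousOn
      ((hG.smooth j).continuousOn_fderivWithin (K.elem j).uniqueDiffOn_carrier (by simp))
  choose C hC using h1
  -- The bound is strict so that the gap `M - ‖A‖` can absorb the little-o term.
  have hC' : ∃ M : NNReal, ∀ j, C j < M := by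
    obtain ⟨M, hM⟩ := (finite_range C).bddAbove
    exact ⟨⟨|M| + 1, by positivity⟩, fun j =>
      lt_of_le_of_lt ((hM ⟨j, rfl⟩).trans (le_abs_self M)) (by
        change |M| < |M| + 1; linarith)⟩
  obtain ⟨M, hM⟩ := hC'
  refine ⟨M, fun z => Filter.eventually_all.2 fun j => ?_⟩
  by_cases hz : z ∈ (K.elem j).carrier
  · have h2 := (((hG.smooth j).differentiableOn (by simp)) z hz).hasFDerivWithinAt
    have h3 := h2.isLittleO.def (sub_pos.2 ((hC j z hz).trans_lt (hM j)))
    filter_upwards [eventually_nhdsWithin_iff.1 h3] with w hw hwj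
    refine ⟨hz, ?_⟩
    have h4 := hw hwj
    set A := fderivWithin ℝ G (K.elem j).carrier z
    calc ‖G w - G z‖ = ‖(G w - G z - A (w - z)) + A (w - z)‖ := by rw [sub_add_cancel]
      _ ≤ (M - ‖A‖) * ‖w - z‖ + ‖A‖ * ‖w - z‖ :=
        (norm_add_le _ _).trans (add_le_add h4 (A.le_opNorm _))
      _ = M * ‖w - z‖ := by ring
  · filter_upwards [(K.elem j).isCompact_carrier.isClosed.isOpen_compl.mem_nhds hz] with w hw hwj
    exact absurd hwj hw

theorem Mesh.PiecewiseSmooth.hasFDerivAt {G : ST d → ℝ} (hG : K.PiecewiseSmooth G)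
    {j : Fin K.card} {z : ST d} (hz : z ∈ (K.elem j).core) : HasFDerivAt G (fderiv ℝ G z) z :=
  ((((hG.smooth j).differentiableOn (by simp)) z ((K.elem j).core_subset hz)).differentiableAt
    (Filter.mem_of_superset ((K.elem j).isOpen_core.mem_nhds hz)
      (K.elem j).core_subset)).hasFDerivAt

theorem Mesh.fderivWithin_carrier {F : Type*} [NormedAddCommGroup F] [NormedSpace ℝ F]
    (G : ST d → F) {j : Fin K.card} {z : ST d}
    (hz : z ∈ (K.elem j).core) : fderivWithin ℝ G (K.elem j).carrier z = fderiv ℝ G z :=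
  fderivWithin_of_mem_nhds (Filter.mem_of_superset ((K.elem j).isOpen_core.mem_nhds hz)
    (K.elem j).core_subset)

include hΩo hΩl hT in
theorem Mesh.fderivWithin_stDom {F : Type*} [NormedAddCommGroup F] [NormedSpace ℝ F]
    (G : ST d → F) {j : Fin K.card} {z : ST d}
    (hz : z ∈ (K.elem j).core) :
    fderivWithin ℝ G (stDom Ω T) z = fderivWithin ℝ G (K.elem j).carrier z := by
  rw [K.fderivWithin_carrier G hz]
  exact fderivWithin_of_mem_nhds (Filter.mem_of_superset ((K.elem j).isOpen_core.mem_nhds hz)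
    (K.core_subset_stDom hΩo hΩl hT j))

include hΩo hΩl hT in
theorem Mesh.PiecewiseSmooth.integral_fderivWithin {G : ST d → ℝ} (hG : K.PiecewiseSmooth G)
    (w : ST d) : IntegrableOn (fun z => fderiv ℝ G z w) (stDom Ω T) ∧
      ∑ j, ∫ z in (K.elem j).carrier, fderivWithin ℝ G (K.elem j).carrier z w =
        ∫ z in stDom Ω T, fderiv ℝ G z w := by
  have h := K.integral_stDom hΩo hΩl hT (g := fun z => fderiv ℝ G z w)
    (g' := fun j z => fderivWithin ℝ G (K.elem j).carrier z w)
    (fun j => ((hG.smooth j).continuousOn_fderivWithin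
      (K.elem j).uniqueDiffOn_carrier (by simp)).clm_apply continuousOn_const)
    (fun j z hz => by simp only [K.fderivWithin_carrier G hz])
  exact ⟨h.1, h.2.symm⟩

theorem volume_restrict_stDom : (volume.restrict (stDom Ω T) : Measure (ST d)) =
    (volume.restrict Ω).prod (volume.restrict (Ioo 0 T)) := by
  rw [Measure.prod_restrict]; rfl

variable (hΩb : Bornology.IsBounded Ω)

include hΩo hΩl hT hΩb in
/-- The integral of a spatial derivative of a function vanishing on the lateral boundary. -/
theorem Mesh.PiecewiseSmooth.integral_dx {G : ST d → ℝ} (hG : K.PiecewiseSmooth G)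
    (h0 : ∀ z ∈ sideBdry Ω T, G z = 0) (i : Fin d) :
    ∑ j, ∫ z in (K.elem j).carrier, dx (K.elem j).carrier i G z = 0 := by
  obtain ⟨hint, heq⟩ := hG.integral_fderivWithin hΩo hΩl hT (EuclideanSpace.single i 1, 0)
  unfold dx
  rw [heq, volume_restrict_stDom, integral_prod_symm _ (by
    rw [← volume_restrict_stDom]; exact hint)]
  have hcore := ae_ae_of_ae_prod_swap (μ := (volume : Measure (Sp d)))
    (ν := (volume : Measure ℝ)) K.ae_mem_core
  refine integral_eq_zero_of_ae ?_
  filter_upwards [ae_restrict_of_ae hcore, ae_restrict_mem measurableSet_Ioo] with t ht ht0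
  classical
  -- The slice at time t, extended by zero, is Lipschitz with compact support on all of ℝ^d because
  -- G vanishes on ∂Ω × {t}.
  let g : Sp d → ℝ := fun x => if x ∈ Ω then G (x, t) else 0
  obtain ⟨C, hC⟩ := hG.exists_lipschitz_bound
  have hmem : ∀ x ∈ closure Ω, (x, t) ∈ closure (stDom Ω T) := fun x hx => by
    rw [closure_stDom hT]; exact ⟨hx, Ioo_subset_Icc_self ht0⟩
  have hg0 : ∀ x ∈ closure Ω, g x = G (x, t) := by
    intro x hx
    by_cases hxΩ : x ∈ Ω
    · simp [g, hxΩ]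
    · rw [h0 (x, t) ⟨⟨hx, by rwa [hΩo.interior_eq]⟩, ht0⟩]
      simp [g, hxΩ]
  have hlip : LipschitzWith C g := by
    refine lipschitzWith_of_eventually fun x => ?_
    have h1 : ∀ᶠ y in nhds x, ∀ j, (y, t) ∈ (K.elem j).carrier →
        (x, t) ∈ (K.elem j).carrier ∧ ‖G (y, t) - G (x, t)‖ ≤ C * ‖y - x‖ := by
      have hcont : Continuous fun y : Sp d => (y, t) := by fun_prop
      filter_upwards [(hcont.tendsto x).eventually (hC (x, t))] with y hy j hj
      simpa [Prod.norm_def] using hy j hj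
    by_cases hx : x ∈ Ω
    · filter_upwards [h1, hΩo.mem_nhds hx] with y hy hyΩ
      obtain ⟨j, hj⟩ := K.exists_mem_carrier (hmem y (subset_closure hyΩ))
      rw [hg0 y (subset_closure hyΩ), hg0 x (subset_closure hx)]
      exact (hy j hj).2
    · filter_upwards [h1] with y hy
      by_cases hyΩ : y ∈ Ω
      · obtain ⟨j, hj⟩ := K.exists_mem_carrier (hmem y (subset_closure hyΩ))
        have h2 := K.carrier_subset j (hy j hj).1
        rw [closure_stDom hT] at h2
        rw [hg0 y (subset_closure hyΩ), hg0 x h2.1]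
        exact (hy j hj).2
      · simp only [g, hx, hyΩ, if_false, sub_self, norm_zero]
        positivity
  have hsupp : HasCompactSupport g := by
    refine HasCompactSupport.of_support_subset_isCompact hΩb.isCompact_closure ?_
    intro x hx
    by_contra hn
    exact hx (if_neg fun h => hn (subset_closure h))
  -- Integration by parts against the constant 1. Moving the derivative reverses the direction, so
  -- −e_i is used to obtain the derivative of g along e_i.
  have hmain := LipschitzWith.integral_lineDeriv_mul_eq (μ := volume)
    (LipschitzWith.const (1 : ℝ)) hlip hsupp (-EuclideanSpace.single i 1)
  have hz : ∀ x : Sp d, lineDeriv ℝ (fun _ : Sp d => (1 : ℝ)) x (-EuclideanSpace.single i 1) = 0 :=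
    fun x => by simp [lineDeriv]
  simp only [hz, zero_mul, integral_zero, neg_neg, mul_one] at hmain
  refine Eq.trans ?_ hmain.symm
  rw [← integral_indicator hΩo.measurableSet]
  refine integral_congr_ae ?_
  filter_upwards [ht] with x hx
  by_cases hxc : x ∈ closure Ω
  · obtain ⟨j, hj⟩ := hx (hmem x hxc)
    have hxΩ : x ∈ Ω := (K.core_subset_stDom hΩo hΩl hT j hj).1
    rw [indicator_of_mem hxΩ]
    have h1 : HasFDerivAt g ((fderiv ℝ G (x, t)).comp (ContinuousLinearMap.inl ℝ (Sp d) ℝ)) x := by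
      refine (((hG.hasFDerivAt hj).comp x (hasFDerivAt_prodMk_left x t))).congr_of_eventuallyEq ?_
      filter_upwards [hΩo.mem_nhds hxΩ] with y hy
      exact hg0 y (subset_closure hy)
    rw [(h1.hasLineDerivAt _).lineDeriv]
    simp
  · rw [indicator_of_notMem fun h => hxc (subset_closure h)]
    have h1 : HasFDerivAt g (0 : Sp d →L[ℝ] ℝ) x := by
      refine (hasFDerivAt_const (0 : ℝ) x).congr_of_eventuallyEq ?_
      filter_upwards [isClosed_closure.isOpen_compl.mem_nhds hxc] with y hy
      exact if_neg fun h => hy (subset_closure h)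
    rw [(h1.hasLineDerivAt _).lineDeriv]
    simp

include hΩo hΩl hT in
/-- The integral of the time derivative of a function vanishing at the initial time. -/
theorem Mesh.PiecewiseSmooth.integral_dt {G : ST d → ℝ} (hG : K.PiecewiseSmooth G)
    (h0 : ∀ z ∈ initBdry Ω, G z = 0) :
    ∑ j, ∫ z in (K.elem j).carrier, dt (K.elem j).carrier G z = ∫ x in Ω, G (x, T) := by
  obtain ⟨hint, heq⟩ := hG.integral_fderivWithin hΩo hΩl hT (0, 1)
  unfold dt
  rw [heq, volume_restrict_stDom, integral_prod _ (by
    rw [← volume_restrict_stDom]; exact hint)]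
  have hcore := Measure.ae_ae_of_ae_prod (μ := (volume : Measure (Sp d)))
    (ν := (volume : Measure ℝ)) K.ae_mem_core
  refine integral_congr_ae ?_
  filter_upwards [ae_restrict_of_ae hcore, ae_restrict_mem hΩo.measurableSet] with x hx hxΩ
  obtain ⟨C, hC⟩ := hG.exists_lipschitz_bound
  -- Clamping time to [0, T] gives a Lipschitz function on the whole line. It is absolutely
  -- continuous, so the fundamental theorem applies although the derivative is known only almost
  -- everywhere.
  let g : ℝ → ℝ := fun t => G (x, projIcc 0 T hT.le t)
  have hmem : ∀ t : ℝ, (x, (projIcc 0 T hT.le t : ℝ)) ∈ closure (stDom Ω T) := fun t => by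
    rw [closure_stDom hT]; exact ⟨subset_closure hxΩ, (projIcc 0 T hT.le t).2⟩
  have hlip : LipschitzWith C g := by
    refine lipschitzWith_of_eventually fun s => ?_
    have hcont : Continuous fun t : ℝ => (x, (projIcc 0 T hT.le t : ℝ)) := by fun_prop
    filter_upwards [(hcont.tendsto s).eventually (hC _)] with t ht
    obtain ⟨j, hj⟩ := K.exists_mem_carrier (hmem t)
    refine (ht j hj).2.trans ?_
    gcongr
    simp only [Prod.norm_def, Prod.mk_sub_mk, sub_self, norm_zero]
    refine max_le (norm_nonneg _) ?_
    simpa [Subtype.dist_eq, Real.dist_eq] using (LipschitzWith.projIcc hT.le).dist_le_mul t s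
  have hFTC := ((hlip.lipschitzOnWith (s := uIcc 0 T)).absolutelyContinuousOnInterval
    ).integral_deriv_eq_sub
  have h1 : g T = G (x, T) := by simp [g]
  have h2 : g 0 = 0 := by
    simp only [g, projIcc_left]
    exact h0 (x, 0) ⟨subset_closure hxΩ, rfl⟩
  rw [h1, h2, sub_zero, intervalIntegral.integral_of_le hT.le, integral_Ioc_eq_integral_Ioo]
    at hFTC
  refine Eq.trans ?_ hFTC
  refine setIntegral_congr_ae measurableSet_Ioo ?_
  filter_upwards [hx] with t ht ht0
  obtain ⟨j, hj⟩ := ht (subset_closure ⟨hxΩ, ht0⟩)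
  have h3 : HasDerivAt g (fderiv ℝ G (x, t) (0, 1)) t := by
    have h4 : HasDerivAt (fun s : ℝ => (x, s)) ((0 : Sp d), (1 : ℝ)) t :=
      (hasDerivAt_const t x).prodMk (hasDerivAt_id t)
    refine ((hG.hasFDerivAt hj).comp_hasDerivAt t h4).congr_of_eventuallyEq ?_
    filter_upwards [Ioo_mem_nhds ht0.1 ht0.2] with s hs
    simp [g, projIcc_of_mem hT.le (Ioo_subset_Icc_self hs)]
  exact h3.deriv.symm

end Integration

/-! ### Elementwise stabilized forms in an abstract setting -/

/-- A stabilized form assembled from elementwise contributions. Velocities `V` and pressures `Q`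
are mapped linearly into Hilbert spaces belonging to the elements (`H`, `HG`, `HS`) and to their
final time faces (`HT`). -/
structure StabilizedData {ι : Type*} (V Q : Type*) [AddCommGroup V] [Module ℝ V]
    [AddCommGroup Q] [Module ℝ Q] (H HG HS HT E : ι → Type*)
    [∀ j, NormedAddCommGroup (H j)] [∀ j, InnerProductSpace ℝ (H j)]
    [∀ j, NormedAddCommGroup (HG j)] [∀ j, InnerProductSpace ℝ (HG j)]
    [∀ j, NormedAddCommGroup (HS j)] [∀ j, InnerProductSpace ℝ (HS j)]
    [∀ j, NormedAddCommGroup (HT j)] [∀ j, InnerProductSpace ℝ (HT j)]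
    [∀ j, NormedAddCommGroup (E j)] [∀ j, NormedSpace ℝ (E j)] where
  val : ∀ j, V →ₗ[ℝ] H j
  grd : ∀ j, V →ₗ[ℝ] HG j
  dvg : ∀ j, V →ₗ[ℝ] HS j
  lpl : ∀ j, V →ₗ[ℝ] H j
  -- The residual is split into ∂_t u + ∇p, free of a, and the part `adv`, bilinear in (a, u), so
  -- that its dependence on the convection field is explicit.
  res : ∀ j, V × Q →ₗ[ℝ] H j
  adv : ∀ j, V →ₗ[ℝ] V →ₗ[ℝ] H j
  prs : ∀ j, Q →ₗ[ℝ] HS j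
  valT : ∀ j, V →ₗ[ℝ] HT j
  lplT : ∀ j, V →ₗ[ℝ] HT j
  resT : ∀ j, V × Q →ₗ[ℝ] HT j
  advT : ∀ j, V →ₗ[ℝ] V →ₗ[ℝ] HT j
  eval : ∀ j, V →ₗ[ℝ] E j
  -- Stands for |ã|_∞, which is not linear in the field. Only its Lipschitz continuity in the
  -- supremum norm, here the norm of `eval`, is used to compare two fields.
  spd : ι → V → ℝ
  ν : ℝ
  c₁ : ℝ
  κ : ι → ℝ
  β : ι → ℝ
  γ₀ : ℝ
  γ₁ : ι → ℝ
  ν_pos : 0 < ν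
  two_lt_c₁ : 2 < c₁
  κ_pos : ∀ j, 0 < κ j
  β_pos : ∀ j, 0 < β j
  γ₀_nonneg : 0 ≤ γ₀
  γ₁_nonneg : ∀ j, 0 ≤ γ₁ j
  spd_nonneg : ∀ j a, 0 ≤ spd j a
  spd_lip : ∀ j a b, |spd j a - spd j b| ≤ ‖eval j (a - b)‖
  norm_lpl_le : ∀ j v, ‖lpl j v‖ ≤ κ j * ‖grd j v‖
  norm_lplT_le : ∀ j v, ‖lplT j v‖ ≤ κ j ^ 2 * ‖valT j v‖
  grd_inj : ∀ v, (∀ j, grd j v = 0) → v = 0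

namespace StabilizedData

variable {ι : Type*} [Fintype ι] {V Q : Type*} [AddCommGroup V] [Module ℝ V]
    [AddCommGroup Q] [Module ℝ Q] {H HG HS HT E : ι → Type*}
    [∀ j, NormedAddCommGroup (H j)] [∀ j, InnerProductSpace ℝ (H j)]
    [∀ j, NormedAddCommGroup (HG j)] [∀ j, InnerProductSpace ℝ (HG j)]
    [∀ j, NormedAddCommGroup (HS j)] [∀ j, InnerProductSpace ℝ (HS j)]
    [∀ j, NormedAddCommGroup (HT j)] [∀ j, InnerProductSpace ℝ (HT j)]
    [∀ j, NormedAddCommGroup (E j)] [∀ j, NormedSpace ℝ (E j)]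
    (S : StabilizedData V Q H HG HS HT E)

/-- The convective residual `M[a]u + ∇p` on the elements. -/
def X (j : ι) (a : V) : V × Q →ₗ[ℝ] H j := S.res j + S.adv j a ∘ₗ LinearMap.fst ℝ V Q

/-- The convective residual `M[a]u + ∇p` on the final time faces. -/
def XT (j : ι) (a : V) : V × Q →ₗ[ℝ] HT j := S.resT j + S.advT j a ∘ₗ LinearMap.fst ℝ V Q

def τ (j : ι) (a : V) : ℝ := (S.c₁ * S.κ j ^ 2 * S.ν + S.β j * S.spd j a)⁻¹

def τc (j : ι) (a : V) : ℝ := S.γ₀ + S.γ₁ j * S.spd j a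

/-- The stabilized form, as a sum over the elements. -/
def form (a : V) (φ ψ : V × Q) : ℝ :=
  ∑ j, (-inner ℝ (S.val j φ.1) (S.X j a (ψ.1, 0)) + S.ν * inner ℝ (S.grd j φ.1) (S.grd j ψ.1)
    - inner ℝ (S.prs j φ.2) (S.dvg j ψ.1) + inner ℝ (S.dvg j φ.1) (S.prs j ψ.2)
    + inner ℝ (S.valT j φ.1) (S.valT j ψ.1)
    + S.τ j a * inner ℝ (S.X j a φ - S.ν • S.lpl j φ.1) (S.X j a ψ + S.ν • S.lpl j ψ.1)
    + S.τc j a * inner ℝ (S.dvg j φ.1) (S.dvg j ψ.1)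
    - S.τ j a * inner ℝ (S.XT j a φ - S.ν • S.lplT j φ.1) (S.valT j ψ.1))

def rhs (F : ∀ j, H j) (FT : ∀ j, HT j) (a : V) (ψ : V × Q) : ℝ :=
  ∑ j, (inner ℝ (F j) (S.val j ψ.1)
    + S.τ j a * inner ℝ (F j) (S.X j a ψ - S.ν • S.lpl j ψ.1)
    - S.τ j a * inner ℝ (FT j) (S.valT j ψ.1))

def triSq (a : V) (φ : V × Q) : ℝ :=
  ∑ j, (‖S.valT j φ.1‖ ^ 2 + S.ν * ‖S.grd j φ.1‖ ^ 2 + S.τ j a * ‖S.X j a φ‖ ^ 2)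

def tri (a : V) (φ : V × Q) : ℝ := √(S.triSq a φ)

def lamSq (F : ∀ j, H j) (FT : ∀ j, HT j) (a : V) : ℝ :=
  ∑ j, (‖S.ν⁻¹ • F j‖ ^ 2 + 2 * (S.τ j a * ‖F j‖ ^ 2) + S.τ j a * ‖FT j‖ ^ 2)

def lam (F : ∀ j, H j) (FT : ∀ j, HT j) (a : V) : ℝ := √(S.lamSq F FT a)

/-- The broken gradient, with values in the Hilbert sum over the elements. -/
def grad : V →ₗ[ℝ] PiLp 2 HG where
  toFun v := WithLp.toLp 2 fun j => S.grd j v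
  map_add' u v := by ext j; simp
  map_smul' c v := by ext j; simp

theorem norm_grad_sq (v : V) : ‖S.grad v‖ ^ 2 = ∑ j, ‖S.grd j v‖ ^ 2 := by
  rw [PiLp.norm_sq_eq_of_L2]; rfl

theorem norm_grd_le (j : ι) (v : V) : ‖S.grd j v‖ ≤ ‖S.grad v‖ :=
  PiLp.norm_apply_le (S.grad v) j

theorem grad_injective : Function.Injective S.grad := by
  refine (injective_iff_map_eq_zero _).2 fun v hv => S.grd_inj v fun j => ?_
  have := S.norm_grd_le j v
  rw [hv, norm_zero] at this
  exact norm_le_zero_iff.1 this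

/-! ### Bounds from finite dimensionality -/

section Bounds

variable [FiniteDimensional ℝ V]

/-- The broken gradient is injective, so its norm is a norm on the finite-dimensional space V and
every linear map is bounded for it. This serves as Poincaré inequality and as a source of further
inverse estimates, with constants depending on the mesh. -/
theorem exists_bound {F : ι → Type*} [∀ j, NormedAddCommGroup (F j)] [∀ j, NormedSpace ℝ (F j)]
    (A : ∀ j, V →ₗ[ℝ] F j) : ∃ C ≥ 0, ∀ j v, ‖A j v‖ ≤ C * ‖S.grad v‖ := by
  let _ : NormedAddCommGroup V := NormedAddCommGroup.induced V (PiLp 2 HG) S.grad S.grad_injective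
  let _ : NormedSpace ℝ V := NormedSpace.induced ℝ V (PiLp 2 HG) S.grad
  refine ⟨∑ j, ‖(A j).toContinuousLinearMap‖, by positivity, fun j v => ?_⟩
  refine ((A j).toContinuousLinearMap.le_opNorm v).trans ?_
  refine mul_le_mul_of_nonneg_right ?_ (norm_nonneg (S.grad v))
  exact Finset.single_le_sum (f := fun j => ‖(A j).toContinuousLinearMap‖)
    (fun _ _ => norm_nonneg _) (Finset.mem_univ j)

/-- The linear case, applied to the curried map into the continuous linear maps. -/
theorem exists_bound₂ {F : ι → Type*} [∀ j, NormedAddCommGroup (F j)] [∀ j, NormedSpace ℝ (F j)]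
    (A : ∀ j, V →ₗ[ℝ] V →ₗ[ℝ] F j) :
    ∃ C ≥ 0, ∀ j u v, ‖A j u v‖ ≤ C * ‖S.grad u‖ * ‖S.grad v‖ := by
  let _ : NormedAddCommGroup V := NormedAddCommGroup.induced V (PiLp 2 HG) S.grad S.grad_injective
  let _ : NormedSpace ℝ V := NormedSpace.induced ℝ V (PiLp 2 HG) S.grad
  let A' : ∀ j, V →ₗ[ℝ] V →L[ℝ] F j := fun j =>
    (LinearMap.toContinuousLinearMap : (V →ₗ[ℝ] F j) ≃ₗ[ℝ] V →L[ℝ] F j).toLinearMap ∘ₗ A j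
  obtain ⟨C, hC, h⟩ := S.exists_bound A'
  refine ⟨C, hC, fun j u v => ?_⟩
  exact ((A' j u).le_opNorm v).trans
    (mul_le_mul_of_nonneg_right (h j u) (norm_nonneg (S.grad v)))

end Bounds

/-! #### The stabilization parameters -/

omit [Fintype ι] in
theorem visc_pos (j : ι) : 0 < S.c₁ * S.κ j ^ 2 * S.ν :=
  mul_pos (mul_pos (by linarith [S.two_lt_c₁]) (pow_pos (S.κ_pos j) 2)) S.ν_pos

omit [Fintype ι] in
theorem conv_nonneg (j : ι) (a : V) : 0 ≤ S.β j * S.spd j a :=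
  mul_nonneg (S.β_pos j).le (S.spd_nonneg j a)

omit [Fintype ι] in
theorem τ_pos (j : ι) (a : V) : 0 < S.τ j a :=
  inv_pos.2 (add_pos_of_pos_of_nonneg (S.visc_pos j) (S.conv_nonneg j a))

omit [Fintype ι] in
theorem τ_mul (j : ι) (a : V) : S.τ j a * (S.c₁ * S.κ j ^ 2 * S.ν + S.β j * S.spd j a) = 1 :=
  inv_mul_cancel₀ (add_pos_of_pos_of_nonneg (S.visc_pos j) (S.conv_nonneg j a)).ne'

omit [Fintype ι] in
theorem τc_nonneg (j : ι) (a : V) : 0 ≤ S.τc j a :=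
  add_nonneg S.γ₀_nonneg (mul_nonneg (S.γ₁_nonneg j) (S.spd_nonneg j a))

/-- The viscous part of 1/τ alone bounds τ, uniformly in the convection field. -/
theorem exists_τ_le : ∃ C ≥ 0, ∀ j a, S.τ j a ≤ C := by
  refine ⟨∑ j, (S.c₁ * S.κ j ^ 2 * S.ν)⁻¹,
    Finset.sum_nonneg fun j _ => (inv_pos.2 (S.visc_pos j)).le, fun j a => ?_⟩
  refine le_trans ?_ (Finset.single_le_sum (f := fun j => (S.c₁ * S.κ j ^ 2 * S.ν)⁻¹)
    (fun j _ => (inv_pos.2 (S.visc_pos j)).le) (Finset.mem_univ j))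
  exact inv_anti₀ (S.visc_pos j) (by linarith [S.conv_nonneg j a])

theorem triSq_nonneg (a : V) (φ : V × Q) : 0 ≤ S.triSq a φ :=
  Finset.sum_nonneg fun j _ => by
    have := (S.τ_pos j a).le
    have := S.ν_pos.le
    positivity

theorem tri_nonneg (a : V) (φ : V × Q) : 0 ≤ S.tri a φ := Real.sqrt_nonneg _

theorem tri_sq (a : V) (φ : V × Q) : S.tri a φ ^ 2 = S.triSq a φ :=
  Real.sq_sqrt (S.triSq_nonneg a φ)

theorem lamSq_nonneg (F : ∀ j, H j) (FT : ∀ j, HT j) (a : V) : 0 ≤ S.lamSq F FT a :=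
  Finset.sum_nonneg fun j _ => by
    have := (S.τ_pos j a).le
    positivity

theorem lam_nonneg (F : ∀ j, H j) (FT : ∀ j, HT j) (a : V) : 0 ≤ S.lam F FT a :=
  Real.sqrt_nonneg _

theorem triSq_eq (a : V) (φ : V × Q) : S.triSq a φ =
    ∑ j, ‖S.valT j φ.1‖ ^ 2 + S.ν * ‖S.grad φ.1‖ ^ 2 + ∑ j, S.τ j a * ‖S.X j a φ‖ ^ 2 := by
  rw [norm_grad_sq, Finset.mul_sum, triSq, Finset.sum_add_distrib, Finset.sum_add_distrib]

theorem norm_valT_le (a : V) (φ : V × Q) (j : ι) : ‖S.valT j φ.1‖ ≤ S.tri a φ := by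
  refine Real.le_sqrt_of_sq_le ?_
  refine le_trans ?_ (Finset.single_le_sum (f := fun j => ‖S.valT j φ.1‖ ^ 2 +
    S.ν * ‖S.grd j φ.1‖ ^ 2 + S.τ j a * ‖S.X j a φ‖ ^ 2) (fun j _ => ?_) (Finset.mem_univ j))
  all_goals
    have := (S.τ_pos j a).le
    have := S.ν_pos.le
  · have : 0 ≤ S.ν * ‖S.grd j φ.1‖ ^ 2 + S.τ j a * ‖S.X j a φ‖ ^ 2 := by positivity
    linarith
  · positivity

theorem τ_mul_norm_X_sq_le (a : V) (φ : V × Q) (j : ι) :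
    S.τ j a * ‖S.X j a φ‖ ^ 2 ≤ S.tri a φ ^ 2 := by
  rw [tri_sq]
  refine le_trans ?_ (Finset.single_le_sum (f := fun j => ‖S.valT j φ.1‖ ^ 2 +
    S.ν * ‖S.grd j φ.1‖ ^ 2 + S.τ j a * ‖S.X j a φ‖ ^ 2) (fun j _ => ?_) (Finset.mem_univ j))
  all_goals
    have := (S.τ_pos j a).le
    have := S.ν_pos.le
  · have : 0 ≤ ‖S.valT j φ.1‖ ^ 2 + S.ν * ‖S.grd j φ.1‖ ^ 2 := by positivity
    linarith
  · positivity

theorem ν_mul_norm_grad_sq_le (a : V) (φ : V × Q) :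
    S.ν * ‖S.grad φ.1‖ ^ 2 ≤ S.tri a φ ^ 2 := by
  rw [tri_sq, triSq_eq]
  have h1 : 0 ≤ ∑ j, S.τ j a * ‖S.X j a φ‖ ^ 2 :=
    Finset.sum_nonneg fun j _ => mul_nonneg (S.τ_pos j a).le (sq_nonneg _)
  have h2 : 0 ≤ ∑ j, ‖S.valT j φ.1‖ ^ 2 := by positivity
  linarith

theorem norm_grad_le (a : V) (φ : V × Q) : ‖S.grad φ.1‖ ≤ (√S.ν)⁻¹ * S.tri a φ := by
  have hν := Real.sqrt_pos.2 S.ν_pos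
  rw [inv_mul_eq_div, le_div_iff₀ hν]
  refine abs_le_of_sq_le_sq' ?_ (S.tri_nonneg a φ) |>.2
  rw [mul_pow, Real.sq_sqrt S.ν_pos.le, mul_comm]
  exact S.ν_mul_norm_grad_sq_le a φ

/-- Fields on which the discrete norm vanishes. -/
theorem eq_zero_of_tri_eq_zero {a : V} {φ : V × Q} (h : S.tri a φ = 0) :
    φ.1 = 0 ∧ ∀ j, S.res j φ = 0 := by
  have h1 := S.norm_grad_le a φ
  rw [h, mul_zero, norm_le_zero_iff, ← map_zero S.grad] at h1
  have h2 := S.grad_injective h1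
  refine ⟨h2, fun j => ?_⟩
  have h3 := S.τ_mul_norm_X_sq_le a φ j
  rw [h] at h3
  have h4 : ‖S.X j a φ‖ ^ 2 ≤ 0 :=
    le_of_mul_le_mul_left (by simpa using h3) (S.τ_pos j a)
  have h5 : S.X j a φ = 0 := norm_le_zero_iff.1 (by nlinarith [norm_nonneg (S.X j a φ)])
  simpa [X, h2] using h5

theorem lam_bounds (F : ∀ j, H j) (FT : ∀ j, HT j) (a : V) (j : ι) :
    S.τ j a * ‖F j‖ ^ 2 ≤ S.lam F FT a ^ 2 ∧ S.τ j a * ‖FT j‖ ^ 2 ≤ S.lam F FT a ^ 2 ∧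
      ‖F j‖ ≤ S.ν * S.lam F FT a := by
  have h0 : ∀ j, 0 ≤ S.τ j a := fun j => (S.τ_pos j a).le
  have h1 : ‖S.ν⁻¹ • F j‖ ^ 2 + 2 * (S.τ j a * ‖F j‖ ^ 2) + S.τ j a * ‖FT j‖ ^ 2 ≤
      S.lam F FT a ^ 2 := by
    rw [lam, Real.sq_sqrt (S.lamSq_nonneg F FT a)]
    exact Finset.single_le_sum (f := fun j => ‖S.ν⁻¹ • F j‖ ^ 2 +
      2 * (S.τ j a * ‖F j‖ ^ 2) + S.τ j a * ‖FT j‖ ^ 2)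
      (fun j _ => by have := h0 j; positivity) (Finset.mem_univ j)
  have h2 : 0 ≤ S.τ j a * ‖F j‖ ^ 2 := mul_nonneg (h0 j) (sq_nonneg _)
  have h3 : 0 ≤ S.τ j a * ‖FT j‖ ^ 2 := mul_nonneg (h0 j) (sq_nonneg _)
  refine ⟨by nlinarith [sq_nonneg ‖S.ν⁻¹ • F j‖], by nlinarith [sq_nonneg ‖S.ν⁻¹ • F j‖], ?_⟩
  have h4 : ‖S.ν⁻¹ • F j‖ ≤ S.lam F FT a :=
    abs_le_of_sq_le_sq' (by linarith) (S.lam_nonneg F FT a) |>.2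
  rwa [norm_smul, norm_inv, Real.norm_of_nonneg S.ν_pos.le, inv_mul_le_iff₀ S.ν_pos] at h4

theorem form_eq (a : V) (φ ψ : V × Q) : S.form a φ ψ =
    -∑ j, inner ℝ (S.val j φ.1) (S.X j a (ψ.1, 0))
    + S.ν * ∑ j, inner ℝ (S.grd j φ.1) (S.grd j ψ.1)
    - ∑ j, inner ℝ (S.prs j φ.2) (S.dvg j ψ.1) + ∑ j, inner ℝ (S.dvg j φ.1) (S.prs j ψ.2)
    + ∑ j, inner ℝ (S.valT j φ.1) (S.valT j ψ.1)
    + ∑ j, S.τ j a * inner ℝ (S.X j a φ - S.ν • S.lpl j φ.1) (S.X j a ψ + S.ν • S.lpl j ψ.1)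
    + ∑ j, S.τc j a * inner ℝ (S.dvg j φ.1) (S.dvg j ψ.1)
    - ∑ j, S.τ j a * inner ℝ (S.XT j a φ - S.ν • S.lplT j φ.1) (S.valT j ψ.1) := by
  simp only [form, Finset.sum_add_distrib, Finset.sum_sub_distrib, Finset.sum_neg_distrib,
    Finset.mul_sum]

theorem rhs_eq (F : ∀ j, H j) (FT : ∀ j, HT j) (a : V) (ψ : V × Q) : S.rhs F FT a ψ =
    ∑ j, inner ℝ (F j) (S.val j ψ.1)
    + ∑ j, S.τ j a * inner ℝ (F j) (S.X j a ψ - S.ν • S.lpl j ψ.1)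
    - ∑ j, S.τ j a * inner ℝ (FT j) (S.valT j ψ.1) := by
  simp only [rhs, Finset.sum_add_distrib, Finset.sum_sub_distrib]

theorem lamSq_eq (F : ∀ j, H j) (FT : ∀ j, HT j) (a : V) : S.lamSq F FT a =
    ∑ j, ‖S.ν⁻¹ • F j‖ ^ 2 + 2 * ∑ j, S.τ j a * ‖F j‖ ^ 2 + ∑ j, S.τ j a * ‖FT j‖ ^ 2 := by
  simp only [lamSq, Finset.sum_add_distrib, Finset.mul_sum]

/-! #### Bilinearity -/

theorem form_add_left (a : V) (φ φ' ψ : V × Q) :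
    S.form a (φ + φ') ψ = S.form a φ ψ + S.form a φ' ψ := by
  simp only [form, ← Finset.sum_add_distrib, map_add, Prod.fst_add, Prod.snd_add, smul_add,
    inner_add_left, inner_sub_left]
  exact Finset.sum_congr rfl fun j _ => by ring

theorem form_smul_left (a : V) (c : ℝ) (φ ψ : V × Q) :
    S.form a (c • φ) ψ = c * S.form a φ ψ := by
  simp only [form, Finset.mul_sum, map_smul, Prod.smul_fst, Prod.smul_snd,
    inner_sub_left, inner_smul_left]
  refine Finset.sum_congr rfl fun j _ => ?_
  simp only [RCLike.conj_to_real]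
  ring

theorem form_add_right (a : V) (φ ψ ψ' : V × Q) :
    S.form a φ (ψ + ψ') = S.form a φ ψ + S.form a φ ψ' := by
  have h : ∀ j, S.X j a (ψ.1 + ψ'.1, 0) = S.X j a (ψ.1, 0) + S.X j a (ψ'.1, 0) := fun j => by
    rw [← map_add]; simp
  simp only [form, Prod.fst_add, Prod.snd_add, h, ← Finset.sum_add_distrib, map_add, smul_add,
    inner_add_right]
  exact Finset.sum_congr rfl fun j _ => by ring

theorem form_smul_right (a : V) (c : ℝ) (φ ψ : V × Q) :
    S.form a φ (c • ψ) = c * S.form a φ ψ := by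
  have h : ∀ j, S.X j a (c • ψ.1, 0) = c • S.X j a (ψ.1, 0) := fun j => by
    rw [← map_smul]; simp
  simp only [form, Prod.smul_fst, Prod.smul_snd, h, Finset.mul_sum, map_smul,
    inner_add_right, inner_smul_right]
  exact Finset.sum_congr rfl fun j _ => by ring

/-- The form as a bilinear map. -/
def bilin (a : V) : V × Q →ₗ[ℝ] V × Q →ₗ[ℝ] ℝ :=
  LinearMap.mk₂ ℝ (S.form a) (S.form_add_left a) (fun c φ ψ => S.form_smul_left a c φ ψ)
    (S.form_add_right a) (fun c φ ψ => S.form_smul_right a c φ ψ)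

/-- The right hand side as a linear map. -/
def rhsLin (F : ∀ j, H j) (FT : ∀ j, HT j) (a : V) : V × Q →ₗ[ℝ] ℝ where
  toFun := S.rhs F FT a
  map_add' ψ ψ' := by
    simp only [rhs, ← Finset.sum_add_distrib, map_add, Prod.fst_add, smul_add,
      inner_add_right, inner_sub_right]
    exact Finset.sum_congr rfl fun j _ => by ring
  map_smul' c ψ := by
    simp only [rhs, map_smul, Prod.smul_fst, inner_smul_right, inner_sub_right, smul_eq_mul,
      RingHom.id_apply, Finset.mul_sum]
    exact Finset.sum_congr rfl fun j _ => by ring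

end StabilizedData

namespace StabilizedData

variable {ι : Type*} [Fintype ι] {V Q : Type*} [AddCommGroup V] [Module ℝ V]
    [AddCommGroup Q] [Module ℝ Q] {H HG HS HT E : ι → Type*}
    [∀ j, NormedAddCommGroup (H j)] [∀ j, InnerProductSpace ℝ (H j)]
    [∀ j, NormedAddCommGroup (HG j)] [∀ j, InnerProductSpace ℝ (HG j)]
    [∀ j, NormedAddCommGroup (HS j)] [∀ j, InnerProductSpace ℝ (HS j)]
    [∀ j, NormedAddCommGroup (HT j)] [∀ j, InnerProductSpace ℝ (HT j)]
    [∀ j, NormedAddCommGroup (E j)] [∀ j, NormedSpace ℝ (E j)]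
    (S : StabilizedData V Q H HG HS HT E)

/-! #### Coercivity -/

/-- The two parts of `τ` absorb the two boundary contributions at the same time. -/
theorem boundary_absorption {ν c₁ κ b τ C ε : ℝ} (hν : 0 < ν) (hc₁ : 2 < c₁) (hκ : 0 < κ)
    (hτ : 0 < τ) (hτm : τ * (c₁ * κ ^ 2 * ν + b) = 1) (hC : 0 < C) (hε : 0 < ε)
    (hεb : 1 < ε * b) (hm : ε * C / 2 < 1) :
    τ * (C / (2 * (1 + ε * C / 2)) + ν * κ ^ 2) ≤
      max (2 / c₁) (2 * (ε * C / 2) / (1 + ε * C / 2)) / 2 := by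
  set m := ε * C / 2 with hmdef
  have hm0 : 0 < m := by positivity
  set θ := max (2 / c₁) (2 * m / (1 + m)) with hθ
  have hc0 : 0 < c₁ := by linarith
  have h1 : 2 / c₁ ≤ θ := le_max_left _ _
  have h2 : 2 * m / (1 + m) ≤ θ := le_max_right _ _
  have hb : 0 < b := by
    by_contra hn
    nlinarith
  -- Since C/2 = m/ε, the trace coefficient is m/(ε(1+m)), and 1/ε < b bounds it by bm/(1+m). So the
  -- convective part b of 1/τ pays for the trace, and the viscous part pays for νκ² below.
  have h3 : C / (2 * (1 + m)) ≤ θ / 2 * b := by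
    have h4 : C / (2 * (1 + m)) ≤ (2 * m / (1 + m)) / 2 * b := by
      have h5 : (2 * m / (1 + m)) / 2 * b = C / (2 * (1 + m)) * (ε * b) := by
        rw [hmdef]; field_simp
      rw [h5]
      exact le_mul_of_one_le_right (by positivity) hεb.le
    exact h4.trans (by gcongr)
  have h6 : ν * κ ^ 2 ≤ θ / 2 * (c₁ * κ ^ 2 * ν) := by
    have h7 : ν * κ ^ 2 = (2 / c₁) / 2 * (c₁ * κ ^ 2 * ν) := by field_simp
    rw [h7]
    gcongr
  calc τ * (C / (2 * (1 + m)) + ν * κ ^ 2)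
      ≤ τ * (θ / 2 * b + θ / 2 * (c₁ * κ ^ 2 * ν)) := by gcongr
    _ = θ / 2 * (τ * (c₁ * κ ^ 2 * ν + b)) := by ring
    _ = θ / 2 := by rw [hτm, mul_one]

/-- Young's inequality, weighted so that after the trace bound x² has the coefficient (1+m)/2. For m
< 1 this leaves (1−m)/2 of the residual, while the coefficient of t² is still one that
`boundary_absorption` can pay for. -/
theorem mul_le_of_trace {x y t C m : ℝ} (hC : 0 < C) (hm : 0 < 1 + m) (hy : y ^ 2 ≤ C * x ^ 2) :
    y * t ≤ (1 + m) / 2 * x ^ 2 + C / (2 * (1 + m)) * t ^ 2 := by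
  have h1 : (1 + m) / (2 * C) * y ^ 2 ≤ (1 + m) / 2 * x ^ 2 := by
    calc (1 + m) / (2 * C) * y ^ 2 ≤ (1 + m) / (2 * C) * (C * x ^ 2) := by gcongr
      _ = (1 + m) / 2 * x ^ 2 := by field_simp
  have h2 : 0 ≤ (1 + m) / (2 * C) * (y - C / (1 + m) * t) ^ 2 := by positivity
  have h3 : (1 + m) / (2 * C) * (y - C / (1 + m) * t) ^ 2 =
      (1 + m) / (2 * C) * y ^ 2 - y * t + C / (2 * (1 + m)) * t ^ 2 := by
    field_simp
    ring
  linarith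

theorem coercive {CΓ ε : ℝ} (hCΓ : 0 < CΓ) (hε : 0 < ε) (hεΓ : ε < 2 / CΓ)
    (htr : ∀ j a φ, ‖S.XT j a φ‖ ^ 2 ≤ CΓ * ‖S.X j a φ‖ ^ 2)
    (hibp : ∀ a u, ∑ j, inner ℝ (S.val j u) (S.X j a (u, 0)) =
      ∑ j, (1 / 2 : ℝ) * ‖S.valT j u‖ ^ 2) :
    ∃ Cs > 0, ∀ a, (∀ j, 1 < ε * (S.β j * S.spd j a)) → ∀ φ,
      Cs * S.tri a φ ^ 2 ≤ S.form a φ φ := by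
  have hc := S.two_lt_c₁
  have hc0 : 0 < S.c₁ := by linarith
  set m := ε * CΓ / 2 with hm
  have hm0 : 0 < m := by positivity
  have hm1 : m < 1 := by
    rw [lt_div_iff₀ hCΓ] at hεΓ
    linarith
  set θ := max (2 / S.c₁) (2 * m / (1 + m)) with hθ
  -- Here both strict conditions enter: c₁ > 2 for the first entry, and ε < 2/CΓ, in the form m < 1,
  -- for the second.
  have hθ1 : θ < 1 := by
    refine max_lt ?_ ?_
    · rw [div_lt_one hc0]; exact hc
    · rw [div_lt_one (by linarith)]; linarith
  have hc1 : 0 < 1 - 1 / S.c₁ := by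
    rw [sub_pos, div_lt_one hc0]; linarith
  -- The entries are what survives of the three parts of the norm. The final value keeps the ½ left
  -- by convection minus θ/2 for the faces, the gradient loses 1/c₁ to the Laplacian, and the
  -- residual loses (1+m)/2 to the trace term.
  refine ⟨min (1 / 2 - θ / 2) (min (1 - 1 / S.c₁) ((1 - m) / 2)),
    lt_min (by linarith) (lt_min hc1 (by linarith)), fun a ha φ => ?_⟩
  set Cs := min (1 / 2 - θ / 2) (min (1 - 1 / S.c₁) ((1 - m) / 2)) with hCs
  have hCs1 : Cs ≤ 1 / 2 - θ / 2 := min_le_left _ _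
  have hCs2 : Cs ≤ 1 - 1 / S.c₁ := (min_le_right _ _).trans (min_le_left _ _)
  have hCs3 : Cs ≤ (1 - m) / 2 := (min_le_right _ _).trans (min_le_right _ _)
  -- The convective term has no sign on a single element. The defect in its energy identity is
  -- therefore added on the left, and it vanishes after summation by `hibp`.
  have key : ∀ j, Cs * (‖S.valT j φ.1‖ ^ 2 + S.ν * ‖S.grd j φ.1‖ ^ 2 +
      S.τ j a * ‖S.X j a φ‖ ^ 2) + ((1 / 2 : ℝ) * ‖S.valT j φ.1‖ ^ 2 -
        inner ℝ (S.val j φ.1) (S.X j a (φ.1, 0))) ≤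
      -inner ℝ (S.val j φ.1) (S.X j a (φ.1, 0)) + S.ν * inner ℝ (S.grd j φ.1) (S.grd j φ.1)
    - inner ℝ (S.prs j φ.2) (S.dvg j φ.1) + inner ℝ (S.dvg j φ.1) (S.prs j φ.2)
    + inner ℝ (S.valT j φ.1) (S.valT j φ.1)
    + S.τ j a * inner ℝ (S.X j a φ - S.ν • S.lpl j φ.1) (S.X j a φ + S.ν • S.lpl j φ.1)
    + S.τc j a * inner ℝ (S.dvg j φ.1) (S.dvg j φ.1)
    - S.τ j a * inner ℝ (S.XT j a φ - S.ν • S.lplT j φ.1) (S.valT j φ.1) := by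
    intro j
    have hν := S.ν_pos
    have hκ := S.κ_pos j
    have hτ := S.τ_pos j a
    have hτm := S.τ_mul j a
    have hb := S.conv_nonneg j a
    set t := ‖S.valT j φ.1‖
    set g := ‖S.grd j φ.1‖
    set x := ‖S.X j a φ‖
    set τ := S.τ j a
    set κ := S.κ j
    have e1 : inner ℝ (S.X j a φ - S.ν • S.lpl j φ.1) (S.X j a φ + S.ν • S.lpl j φ.1) =
        x ^ 2 - S.ν ^ 2 * ‖S.lpl j φ.1‖ ^ 2 := by
      simp only [inner_add_right, inner_sub_left, inner_smul_left, inner_smul_right,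
        real_inner_self_eq_norm_sq, RCLike.conj_to_real, real_inner_comm (S.X j a φ) (S.lpl j φ.1)]
      ring
    have e2 : S.ν ^ 2 * ‖S.lpl j φ.1‖ ^ 2 ≤ S.ν ^ 2 * (κ ^ 2 * g ^ 2) := by
      rw [← mul_pow κ]
      gcongr
      exact S.norm_lpl_le j φ.1
    have e3 : inner ℝ (S.XT j a φ - S.ν • S.lplT j φ.1) (S.valT j φ.1) ≤
        ‖S.XT j a φ‖ * t + S.ν * κ ^ 2 * t ^ 2 := by
      refine (real_inner_le_norm _ _).trans ?_
      have e4 : ‖S.XT j a φ - S.ν • S.lplT j φ.1‖ ≤ ‖S.XT j a φ‖ + S.ν * (κ ^ 2 * t) := by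
        refine (norm_sub_le _ _).trans ?_
        rw [norm_smul, Real.norm_of_nonneg hν.le]
        gcongr
        exact S.norm_lplT_le j φ.1
      calc _ ≤ (‖S.XT j a φ‖ + S.ν * (κ ^ 2 * t)) * t := by gcongr
        _ = _ := by ring
    have e5 := mul_le_of_trace (t := t) hCΓ (by linarith : 0 < 1 + m) (htr j a φ)
    have e6 := boundary_absorption hν hc hκ hτ hτm hCΓ hε (ha j) hm1
    rw [← hm, ← hθ] at e6
    have e7 : τ * (S.ν ^ 2 * (κ ^ 2 * g ^ 2)) ≤ 1 / S.c₁ * (S.ν * g ^ 2) := by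
      have e8 : τ * (S.c₁ * κ ^ 2 * S.ν) ≤ 1 := by
        nlinarith [mul_nonneg hτ.le hb]
      have e9 : τ * (S.ν ^ 2 * (κ ^ 2 * g ^ 2)) =
          τ * (S.c₁ * κ ^ 2 * S.ν) * (1 / S.c₁ * (S.ν * g ^ 2)) := by field_simp
      rw [e9]
      exact mul_le_of_le_one_left (by positivity) e8
    have e10 : τ * inner ℝ (S.XT j a φ - S.ν • S.lplT j φ.1) (S.valT j φ.1) ≤
        (1 + m) / 2 * (τ * x ^ 2) + θ / 2 * t ^ 2 := by
      calc _ ≤ τ * ((1 + m) / 2 * x ^ 2 + CΓ / (2 * (1 + m)) * t ^ 2 + S.ν * κ ^ 2 * t ^ 2) := by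
            gcongr; linarith
        _ = (1 + m) / 2 * (τ * x ^ 2) + τ * (CΓ / (2 * (1 + m)) + S.ν * κ ^ 2) * t ^ 2 := by ring
        _ ≤ _ := by gcongr
    have e11 : 0 ≤ S.τc j a * ‖S.dvg j φ.1‖ ^ 2 := mul_nonneg (S.τc_nonneg j a) (sq_nonneg _)
    have e12 : Cs * t ^ 2 ≤ (1 / 2 - θ / 2) * t ^ 2 := by gcongr
    have e13 : Cs * (S.ν * g ^ 2) ≤ (1 - 1 / S.c₁) * (S.ν * g ^ 2) := by gcongr
    have e14 : Cs * (τ * x ^ 2) ≤ (1 - m) / 2 * (τ * x ^ 2) := by gcongr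
    have e15 := mul_le_mul_of_nonneg_left e2 hτ.le
    rw [e1, real_inner_self_eq_norm_sq, real_inner_self_eq_norm_sq, real_inner_self_eq_norm_sq,
      real_inner_comm (S.prs j φ.2)]
    linarith
  rw [tri_sq, triSq, form, Finset.mul_sum]
  refine le_trans (le_of_eq ?_) (Finset.sum_le_sum fun j _ => key j)
  rw [Finset.sum_add_distrib, Finset.sum_sub_distrib, hibp, sub_self, add_zero]

/-! #### Boundedness of the right hand side -/

theorem mul_le_of_weighted {τ a b L t : ℝ} (hτ : 0 ≤ τ) (hL : 0 ≤ L) (ht : 0 ≤ t)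
    (ha : τ * a ^ 2 ≤ L ^ 2) (hb : τ * b ^ 2 ≤ t ^ 2) : τ * (a * b) ≤ L * t := by
  refine abs_le_of_sq_le_sq' ?_ (mul_nonneg hL ht) |>.2
  calc (τ * (a * b)) ^ 2 = (τ * a ^ 2) * (τ * b ^ 2) := by ring
    _ ≤ L ^ 2 * t ^ 2 := by gcongr
    _ = (L * t) ^ 2 := by ring

/-- By the inverse estimate and τκ²ν ≤ 1 the weighted viscous term is controlled by the gradient
part of the norm. -/
theorem τ_mul_lpl_sq_le (a : V) (φ : V × Q) (j : ι) :
    S.τ j a * (S.ν * ‖S.lpl j φ.1‖) ^ 2 ≤ S.tri a φ ^ 2 := by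
  have hν := S.ν_pos
  have hκ := S.κ_pos j
  have hτ := S.τ_pos j a
  have h1 : S.τ j a * (S.c₁ * S.κ j ^ 2 * S.ν) ≤ 1 := by
    nlinarith [mul_nonneg hτ.le (S.conv_nonneg j a), S.τ_mul j a]
  have h2 : S.τ j a * (S.κ j ^ 2 * S.ν) ≤ 1 := by
    refine le_trans ?_ h1
    have : S.κ j ^ 2 * S.ν ≤ S.c₁ * S.κ j ^ 2 * S.ν := by
      rw [mul_assoc]
      exact le_mul_of_one_le_left (by positivity) (by linarith [S.two_lt_c₁])
    gcongr
  have h3 : ‖S.grd j φ.1‖ ≤ ‖S.grad φ.1‖ := S.norm_grd_le j φ.1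
  calc S.τ j a * (S.ν * ‖S.lpl j φ.1‖) ^ 2
      ≤ S.τ j a * (S.ν * (S.κ j * ‖S.grd j φ.1‖)) ^ 2 := by
        gcongr
        exact S.norm_lpl_le j φ.1
    _ = (S.τ j a * (S.κ j ^ 2 * S.ν)) * (S.ν * ‖S.grd j φ.1‖ ^ 2) := by ring
    _ ≤ 1 * (S.ν * ‖S.grad φ.1‖ ^ 2) := by gcongr
    _ ≤ S.tri a φ ^ 2 := by rw [one_mul]; exact S.ν_mul_norm_grad_sq_le a φ

/-- Cauchy–Schwarz on each element. Local factors are estimated by the full norms, which costs a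
factor counting the elements. Only the pairing of the force with v needs a Poincaré type bound. -/
theorem rhs_le [FiniteDimensional ℝ V] : ∃ Cb > 0, ∀ F FT a ψ,
    S.rhs F FT a ψ ≤ Cb * (S.lam F FT a * S.tri a ψ) := by
  obtain ⟨Cv, hCv, hval⟩ := S.exists_bound S.val
  obtain ⟨Cτ, hCτ, hτle⟩ := S.exists_τ_le
  have hν := S.ν_pos
  -- One summand each for the volume force, the stabilization (residual and Laplacian, hence 2) and
  -- the final faces.
  let D : ℝ := S.ν * Cv * (√S.ν)⁻¹ + 2 + √Cτ
  have hD : 0 ≤ D := by positivity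
  -- The added 1 keeps the constant positive when there are no elements.
  refine ⟨∑ _j : ι, D + 1, by positivity, fun F FT a ψ => ?_⟩
  have hlam := S.lam_nonneg F FT a
  have htri := S.tri_nonneg a ψ
  have key : ∀ j, inner ℝ (F j) (S.val j ψ.1)
    + S.τ j a * inner ℝ (F j) (S.X j a ψ - S.ν • S.lpl j ψ.1)
    - S.τ j a * inner ℝ (FT j) (S.valT j ψ.1) ≤ D * (S.lam F FT a * S.tri a ψ) := by
    intro j
    have hτ := (S.τ_pos j a).le
    obtain ⟨hF1, hF2, hF3⟩ := S.lam_bounds F FT a j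
    have h1 : inner ℝ (F j) (S.val j ψ.1) ≤
        S.ν * Cv * (√S.ν)⁻¹ * (S.lam F FT a * S.tri a ψ) := by
      calc inner ℝ (F j) (S.val j ψ.1) ≤ ‖F j‖ * ‖S.val j ψ.1‖ := real_inner_le_norm _ _
        _ ≤ (S.ν * S.lam F FT a) * (Cv * ((√S.ν)⁻¹ * S.tri a ψ)) := by
          gcongr
          exact (hval j ψ.1).trans (mul_le_mul_of_nonneg_left (S.norm_grad_le a ψ) hCv)
        _ = _ := by ring
    have h2 : S.τ j a * inner ℝ (F j) (S.X j a ψ - S.ν • S.lpl j ψ.1) ≤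
        2 * (S.lam F FT a * S.tri a ψ) := by
      calc _ ≤ S.τ j a * (‖F j‖ * (‖S.X j a ψ‖ + S.ν * ‖S.lpl j ψ.1‖)) := by
            gcongr
            refine (real_inner_le_norm _ _).trans ?_
            gcongr
            refine (norm_sub_le _ _).trans (le_of_eq ?_)
            rw [norm_smul, Real.norm_of_nonneg hν.le]
        _ = S.τ j a * (‖F j‖ * ‖S.X j a ψ‖) + S.τ j a * (‖F j‖ * (S.ν * ‖S.lpl j ψ.1‖)) := by
            ring
        _ ≤ S.lam F FT a * S.tri a ψ + S.lam F FT a * S.tri a ψ :=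
            add_le_add
              (mul_le_of_weighted hτ hlam htri hF1 (S.τ_mul_norm_X_sq_le a ψ j))
              (mul_le_of_weighted hτ hlam htri hF1 (S.τ_mul_lpl_sq_le a ψ j))
        _ = _ := by ring
    have h3 : -(S.τ j a * inner ℝ (FT j) (S.valT j ψ.1)) ≤
        √Cτ * (S.lam F FT a * S.tri a ψ) := by
      have h4 : S.τ j a * ‖S.valT j ψ.1‖ ^ 2 ≤ (√Cτ * S.tri a ψ) ^ 2 := by
        rw [mul_pow, Real.sq_sqrt hCτ]
        gcongr
        · exact hτle j a
        · exact S.norm_valT_le a ψ j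
      have h5 := mul_le_of_weighted hτ hlam (by positivity) hF2 h4
      calc _ = S.τ j a * (-inner ℝ (FT j) (S.valT j ψ.1)) := by ring
        _ ≤ S.τ j a * (‖FT j‖ * ‖S.valT j ψ.1‖) := by
          gcongr
          exact (neg_le_abs _).trans (abs_real_inner_le_norm _ _)
        _ ≤ _ := h5
        _ = _ := by ring
    calc _ ≤ S.ν * Cv * (√S.ν)⁻¹ * (S.lam F FT a * S.tri a ψ) +
          2 * (S.lam F FT a * S.tri a ψ) + √Cτ * (S.lam F FT a * S.tri a ψ) := by linarith
      _ = _ := by ring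
  calc S.rhs F FT a ψ ≤ ∑ _j : ι, D * (S.lam F FT a * S.tri a ψ) :=
        Finset.sum_le_sum fun j _ => key j
    _ = (∑ _j : ι, D) * (S.lam F FT a * S.tri a ψ) := by rw [Finset.sum_mul]
    _ ≤ _ := by gcongr; linarith

theorem exists_lam_le (F : ∀ j, H j) (FT : ∀ j, HT j) : ∃ C, ∀ a, S.lam F FT a ≤ C := by
  obtain ⟨Cτ, -, hτle⟩ := S.exists_τ_le
  refine ⟨√(∑ j, (‖S.ν⁻¹ • F j‖ ^ 2 + 2 * (Cτ * ‖F j‖ ^ 2) + Cτ * ‖FT j‖ ^ 2)), fun a => ?_⟩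
  refine Real.sqrt_le_sqrt (Finset.sum_le_sum fun j _ => ?_)
  have := hτle j a
  gcongr

/-! #### Solvability -/

/-- The form is definite only modulo the kernel N of the seminorm. Because N annihilates both sides
as test space, it suffices to solve on a complement, where injectivity into the dual implies
surjectivity. -/
theorem exists_solution [FiniteDimensional ℝ V] [FiniteDimensional ℝ Q] {a : V} {Cs : ℝ}
    (hCs : 0 < Cs) (hco : ∀ φ, Cs * S.tri a φ ^ 2 ≤ S.form a φ φ)
    (hker : ∀ q : Q, (∀ j, S.res j (0, q) = 0) →
      ∀ v, ∑ j, inner ℝ (S.dvg j v) (S.prs j q) = 0)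
    (F : ∀ j, H j) (FT : ∀ j, HT j) : ∃ φ, ∀ ψ, S.form a φ ψ = S.rhs F FT a ψ := by
  let N : Submodule ℝ (V × Q) :=
    LinearMap.ker (LinearMap.fst ℝ V Q) ⊓ ⨅ j, LinearMap.ker (S.res j)
  have hN : ∀ φ, φ ∈ N ↔ φ.1 = 0 ∧ ∀ j, S.res j φ = 0 := by
    intro φ
    simp [N, Submodule.mem_inf, Submodule.mem_iInf]
  obtain ⟨C, hC⟩ := N.exists_isCompl
  -- For (0, q) in N only (∇·u, q) survives in the form, and `hker` makes it vanish.
  have hBN : ∀ φ, ∀ n ∈ N, S.form a φ n = 0 := by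
    rintro φ ⟨v, q⟩ hn
    obtain ⟨hv, hq⟩ := (hN _).1 hn
    obtain rfl : v = 0 := hv
    have h1 := hker q hq φ.1
    have h2 : ((0 : V), (0 : Q)) = 0 := rfl
    have h3 : ∀ j, S.X j a (0, q) = 0 := fun j => by simp [X, hq j]
    simpa [form, h2, h3] using h1
  have hLN : ∀ n ∈ N, S.rhs F FT a n = 0 := by
    rintro ⟨v, q⟩ hn
    obtain ⟨hv, hq⟩ := (hN _).1 hn
    obtain rfl : v = 0 := hv
    have h3 : ∀ j, S.X j a (0, q) = 0 := fun j => by simp [X, hq j]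
    simp [rhs, h3]
  let A : C →ₗ[ℝ] Module.Dual ℝ C :=
    { toFun := fun c => (S.bilin a c).comp C.subtype
      map_add' := fun c c' => by ext x; simp
      map_smul' := fun r c => by ext x; simp }
  have hA : Function.Injective A := by
    refine (injective_iff_map_eq_zero _).2 fun c hc => ?_
    have h1 : S.form a c c = 0 := by
      have := congrArg (fun ℓ : Module.Dual ℝ C => ℓ c) hc
      simpa [A, bilin] using this
    have h2 := hco c
    rw [h1] at h2
    have h3 : S.tri a c = 0 := by
      by_contra hne
      have : 0 < S.tri a c ^ 2 := by positivity
      nlinarith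
    have h4 : (c : V × Q) ∈ N := (hN _).2 (S.eq_zero_of_tri_eq_zero h3)
    exact Subtype.ext (Submodule.disjoint_def.1 hC.disjoint _ h4 c.2)
  have hA' : Function.Surjective A :=
    (LinearMap.injective_iff_surjective_of_finrank_eq_finrank
      (Subspace.dual_finrank_eq (K := ℝ) (V := C)).symm).1 hA
  obtain ⟨c, hc⟩ := hA' ((S.rhsLin F FT a).comp C.subtype)
  refine ⟨c, fun ψ => ?_⟩
  obtain ⟨n, hn, c', hc', rfl⟩ := Submodule.mem_sup.1
    (hC.codisjoint.eq_top ▸ Submodule.mem_top : ψ ∈ N ⊔ C)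
  have h1 : S.form a c c' = S.rhs F FT a c' := by
    have := congrArg (fun ℓ : Module.Dual ℝ C => ℓ ⟨c', hc'⟩) hc
    simpa [A, bilin, rhsLin] using this
  have h2 : S.rhs F FT a (n + c') = S.rhs F FT a n + S.rhs F FT a c' :=
    (S.rhsLin F FT a).map_add n c'
  rw [form_add_right, h2, hBN _ n hn, hLN n hn, h1]

/-- Test with φ itself and cancel one factor of its norm, unless that norm is zero. -/
theorem tri_le_of_solution {a : V} {Cs Cb : ℝ} (hCs : 0 < Cs) {F : ∀ j, H j} {FT : ∀ j, HT j}
    (hco : ∀ φ, Cs * S.tri a φ ^ 2 ≤ S.form a φ φ)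
    (hrhs : ∀ ψ, S.rhs F FT a ψ ≤ Cb * (S.lam F FT a * S.tri a ψ)) (hCb : 0 < Cb)
    {φ : V × Q} (hφ : ∀ ψ, S.form a φ ψ = S.rhs F FT a ψ) :
    S.tri a φ ≤ Cb / Cs * S.lam F FT a := by
  rcases (S.tri_nonneg a φ).eq_or_lt with h0 | h0
  · rw [← h0]
    have := S.lam_nonneg F FT a
    positivity
  · have h1 : Cs * S.tri a φ ^ 2 ≤ Cb * (S.lam F FT a * S.tri a φ) :=
      (hco φ).trans ((hφ φ).trans_le (hrhs φ))
    have h2 : Cs * S.tri a φ ≤ Cb * S.lam F FT a := by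
      refine le_of_mul_le_mul_right ?_ h0
      nlinarith
    rw [div_mul_eq_mul_div, le_div_iff₀ hCs]
    linarith

theorem form_sub_left (a : V) (φ φ' ψ : V × Q) :
    S.form a (φ - φ') ψ = S.form a φ ψ - S.form a φ' ψ := by
  have h : S.bilin a (φ - φ') ψ = S.bilin a φ ψ - S.bilin a φ' ψ := by
    rw [map_sub, LinearMap.sub_apply]
  exact h

/-- Coercivity applied to the difference shows that its seminorm is zero. This fixes the velocity
and the elementwise pressure gradient, but not the pressure. -/
theorem solution_unique {a : V} {Cs : ℝ} (hCs : 0 < Cs)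
    (hco : ∀ φ, Cs * S.tri a φ ^ 2 ≤ S.form a φ φ) {φ φ' : V × Q}
    (h : ∀ ψ, S.form a φ' ψ = S.form a φ ψ) :
    φ'.1 - φ.1 = 0 ∧ ∀ j, S.res j (0, φ'.2 - φ.2) = 0 := by
  have h1 := hco (φ' - φ)
  rw [form_sub_left, h, sub_self] at h1
  have h2 : S.tri a (φ' - φ) = 0 := by
    by_contra hne
    have : 0 < S.tri a (φ' - φ) ^ 2 := by positivity
    nlinarith
  obtain ⟨h3, h4⟩ := S.eq_zero_of_tri_eq_zero h2
  refine ⟨h3, fun j => ?_⟩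
  have h5 : ((0 : V), φ'.2 - φ.2) = φ' - φ := Prod.ext h3.symm rfl
  rw [h5, h4 j]

end StabilizedData

namespace StabilizedData

variable {ι : Type*} [Fintype ι] {V Q : Type*} [AddCommGroup V] [Module ℝ V]
    [AddCommGroup Q] [Module ℝ Q] {H HG HS HT E : ι → Type*}
    [∀ j, NormedAddCommGroup (H j)] [∀ j, InnerProductSpace ℝ (H j)]
    [∀ j, NormedAddCommGroup (HG j)] [∀ j, InnerProductSpace ℝ (HG j)]
    [∀ j, NormedAddCommGroup (HS j)] [∀ j, InnerProductSpace ℝ (HS j)]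
    [∀ j, NormedAddCommGroup (HT j)] [∀ j, InnerProductSpace ℝ (HT j)]
    [∀ j, NormedAddCommGroup (E j)] [∀ j, NormedSpace ℝ (E j)]
    (S : StabilizedData V Q H HG HS HT E)

/-! #### Dependence on the convection field -/

section Convection

variable [FiniteDimensional ℝ V]

omit [FiniteDimensional ℝ V] in
theorem norm_grad_sub_le (a b : V) : ‖S.grad (a - b)‖ ≤ ‖S.grad a‖ + ‖S.grad b‖ := by
  rw [map_sub]
  exact norm_sub_le _ _

theorem exists_spd_lip : ∃ C ≥ 0, ∀ j a b, |S.spd j a - S.spd j b| ≤ C * ‖S.grad (a - b)‖ := by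
  obtain ⟨C, hC, h⟩ := S.exists_bound S.eval
  exact ⟨C, hC, fun j a b => (S.spd_lip j a b).trans (h j _)⟩

theorem exists_spd_le {ρ : ℝ} : ∃ C ≥ 0, ∀ a, ‖S.grad a‖ ≤ ρ → ∀ j, S.spd j a ≤ C := by
  obtain ⟨C, hC, h⟩ := S.exists_spd_lip
  refine ⟨∑ j, S.spd j 0 + C * |ρ|,
    add_nonneg (Finset.sum_nonneg fun j _ => S.spd_nonneg j 0) (by positivity), fun a ha j => ?_⟩
  have h1 := (le_abs_self _).trans (h j a 0)
  rw [sub_zero] at h1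
  have h2 : S.spd j 0 ≤ ∑ j, S.spd j 0 :=
    Finset.single_le_sum (f := fun j => S.spd j 0) (fun j _ => S.spd_nonneg j 0)
      (Finset.mem_univ j)
  have h3 : C * ‖S.grad a‖ ≤ C * |ρ| :=
    mul_le_mul_of_nonneg_left (ha.trans (le_abs_self ρ)) hC
  linarith

/-- A bounded gradient bounds the speed and hence 1/τ. On bounded sets of fields the weight τ can
therefore be removed from the norm. -/
theorem exists_one_le_mul_τ {ρ : ℝ} :
    ∃ D ≥ 0, ∀ a, ‖S.grad a‖ ≤ ρ → ∀ j, 1 ≤ D * S.τ j a := by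
  obtain ⟨C, hC, h⟩ := S.exists_spd_le (ρ := ρ)
  have h0 : ∀ j, 0 ≤ S.c₁ * S.κ j ^ 2 * S.ν + S.β j * C := fun j =>
    add_nonneg (S.visc_pos j).le (mul_nonneg (S.β_pos j).le hC)
  refine ⟨∑ j, (S.c₁ * S.κ j ^ 2 * S.ν + S.β j * C), Finset.sum_nonneg fun j _ => h0 j,
    fun a ha j => ?_⟩
  rw [← S.τ_mul j a, mul_comm]
  refine mul_le_mul_of_nonneg_right ?_ (S.τ_pos j a).le
  refine le_trans ?_ (Finset.single_le_sum (f := fun j => S.c₁ * S.κ j ^ 2 * S.ν + S.β j * C)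
    (fun j _ => h0 j) (Finset.mem_univ j))
  have := mul_le_mul_of_nonneg_left (h a ha j) (S.β_pos j).le
  linarith

theorem exists_τ_lip : ∃ C ≥ 0, ∀ j a b, |S.τ j a - S.τ j b| ≤ C * ‖S.grad (a - b)‖ := by
  obtain ⟨C, hC, h⟩ := S.exists_spd_lip
  obtain ⟨Cτ, hCτ, hτ⟩ := S.exists_τ_le
  have hβ : ∀ j, 0 ≤ S.β j := fun j => (S.β_pos j).le
  refine ⟨Cτ * Cτ * ((∑ j, S.β j) * C),
    mul_nonneg (mul_nonneg hCτ hCτ) (mul_nonneg (Finset.sum_nonneg fun j _ => hβ j) hC),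
    fun j a b => ?_⟩
  -- This is 1/τ_b − 1/τ_a = β(spd b − spd a), multiplied by τ_a τ_b.
  have h1 : S.τ j a - S.τ j b = S.τ j a * S.τ j b * (S.β j * (S.spd j b - S.spd j a)) := by
    linear_combination S.τ j b * S.τ_mul j a - S.τ j a * S.τ_mul j b
  have h2 : S.β j ≤ ∑ j, S.β j :=
    Finset.single_le_sum (f := S.β) (fun j _ => hβ j) (Finset.mem_univ j)
  have h3 := (S.τ_pos j a).le
  have h4 := (S.τ_pos j b).le
  have h5 := hβ j
  rw [h1, abs_mul, abs_mul, abs_mul, abs_of_nonneg h3, abs_of_nonneg h4, abs_of_nonneg h5,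
    abs_sub_comm]
  calc _ ≤ Cτ * Cτ * ((∑ j, S.β j) * (C * ‖S.grad (a - b)‖)) := by
        have := hτ j a
        have := hτ j b
        have := h j a b
        have := h5.trans h2
        gcongr
    _ = _ := by ring

theorem exists_τc_lip : ∃ C ≥ 0, ∀ j a b, |S.τc j a - S.τc j b| ≤ C * ‖S.grad (a - b)‖ := by
  obtain ⟨C, hC, h⟩ := S.exists_spd_lip
  refine ⟨(∑ j, S.γ₁ j) * C,
    mul_nonneg (Finset.sum_nonneg fun j _ => S.γ₁_nonneg j) hC, fun j a b => ?_⟩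
  have h1 : S.τc j a - S.τc j b = S.γ₁ j * (S.spd j a - S.spd j b) := by
    simp only [τc]; ring
  have h2 : S.γ₁ j ≤ ∑ j, S.γ₁ j :=
    Finset.single_le_sum (f := S.γ₁) (fun j _ => S.γ₁_nonneg j) (Finset.mem_univ j)
  rw [h1, abs_mul, abs_of_nonneg (S.γ₁_nonneg j)]
  calc _ ≤ (∑ j, S.γ₁ j) * (C * ‖S.grad (a - b)‖) := by
        have := h j a b
        have := (S.γ₁_nonneg j).trans h2
        gcongr
    _ = _ := by ring

theorem exists_τc_le {ρ : ℝ} : ∃ C ≥ 0, ∀ a, ‖S.grad a‖ ≤ ρ → ∀ j, S.τc j a ≤ C := by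
  obtain ⟨C, hC, h⟩ := S.exists_spd_le (ρ := ρ)
  refine ⟨S.γ₀ + (∑ j, S.γ₁ j) * C, add_nonneg S.γ₀_nonneg
    (mul_nonneg (Finset.sum_nonneg fun j _ => S.γ₁_nonneg j) hC), fun a ha j => ?_⟩
  have h2 : S.γ₁ j ≤ ∑ j, S.γ₁ j :=
    Finset.single_le_sum (f := S.γ₁) (fun j _ => S.γ₁_nonneg j) (Finset.mem_univ j)
  have := mul_le_mul h2 (h a ha j) (S.spd_nonneg j a) ((S.γ₁_nonneg j).trans h2)
  simp only [τc]
  linarith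

omit [Fintype ι] [FiniteDimensional ℝ V] in
theorem X_sub (j : ι) (a b : V) (φ : V × Q) : S.X j a φ - S.X j b φ = S.adv j (a - b) φ.1 := by
  simp [X]

omit [Fintype ι] [FiniteDimensional ℝ V] in
theorem XT_sub (j : ι) (a b : V) (φ : V × Q) :
    S.XT j a φ - S.XT j b φ = S.advT j (a - b) φ.1 := by
  simp [XT]

/-- All local quantities are controlled by the discrete norm. -/
theorem exists_local_bound {CΓ : ℝ} (hCΓ : 0 < CΓ)
    (htr : ∀ j a φ, ‖S.XT j a φ‖ ^ 2 ≤ CΓ * ‖S.X j a φ‖ ^ 2) (ρ : ℝ) :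
    ∃ C ≥ 0, ∀ a, ‖S.grad a‖ ≤ ρ → ∀ b, ‖S.grad b‖ ≤ ρ → ∀ (φ : V × Q) j,
      ‖S.val j φ.1‖ ≤ C * S.tri a φ ∧ ‖S.dvg j φ.1‖ ≤ C * S.tri a φ ∧
      ‖S.valT j φ.1‖ ≤ C * S.tri a φ ∧
      ‖S.X j b φ‖ + S.ν * ‖S.lpl j φ.1‖ ≤ C * S.tri a φ ∧
      ‖S.XT j b φ‖ + S.ν * ‖S.lplT j φ.1‖ ≤ C * S.tri a φ ∧
      (∀ c, ‖S.adv j c φ.1‖ ≤ C * ‖S.grad c‖ * S.tri a φ) ∧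
      (∀ c, ‖S.advT j c φ.1‖ ≤ C * ‖S.grad c‖ * S.tri a φ) := by
  obtain ⟨Cv, hCv, hval⟩ := S.exists_bound S.val
  obtain ⟨Cd, hCd, hdvg⟩ := S.exists_bound S.dvg
  obtain ⟨Cl, hCl, hlpl⟩ := S.exists_bound S.lpl
  obtain ⟨Ct, hCt, hlplT⟩ := S.exists_bound S.lplT
  obtain ⟨Ca, hCa, hadv⟩ := S.exists_bound₂ S.adv
  obtain ⟨Cb, hCb, hadvT⟩ := S.exists_bound₂ S.advT
  obtain ⟨D, hD, hτ⟩ := S.exists_one_le_mul_τ (ρ := ρ)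
  have hν := S.ν_pos
  set μ : ℝ := (√S.ν)⁻¹ with hμ
  have hμ0 : 0 ≤ μ := by positivity
  -- The residual for the field b is measured in the norm of another field a. The residual for a
  -- loses its weight by the lower bound on τ, and the difference is convective with ‖∇(b − a)‖ ≤
  -- 2|ρ|.
  let CX : ℝ := √D + Ca * (2 * |ρ|) * μ
  have hCX : 0 ≤ CX := by positivity
  let C : ℝ := Cv * μ + Cd * μ + 1 + (CX + S.ν * (Cl * μ)) + (√CΓ * CX + S.ν * (Ct * μ)) +
    Ca * μ + Cb * μ
  refine ⟨C, by positivity, fun a ha b hb φ j => ?_⟩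
  have ht := S.tri_nonneg a φ
  have hg : ‖S.grad φ.1‖ ≤ μ * S.tri a φ := S.norm_grad_le a φ
  have lift : ∀ {x c : ℝ}, x ≤ c * S.tri a φ → c ≤ C → x ≤ C * S.tri a φ := fun hx hc =>
    hx.trans (mul_le_mul_of_nonneg_right hc ht)
  have viaGrad : ∀ {x c : ℝ}, 0 ≤ c → x ≤ c * ‖S.grad φ.1‖ → x ≤ c * μ * S.tri a φ :=
    fun hc hx => hx.trans (by rw [mul_assoc]; exact mul_le_mul_of_nonneg_left hg hc)
  have n1 : 0 ≤ Cv * μ := by positivity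
  have n2 : 0 ≤ Cd * μ := by positivity
  have n3 : 0 ≤ CX + S.ν * (Cl * μ) := by positivity
  have n4 : 0 ≤ √CΓ * CX + S.ν * (Ct * μ) := by positivity
  have n5 : 0 ≤ Ca * μ := by positivity
  have n6 : 0 ≤ Cb * μ := by positivity
  have hXa : ‖S.X j a φ‖ ≤ √D * S.tri a φ := by
    refine abs_le_of_sq_le_sq' ?_ (by positivity) |>.2
    rw [mul_pow, Real.sq_sqrt hD]
    calc ‖S.X j a φ‖ ^ 2 ≤ (D * S.τ j a) * ‖S.X j a φ‖ ^ 2 :=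
          le_mul_of_one_le_left (sq_nonneg _) (hτ a ha j)
      _ = D * (S.τ j a * ‖S.X j a φ‖ ^ 2) := by ring
      _ ≤ D * S.tri a φ ^ 2 := by gcongr; exact S.τ_mul_norm_X_sq_le a φ j
  have hXb : ‖S.X j b φ‖ ≤ CX * S.tri a φ := by
    have h1 : S.X j b φ = S.X j a φ + S.adv j (b - a) φ.1 := by rw [← X_sub]; abel
    have h2 : ‖S.grad (b - a)‖ ≤ 2 * |ρ| := by
      have := S.norm_grad_sub_le b a
      have := le_abs_self ρ
      linarith
    rw [h1]
    calc _ ≤ ‖S.X j a φ‖ + ‖S.adv j (b - a) φ.1‖ := norm_add_le _ _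
      _ ≤ √D * S.tri a φ + Ca * (2 * |ρ|) * (μ * S.tri a φ) := by
        refine add_le_add hXa ((hadv j _ _).trans ?_)
        gcongr
      _ = _ := by simp only [CX]; ring
  have hXT : ‖S.XT j b φ‖ ≤ √CΓ * CX * S.tri a φ := by
    refine abs_le_of_sq_le_sq' ?_ (by positivity) |>.2
    calc ‖S.XT j b φ‖ ^ 2 ≤ CΓ * ‖S.X j b φ‖ ^ 2 := htr j b φ
      _ ≤ CΓ * (CX * S.tri a φ) ^ 2 := by gcongr
      _ = (√CΓ * CX * S.tri a φ) ^ 2 := by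
        rw [mul_assoc, mul_pow (√CΓ), Real.sq_sqrt hCΓ.le]
  have hl : S.ν * ‖S.lpl j φ.1‖ ≤ S.ν * (Cl * μ * S.tri a φ) := by
    gcongr; exact viaGrad hCl (hlpl j _)
  have hlT : S.ν * ‖S.lplT j φ.1‖ ≤ S.ν * (Ct * μ * S.tri a φ) := by
    gcongr; exact viaGrad hCt (hlplT j _)
  refine ⟨lift (viaGrad hCv (hval j _)) (by simp only [C]; linarith),
    lift (viaGrad hCd (hdvg j _)) (by simp only [C]; linarith),
    lift (c := 1) (by rw [one_mul]; exact S.norm_valT_le a φ j) (by simp only [C]; linarith),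
    lift (c := CX + S.ν * (Cl * μ)) (by linarith) (by simp only [C]; linarith),
    lift (c := √CΓ * CX + S.ν * (Ct * μ)) (by linarith) (by simp only [C]; linarith),
    fun c => ?_, fun c => ?_⟩
  · calc _ ≤ Ca * ‖S.grad c‖ * (μ * S.tri a φ) := (hadv j c φ.1).trans (by gcongr)
      _ = (Ca * μ) * (‖S.grad c‖ * S.tri a φ) := by ring
      _ ≤ C * (‖S.grad c‖ * S.tri a φ) := by gcongr; simp only [C]; linarith
      _ = _ := by ring
  · calc _ ≤ Cb * ‖S.grad c‖ * (μ * S.tri a φ) := (hadvT j c φ.1).trans (by gcongr)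
      _ = (Cb * μ) * (‖S.grad c‖ * S.tri a φ) := by ring
      _ ≤ C * (‖S.grad c‖ * S.tri a φ) := by gcongr; simp only [C]; linarith
      _ = _ := by ring

theorem norm_sub_smul_le {X : Type*} [NormedAddCommGroup X] [NormedSpace ℝ X] {ν B : ℝ}
    (hν : 0 < ν) {x y : X} (h : ‖x‖ + ν * ‖y‖ ≤ B) : ‖x - ν • y‖ ≤ B ∧ ‖x + ν • y‖ ≤ B := by
  have h1 : ‖ν • y‖ = ν * ‖y‖ := by rw [norm_smul, Real.norm_of_nonneg hν.le]
  exact ⟨(norm_sub_le _ _).trans (h1 ▸ h), (norm_add_le _ _).trans (h1 ▸ h)⟩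

/-- Telescoping a product of three factors: one factor at a time changes, contributing n, and the
other two stay bounded. -/
theorem weighted_inner_sub_le {X : Type*} [NormedAddCommGroup X] [InnerProductSpace ℝ X]
    {τ₁ τ₂ K n t : ℝ} {x₁ x₂ y₁ y₂ : X} (hτ : |τ₁ - τ₂| ≤ K * n) (hτ₂ : |τ₂| ≤ K)
    (hx₁ : ‖x₁‖ ≤ K) (hx₂ : ‖x₂‖ ≤ K) (hx : ‖x₁ - x₂‖ ≤ K * n) (hy₁ : ‖y₁‖ ≤ K * t)
    (hy : ‖y₁ - y₂‖ ≤ K * n * t) (hn : 0 ≤ n) :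
    |τ₁ * inner ℝ x₁ y₁ - τ₂ * inner ℝ x₂ y₂| ≤ 3 * K ^ 3 * n * t := by
  have hK : 0 ≤ K := (abs_nonneg _).trans hτ₂
  have h1 : τ₁ * inner ℝ x₁ y₁ - τ₂ * inner ℝ x₂ y₂ =
      (τ₁ - τ₂) * inner ℝ x₁ y₁ + τ₂ * inner ℝ (x₁ - x₂) y₁ + τ₂ * inner ℝ x₂ (y₁ - y₂) := by
    rw [inner_sub_left, inner_sub_right]; ring
  have h2 := abs_real_inner_le_norm x₁ y₁
  have h3 := abs_real_inner_le_norm (x₁ - x₂) y₁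
  have h4 := abs_real_inner_le_norm x₂ (y₁ - y₂)
  rw [h1]
  refine (abs_add_three _ _ _).trans ?_
  rw [abs_mul, abs_mul, abs_mul]
  calc _ ≤ (K * n) * (K * (K * t)) + K * ((K * n) * (K * t)) + K * (K * (K * n * t)) := by
        gcongr
        · exact h2.trans (by gcongr)
        · exact h3.trans (by gcongr)
        · exact h4.trans (by gcongr)
    _ = _ := by ring

/-- Subtract the two problems and test with χ = φ₁ − φ₂. Coercivity at a₁ reduces the claim to how
the form at fixed φ₂ and the right hand side change between the fields; terms free of a drop out.
The constant precedes force and fields and sees them only through ρ, R and Λ. -/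
theorem exists_lipschitz {CΓ Cs : ℝ} (hCΓ : 0 < CΓ) (hCs : 0 < Cs)
    (htr : ∀ j a φ, ‖S.XT j a φ‖ ^ 2 ≤ CΓ * ‖S.X j a φ‖ ^ 2) (ρ R Λ : ℝ)
    (hR : 0 ≤ R) (hΛ : 0 ≤ Λ) :
    ∃ Ct ≥ 0, ∀ F FT a₁ a₂, ‖S.grad a₁‖ ≤ ρ → ‖S.grad a₂‖ ≤ ρ →
      (∀ φ, Cs * S.tri a₁ φ ^ 2 ≤ S.form a₁ φ φ) → S.lam F FT a₂ ≤ Λ →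
      ∀ φ₁ φ₂, (∀ ψ, S.form a₁ φ₁ ψ = S.rhs F FT a₁ ψ) →
        (∀ ψ, S.form a₂ φ₂ ψ = S.rhs F FT a₂ ψ) → S.tri a₂ φ₂ ≤ R →
        S.tri a₁ (φ₁ - φ₂) ≤ Ct / Cs * ‖S.grad (a₁ - a₂)‖ := by
  obtain ⟨C, hC, hloc⟩ := S.exists_local_bound hCΓ htr ρ
  obtain ⟨Cτ, hCτ, hτle⟩ := S.exists_τ_le
  obtain ⟨Cτ', hCτ', hτlip⟩ := S.exists_τ_lip
  obtain ⟨Cc, hCc, hτcle⟩ := S.exists_τc_le (ρ := ρ)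
  obtain ⟨Cc', hCc', hτclip⟩ := S.exists_τc_lip
  obtain ⟨D, hD, hτ⟩ := S.exists_one_le_mul_τ (ρ := ρ)
  have hν := S.ν_pos
  -- A common bound for all local norms, for τ, τc and their Lipschitz constants, and for the
  -- forces.
  let K : ℝ := C + C * R + Cτ + Cτ' + Cc + Cc' + S.ν * Λ + √D * Λ
  have n0 : 0 ≤ C * R := by positivity
  have n1 : 0 ≤ S.ν * Λ := by positivity
  have n2 : 0 ≤ √D * Λ := by positivity
  have hK : 0 ≤ K := by positivity
  -- Five weighted products contribute 3K³ each and the convective term contributes K²; 18 in place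
  -- of 15 is slack.
  refine ⟨∑ _j : ι, (18 * K ^ 3 + K ^ 2), by positivity, ?_⟩
  intro F FT a₁ a₂ ha₁ ha₂ hco hlam φ₁ φ₂ hφ₁ hφ₂ hR₂
  set χ := φ₁ - φ₂ with hχ
  set n := ‖S.grad (a₁ - a₂)‖
  set t := S.tri a₁ χ
  have hn : 0 ≤ n := norm_nonneg _
  have ht : 0 ≤ t := S.tri_nonneg _ _
  have key : Cs * t ^ 2 ≤ (∑ _j : ι, (18 * K ^ 3 + K ^ 2)) * n * t := by
    have h1 : S.form a₁ χ χ = (S.rhs F FT a₁ χ - S.rhs F FT a₂ χ) -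
        (S.form a₁ φ₂ χ - S.form a₂ φ₂ χ) := by
      rw [hφ₂, form_sub_left, hφ₁]; ring
    refine (hco χ).trans ?_
    rw [h1, rhs, rhs, form, form, ← Finset.sum_sub_distrib, ← Finset.sum_sub_distrib,
      ← Finset.sum_sub_distrib, Finset.sum_mul, Finset.sum_mul]
    refine Finset.sum_le_sum fun j _ => ?_
    obtain ⟨u1, u2, u3, -, -, u6, u7⟩ := hloc a₂ ha₂ a₂ ha₂ φ₂ j
    obtain ⟨-, -, -, u4, u5, -, -⟩ := hloc a₂ ha₂ a₁ ha₁ φ₂ j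
    obtain ⟨-, -, -, u4', u5', -, -⟩ := hloc a₂ ha₂ a₂ ha₂ φ₂ j
    obtain ⟨-, v2, v3, v4, -, v6, -⟩ := hloc a₁ ha₁ a₁ ha₁ χ j
    have hCR : C * S.tri a₂ φ₂ ≤ C * R := by gcongr
    have hCK : C ≤ K := by simp only [K]; linarith
    have hCRK : C * R ≤ K := by simp only [K]; linarith
    have hCt : C * t ≤ K * t := by gcongr
    have hadvφ : ‖S.adv j (a₁ - a₂) φ₂.1‖ ≤ K * n := by
      refine (u6 _).trans ?_
      calc C * n * S.tri a₂ φ₂ ≤ C * n * R := by gcongr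
        _ = (C * R) * n := by ring
        _ ≤ K * n := by gcongr
    have hadvTφ : ‖S.advT j (a₁ - a₂) φ₂.1‖ ≤ K * n := by
      refine (u7 _).trans ?_
      calc C * n * S.tri a₂ φ₂ ≤ C * n * R := by gcongr
        _ = (C * R) * n := by ring
        _ ≤ K * n := by gcongr
    have hadvχ : ‖S.adv j (a₁ - a₂) χ.1‖ ≤ K * n * t := (v6 _).trans (by gcongr)
    have hτd : |S.τ j a₁ - S.τ j a₂| ≤ K * n :=
      (hτlip j a₁ a₂).trans (by gcongr; simp only [K]; linarith)
    have hτcd : |S.τc j a₁ - S.τc j a₂| ≤ K * n :=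
      (hτclip j a₁ a₂).trans (by gcongr; simp only [K]; linarith)
    have hτ₂ : |S.τ j a₂| ≤ K := by
      rw [abs_of_pos (S.τ_pos j a₂)]
      exact (hτle j a₂).trans (by simp only [K]; linarith)
    have hτc₂ : |S.τc j a₂| ≤ K := by
      rw [abs_of_nonneg (S.τc_nonneg j a₂)]
      exact (hτcle a₂ ha₂ j).trans (by simp only [K]; linarith)
    obtain ⟨-, f2, f3⟩ := S.lam_bounds F FT a₂ j
    have hlam0 := S.lam_nonneg F FT a₂
    have hF : ‖F j‖ ≤ K := f3.trans <| by
      have : S.ν * S.lam F FT a₂ ≤ S.ν * Λ := by gcongr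
      simp only [K]; linarith
    have hFT : ‖FT j‖ ≤ K := by
      have h2 : ‖FT j‖ ≤ √D * Λ := by
        refine abs_le_of_sq_le_sq' ?_ (by positivity) |>.2
        rw [mul_pow, Real.sq_sqrt hD]
        calc ‖FT j‖ ^ 2 ≤ (D * S.τ j a₂) * ‖FT j‖ ^ 2 :=
              le_mul_of_one_le_left (sq_nonneg _) (hτ a₂ ha₂ j)
          _ = D * (S.τ j a₂ * ‖FT j‖ ^ 2) := by ring
          _ ≤ D * Λ ^ 2 := by
            gcongr
            exact f2.trans (by gcongr)
      exact h2.trans (by simp only [K]; linarith)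
    have hKn : 0 ≤ K * n := mul_nonneg hK hn
    have hKnt : 0 ≤ K * n * t := mul_nonneg hKn ht
    have e1 : (S.X j a₁ φ₂ - S.ν • S.lpl j φ₂.1) - (S.X j a₂ φ₂ - S.ν • S.lpl j φ₂.1) =
        S.adv j (a₁ - a₂) φ₂.1 := by rw [← X_sub]; abel
    have e2 : (S.XT j a₁ φ₂ - S.ν • S.lplT j φ₂.1) - (S.XT j a₂ φ₂ - S.ν • S.lplT j φ₂.1) =
        S.advT j (a₁ - a₂) φ₂.1 := by rw [← XT_sub]; abel
    have e3 : (S.X j a₁ χ - S.ν • S.lpl j χ.1) - (S.X j a₂ χ - S.ν • S.lpl j χ.1) =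
        S.adv j (a₁ - a₂) χ.1 := by rw [← X_sub]; abel
    have e4 : (S.X j a₁ χ + S.ν • S.lpl j χ.1) - (S.X j a₂ χ + S.ν • S.lpl j χ.1) =
        S.adv j (a₁ - a₂) χ.1 := by rw [← X_sub]; abel
    have r1 := ((norm_sub_smul_le hν u4).1.trans hCR).trans hCRK
    have r2 := ((norm_sub_smul_le hν u4').1.trans hCR).trans hCRK
    have rT1 := ((norm_sub_smul_le hν u5).1.trans hCR).trans hCRK
    have rT2 := ((norm_sub_smul_le hν u5').1.trans hCR).trans hCRK
    have s1 := (norm_sub_smul_le hν v4).2.trans hCt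
    have p1 := (norm_sub_smul_le hν v4).1.trans hCt
    have hd2 := (u2.trans hCR).trans hCRK
    have b1 := weighted_inner_sub_le (x₁ := F j) (x₂ := F j) hτd hτ₂ hF hF (by simpa using hKn)
      p1 (by rw [e3]; exact hadvχ) hn
    have b2 := weighted_inner_sub_le (x₁ := FT j) (x₂ := FT j) (y₂ := S.valT j χ.1) hτd hτ₂ hFT
      hFT (by simpa using hKn) (v3.trans hCt) (by simpa using hKnt) hn
    have b3 := weighted_inner_sub_le hτd hτ₂ r1 r2 (by rw [e1]; exact hadvφ)
      s1 (by rw [e4]; exact hadvχ) hn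
    have b4 := weighted_inner_sub_le (y₂ := S.dvg j χ.1) hτcd hτc₂ hd2 hd2 (by simpa using hKn)
      (v2.trans hCt) (by simpa using hKnt) hn
    have b5 := weighted_inner_sub_le (y₂ := S.valT j χ.1) hτd hτ₂ rT1 rT2
      (by rw [e2]; exact hadvTφ) (v3.trans hCt) (by simpa using hKnt) hn
    have b6 : |(inner ℝ (S.val j φ₂.1) (S.X j a₁ (χ.1, 0)) : ℝ) -
        inner ℝ (S.val j φ₂.1) (S.X j a₂ (χ.1, 0))| ≤ K ^ 2 * n * t := by
      rw [← inner_sub_right, X_sub]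
      refine (abs_real_inner_le_norm _ _).trans ?_
      calc _ ≤ K * (K * n * t) := by
            gcongr
            exact (u1.trans hCR).trans hCRK
        _ = _ := by ring
    have c1 := (abs_le.1 b1).2
    have c2 := (abs_le.1 b2).1
    have c3 := (abs_le.1 b3).1
    have c4 := (abs_le.1 b4).1
    have c5 := (abs_le.1 b5).2
    have c6 := (abs_le.1 b6).2
    have c7 : 0 ≤ 3 * K ^ 3 * n * t := by positivity
    linarith
  rcases ht.eq_or_lt with h0 | h0
  · rw [← h0]; positivity
  · rw [div_mul_eq_mul_div, le_div_iff₀ hCs]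
    refine le_of_mul_le_mul_right ?_ h0
    linarith

end Convection

end StabilizedData

/-! ### The finite element spaces as vector spaces -/

section Spaces

variable {d : ℕ} {Ω : Set (Sp d)} {T : ℝ}

/-- The integrals may be split because products of L² functions with the test function and its
derivative are integrable. -/
theorem HasWeakDeriv.add {D : Set (ST d)} {w : ST d} {u u' g g' : ST d → ℝ}
    (hu : MemLp u 2 (volume.restrict D)) (hu' : MemLp u' 2 (volume.restrict D))
    (hg : MemLp g 2 (volume.restrict D)) (hg' : MemLp g' 2 (volume.restrict D))
    (h : HasWeakDeriv D w u g) (h' : HasWeakDeriv D w u' g') :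
    HasWeakDeriv D w (fun z => u z + u' z) (fun z => g z + g' z) := by
  intro η hη hc hs
  have h1 : MemLp η 2 (volume.restrict D) :=
    (hη.continuous.memLp_of_hasCompactSupport (μ := volume) hc).restrict D
  have h2 : MemLp (fun z => fderiv ℝ η z w) 2 (volume.restrict D) := by
    refine (Continuous.memLp_of_hasCompactSupport (μ := volume) ?_ (hc.fderiv_apply ℝ w)).restrict D
    exact (hη.continuous_fderiv (by simp)).clm_apply continuous_const
  have h3 := integral_add (hu.integrable_mul h2) (hu'.integrable_mul h2)
  have h4 := integral_add (hg.integrable_mul h1) (hg'.integrable_mul h1)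
  simp only [Pi.mul_apply] at h3 h4
  simp only [add_mul]
  rw [h3, h4, h η hη hc hs, h' η hη hc hs, neg_add]

theorem MemH1.add {D : Set (ST d)} {u u' : ST d → ℝ} (hu : MemH1 D u) (hu' : MemH1 D u') :
    MemH1 D fun z => u z + u' z := by
  refine ⟨hu.1.add hu'.1, fun w => ?_⟩
  obtain ⟨g, hg, h⟩ := hu.2 w
  obtain ⟨g', hg', h'⟩ := hu'.2 w
  exact ⟨fun z => g z + g' z, hg.add hg', h.add hu.1 hu'.1 hg hg' h'⟩

theorem MemH1.const_mul {D : Set (ST d)} {u : ST d → ℝ} (c : ℝ) (hu : MemH1 D u) :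
    MemH1 D fun z => c * u z := by
  refine ⟨hu.1.const_mul c, fun w => ?_⟩
  obtain ⟨g, hg, h⟩ := hu.2 w
  refine ⟨fun z => c * g z, hg.const_mul c, fun η hη hc hs => ?_⟩
  simp only [mul_assoc]
  rw [integral_const_mul, integral_const_mul, h η hη hc hs, mul_neg]

theorem MemH1.zero {D : Set (ST d)} : MemH1 D fun _ => 0 :=
  ⟨MemLp.zero, fun _ => ⟨fun _ => 0, MemLp.zero, fun η _ _ _ => by simp⟩⟩

namespace Element

variable (e : Element d)

/-- The polynomial functions on the reference cube. -/
def refPoly (d k : ℕ) : Submodule ℝ (Icc (0 : Fin (d + 1) → ℝ) 1 → ℝ) :=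
  (MvPolynomial.restrictDegree (Fin (d + 1)) ℝ k).map
    (LinearMap.pi fun y : Icc (0 : Fin (d + 1) → ℝ) 1 => (MvPolynomial.aeval y.1).toLinearMap)

instance (k : ℕ) : FiniteDimensional ℝ (refPoly d k) := by
  have : Module.Finite ℝ (MvPolynomial.restrictDegree (Fin (d + 1)) ℝ k) := by
    have hfin : Finite {s : Fin (d + 1) →₀ ℕ | ∀ i, s i ≤ k} := by
      refine Set.Finite.to_subtype (Set.Finite.subset (Set.finite_Iic
        (Finsupp.equivFunOnFinite.symm fun _ : Fin (d + 1) => k)) ?_)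
      intro s hs i
      exact hs i
    exact Module.Finite.of_basis (MvPolynomial.basisRestrictSupport ℝ _)
  unfold refPoly
  infer_instance

theorem polyOn_iff {k : ℕ} {p : ST d → ℝ} :
    e.PolyOn k p ↔ (fun y : Icc (0 : Fin (d + 1) → ℝ) 1 => p (e.chart y)) ∈ refPoly d k := by
  have h0 : ∀ q : MvPolynomial (Fin (d + 1)) ℝ,
      (∀ j, q.degreeOf j ≤ k) ↔ q ∈ MvPolynomial.restrictDegree (Fin (d + 1)) ℝ k := by
    intro q
    simp only [MvPolynomial.mem_restrictDegree, MvPolynomial.degreeOf_le_iff]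
    exact ⟨fun h s hs i => h i s hs, fun h i s hs => h s hs i⟩
  constructor
  · rintro ⟨q, hq, h⟩
    refine ⟨q, (h0 q).1 hq, ?_⟩
    ext y
    simp [h y.1 y.2, MvPolynomial.aeval_eq_eval]
  · rintro ⟨q, hq, h⟩
    refine ⟨q, (h0 q).2 hq, fun y hy => ?_⟩
    have := congrFun h ⟨y, hy⟩
    simpa [MvPolynomial.aeval_eq_eval] using this.symm

theorem PolyOn.add {e : Element d} {k : ℕ} {p p' : ST d → ℝ} (h : e.PolyOn k p)
    (h' : e.PolyOn k p') : e.PolyOn k fun z => p z + p' z :=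
  e.polyOn_iff.2 ((refPoly d k).add_mem (e.polyOn_iff.1 h) (e.polyOn_iff.1 h'))

theorem PolyOn.const_mul {e : Element d} {k : ℕ} {p : ST d → ℝ} (c : ℝ) (h : e.PolyOn k p) :
    e.PolyOn k fun z => c * p z :=
  e.polyOn_iff.2 ((refPoly d k).smul_mem c (e.polyOn_iff.1 h))

theorem PolyOn.zero {e : Element d} {k : ℕ} : e.PolyOn k fun _ => 0 :=
  e.polyOn_iff.2 (refPoly d k).zero_mem

end Element

variable (K : Mesh Ω T) (k : ℕ)

/-- `V_h` as a subspace. -/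
def Mesh.velocity : Submodule ℝ (ST d → Sp d) where
  carrier := K.Vh k
  zero_mem' := ⟨fun _ => MemH1.zero, continuousOn_const, fun _ _ => rfl,
    fun _ _ => Element.PolyOn.zero, fun _ _ => rfl⟩
  add_mem' := by
    rintro u v ⟨u1, u2, u3, u4, u5⟩ ⟨v1, v2, v3, v4, v5⟩
    exact ⟨fun i => (u1 i).add (v1 i), u2.add v2, fun z hz => by simp [u3 z hz, v3 z hz],
      fun j i => (u4 j i).add (v4 j i), fun z hz => by simp [u5 z hz, v5 z hz]⟩
  smul_mem' := by
    rintro c v ⟨v1, v2, v3, v4, v5⟩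
    exact ⟨fun i => (v1 i).const_mul c, continuousOn_const.smul v2, fun z hz => by simp [v3 z hz],
      fun j i => (v4 j i).const_mul c, fun z hz => by simp [v5 z hz]⟩

/-- `Q_h` as a subspace. -/
def Mesh.pressure : Submodule ℝ (ST d → ℝ) where
  carrier := K.Qh k
  zero_mem' := ⟨MemH1.zero, continuousOn_const, fun _ => Element.PolyOn.zero, fun _ _ => rfl⟩
  add_mem' := by
    rintro u v ⟨u1, u2, u4, u5⟩ ⟨v1, v2, v4, v5⟩
    exact ⟨u1.add v1, u2.add v2, fun j => (u4 j).add (v4 j),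
      fun z hz => by simp [u5 z hz, v5 z hz]⟩
  smul_mem' := by
    rintro c v ⟨v1, v2, v4, v5⟩
    exact ⟨v1.const_mul c, continuousOn_const.smul v2, fun j => (v4 j).const_mul c,
      fun z hz => by simp [v5 z hz]⟩

variable {K k}

theorem Mesh.eq_zero_of_carrier {F : Type*} [Zero F] {v : ST d → F}
    (h : ∀ j, ∀ z ∈ (K.elem j).carrier, v z = 0)
    (h0 : ∀ z ∉ closure (stDom Ω T), v z = 0) : v = 0 := by
  funext z
  by_cases hz : z ∈ closure (stDom Ω T)
  · obtain ⟨j, hj⟩ := K.exists_mem_carrier hz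
    exact h j z hj
  · exact h0 z hz

/-- A velocity is determined by its polynomials in reference coordinates: the elements cover the
closed cylinder, and the extension by zero fixes the values outside. -/
instance : FiniteDimensional ℝ (K.velocity k) := by
  let A : K.velocity k →ₗ[ℝ] Fin K.card → Fin d → Element.refPoly d k :=
    LinearMap.pi fun j => LinearMap.pi fun i => LinearMap.codRestrict _
      { toFun := fun v (y : Icc (0 : Fin (d + 1) → ℝ) 1) => v.1 ((K.elem j).chart y) i
        map_add' := fun _ _ => rfl
        map_smul' := fun _ _ => rfl }
      fun v => (K.elem j).polyOn_iff.1 (v.2.2.2.2.1 j i)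
  refine FiniteDimensional.of_injective A ((injective_iff_map_eq_zero _).2 fun v hv => ?_)
  refine Subtype.ext (Mesh.eq_zero_of_carrier (K := K) ?_ v.2.2.2.2.2)
  rintro j _ ⟨y, hy, rfl⟩
  ext i
  exact congrArg (fun f : Fin K.card → Fin d → Element.refPoly d k => (f j i).1 ⟨y, hy⟩) hv

instance : FiniteDimensional ℝ (K.pressure k) := by
  let A : K.pressure k →ₗ[ℝ] Fin K.card → Element.refPoly d k :=
    LinearMap.pi fun j => LinearMap.codRestrict _
      { toFun := fun v (y : Icc (0 : Fin (d + 1) → ℝ) 1) => v.1 ((K.elem j).chart y)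
        map_add' := fun _ _ => rfl
        map_smul' := fun _ _ => rfl }
      fun v => (K.elem j).polyOn_iff.1 (v.2.2.2.1 j)
  refine FiniteDimensional.of_injective A ((injective_iff_map_eq_zero _).2 fun v hv => ?_)
  refine Subtype.ext (Mesh.eq_zero_of_carrier (K := K) ?_ v.2.2.2.2)
  rintro j _ ⟨y, hy, rfl⟩
  exact congrArg (fun f : Fin K.card → Element.refPoly d k => (f j).1 ⟨y, hy⟩) hv

theorem Mesh.velocity_contDiffOn {v : ST d → Sp d} (hv : v ∈ K.Vh k) (j : Fin K.card) :
    ContDiffOn ℝ ∞ v (K.elem j).carrier :=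
  contDiffOn_euclidean.2 fun i => (hv.2.2.2.1 j i).contDiffOn

theorem Mesh.velocity_piecewiseSmooth {v : ST d → Sp d} (hv : v ∈ K.Vh k) (i : Fin d) :
    K.PiecewiseSmooth fun z => v z i :=
  ⟨(EuclideanSpace.proj i : Sp d →L[ℝ] ℝ).continuous.comp_continuousOn hv.2.1,
    fun j => (hv.2.2.2.1 j i).contDiffOn⟩

theorem Mesh.pressure_piecewiseSmooth {q : ST d → ℝ} (hq : q ∈ K.Qh k) :
    K.PiecewiseSmooth q := ⟨hq.2.1, fun j => (hq.2.2.1 j).contDiffOn⟩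

theorem Mesh.velocity_norm_sq_piecewiseSmooth {v : ST d → Sp d} (hv : v ∈ K.Vh k) :
    K.PiecewiseSmooth fun z => ‖v z‖ ^ 2 :=
  ⟨hv.2.1.norm.pow 2, fun j => (Mesh.velocity_contDiffOn hv j).norm_sq ℝ⟩

end Spaces

/-! ### Calculus on an element -/

section Calculus

variable {d : ℕ} {e : Element d} {F : Type*} [NormedAddCommGroup F] [NormedSpace ℝ F]

theorem Element.contDiffOn_fderivWithin {u : ST d → F} (hu : ContDiffOn ℝ ∞ u e.carrier)
    (w : ST d) : ContDiffOn ℝ ∞ (fun z => fderivWithin ℝ u e.carrier z w) e.carrier :=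
  (hu.fderivWithin e.uniqueDiffOn_carrier (by simp)).clm_apply contDiffOn_const

theorem Element.hasFDerivWithinAt {u : ST d → F} (hu : ContDiffOn ℝ ∞ u e.carrier) {z : ST d}
    (hz : z ∈ e.carrier) : HasFDerivWithinAt u (fderivWithin ℝ u e.carrier z) e.carrier z :=
  (hu.differentiableOn (by simp) z hz).hasFDerivWithinAt

theorem Element.fderivWithin_add {u v : ST d → F} (hu : ContDiffOn ℝ ∞ u e.carrier)
    (hv : ContDiffOn ℝ ∞ v e.carrier) {z : ST d} (hz : z ∈ e.carrier) :
    fderivWithin ℝ (u + v) e.carrier z =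
      fderivWithin ℝ u e.carrier z + fderivWithin ℝ v e.carrier z :=
  ((hasFDerivWithinAt hu hz).add (hasFDerivWithinAt hv hz)).fderivWithin
    (e.uniqueDiffOn_carrier z hz)

theorem Element.fderivWithin_smul {u : ST d → F} (c : ℝ) (hu : ContDiffOn ℝ ∞ u e.carrier)
    {z : ST d} (hz : z ∈ e.carrier) :
    fderivWithin ℝ (c • u) e.carrier z = c • fderivWithin ℝ u e.carrier z :=
  ((hasFDerivWithinAt hu hz).const_smul c).fderivWithin (e.uniqueDiffOn_carrier z hz)

theorem Element.contDiffOn_dx {u : ST d → F} (hu : ContDiffOn ℝ ∞ u e.carrier) (i : Fin d) :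
    ContDiffOn ℝ ∞ (dx e.carrier i u) e.carrier := e.contDiffOn_fderivWithin hu _

theorem Element.continuousOn_dt {u : ST d → F} (hu : ContDiffOn ℝ ∞ u e.carrier) :
    ContinuousOn (dt e.carrier u) e.carrier := (e.contDiffOn_fderivWithin hu _).continuousOn

theorem Element.continuousOn_dx {u : ST d → F} (hu : ContDiffOn ℝ ∞ u e.carrier) (i : Fin d) :
    ContinuousOn (dx e.carrier i u) e.carrier := (e.contDiffOn_dx hu i).continuousOn

theorem Element.continuousOn_grad {q : ST d → ℝ} (hq : ContDiffOn ℝ ∞ q e.carrier) :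
    ContinuousOn (grad e.carrier q) e.carrier :=
  (PiLp.continuous_toLp 2 _).comp_continuousOn <|
    continuousOn_pi.2 fun i => e.continuousOn_dx hq i

theorem Element.continuousOn_div {u : ST d → Sp d} (hu : ContDiffOn ℝ ∞ u e.carrier) :
    ContinuousOn (div e.carrier u) e.carrier :=
  continuousOn_finsetSum _ fun i _ =>
    (EuclideanSpace.proj i : Sp d →L[ℝ] ℝ).continuous.comp_continuousOn (e.continuousOn_dx hu i)

theorem Element.continuousOn_lap {u : ST d → Sp d} (hu : ContDiffOn ℝ ∞ u e.carrier) :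
    ContinuousOn (lap e.carrier u) e.carrier :=
  continuousOn_finsetSum _ fun i _ => e.continuousOn_dx (e.contDiffOn_dx hu i) i

theorem Element.continuousOn_advL {a u : ST d → Sp d} (ha : ContDiffOn ℝ ∞ a e.carrier)
    (hu : ContDiffOn ℝ ∞ u e.carrier) : ContinuousOn (advL e.carrier a u) e.carrier := by
  refine ContinuousOn.add (continuousOn_finsetSum _ fun i _ => ?_) ?_
  · exact ((EuclideanSpace.proj i : Sp d →L[ℝ] ℝ).continuous.comp_continuousOn
      ha.continuousOn).smul (e.continuousOn_dx hu i)
  · exact (continuousOn_const.mul (e.continuousOn_div ha)).smul hu.continuousOn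

theorem Element.dt_add {u v : ST d → F} (hu : ContDiffOn ℝ ∞ u e.carrier)
    (hv : ContDiffOn ℝ ∞ v e.carrier) {z : ST d} (hz : z ∈ e.carrier) :
    dt e.carrier (u + v) z = dt e.carrier u z + dt e.carrier v z := by
  simp [dt, e.fderivWithin_add hu hv hz]

theorem Element.dt_smul {u : ST d → F} (c : ℝ) (hu : ContDiffOn ℝ ∞ u e.carrier)
    {z : ST d} (hz : z ∈ e.carrier) : dt e.carrier (c • u) z = c • dt e.carrier u z := by
  simp [dt, e.fderivWithin_smul c hu hz]

theorem Element.dx_add {u v : ST d → F} (hu : ContDiffOn ℝ ∞ u e.carrier)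
    (hv : ContDiffOn ℝ ∞ v e.carrier) (i : Fin d) {z : ST d} (hz : z ∈ e.carrier) :
    dx e.carrier i (u + v) z = dx e.carrier i u z + dx e.carrier i v z := by
  simp [dx, e.fderivWithin_add hu hv hz]

theorem Element.dx_smul {u : ST d → F} (c : ℝ) (hu : ContDiffOn ℝ ∞ u e.carrier) (i : Fin d)
    {z : ST d} (hz : z ∈ e.carrier) : dx e.carrier i (c • u) z = c • dx e.carrier i u z := by
  simp [dx, e.fderivWithin_smul c hu hz]

theorem Element.dx_congr {u v : ST d → F} (h : EqOn u v e.carrier) (i : Fin d)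
    {z : ST d} (hz : z ∈ e.carrier) : dx e.carrier i u z = dx e.carrier i v z := by
  rw [dx, dx, fderivWithin_congr h (h hz)]

theorem Element.grad_add {p q : ST d → ℝ} (hp : ContDiffOn ℝ ∞ p e.carrier)
    (hq : ContDiffOn ℝ ∞ q e.carrier) {z : ST d} (hz : z ∈ e.carrier) :
    grad e.carrier (p + q) z = grad e.carrier p z + grad e.carrier q z := by
  ext i; simp [grad, e.dx_add hp hq i hz]

theorem Element.grad_smul {q : ST d → ℝ} (c : ℝ) (hq : ContDiffOn ℝ ∞ q e.carrier)
    {z : ST d} (hz : z ∈ e.carrier) :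
    grad e.carrier (c • q) z = c • grad e.carrier q z := by
  ext i; simp [grad, e.dx_smul c hq i hz]

theorem Element.div_add {u v : ST d → Sp d} (hu : ContDiffOn ℝ ∞ u e.carrier)
    (hv : ContDiffOn ℝ ∞ v e.carrier) {z : ST d} (hz : z ∈ e.carrier) :
    div e.carrier (u + v) z = div e.carrier u z + div e.carrier v z := by
  simp [div, e.dx_add hu hv _ hz, Finset.sum_add_distrib]

theorem Element.div_smul {u : ST d → Sp d} (c : ℝ) (hu : ContDiffOn ℝ ∞ u e.carrier)
    {z : ST d} (hz : z ∈ e.carrier) : div e.carrier (c • u) z = c • div e.carrier u z := by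
  simp [div, e.dx_smul c hu _ hz, Finset.mul_sum]

theorem Element.lap_add {u v : ST d → Sp d} (hu : ContDiffOn ℝ ∞ u e.carrier)
    (hv : ContDiffOn ℝ ∞ v e.carrier) {z : ST d} (hz : z ∈ e.carrier) :
    lap e.carrier (u + v) z = lap e.carrier u z + lap e.carrier v z := by
  rw [lap, lap, lap, ← Finset.sum_add_distrib]
  refine Finset.sum_congr rfl fun i _ => ?_
  rw [← e.dx_add (e.contDiffOn_dx hu i) (e.contDiffOn_dx hv i) i hz]
  -- The first derivatives agree only on the element, which suffices for derivatives taken within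
  -- it.
  exact e.dx_congr (fun w hw => e.dx_add hu hv i hw) i hz

theorem Element.lap_smul {u : ST d → Sp d} (c : ℝ) (hu : ContDiffOn ℝ ∞ u e.carrier)
    {z : ST d} (hz : z ∈ e.carrier) : lap e.carrier (c • u) z = c • lap e.carrier u z := by
  rw [lap, lap, Finset.smul_sum]
  refine Finset.sum_congr rfl fun i _ => ?_
  rw [← e.dx_smul c (e.contDiffOn_dx hu i) i hz]
  exact e.dx_congr (fun w hw => e.dx_smul c hu i hw) i hz

theorem Element.advL_add_left {a b u : ST d → Sp d} (ha : ContDiffOn ℝ ∞ a e.carrier)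
    (hb : ContDiffOn ℝ ∞ b e.carrier) {z : ST d} (hz : z ∈ e.carrier) :
    advL e.carrier (a + b) u z = advL e.carrier a u z + advL e.carrier b u z := by
  simp only [advL, e.div_add ha hb hz, Pi.add_apply, PiLp.add_apply, add_smul, mul_add,
    Finset.sum_add_distrib]
  abel

theorem Element.advL_smul_left {a u : ST d → Sp d} (c : ℝ) (ha : ContDiffOn ℝ ∞ a e.carrier)
    {z : ST d} (hz : z ∈ e.carrier) :
    advL e.carrier (c • a) u z = c • advL e.carrier a u z := by
  simp only [advL, e.div_smul c ha hz, Pi.smul_apply, PiLp.smul_apply, smul_add, Finset.smul_sum,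
    smul_smul, smul_eq_mul]
  rw [show (1 / 2 : ℝ) * (c * div e.carrier a z) = c * (1 / 2 * div e.carrier a z) by ring]

theorem Element.advL_add_right {a u v : ST d → Sp d} (hu : ContDiffOn ℝ ∞ u e.carrier)
    (hv : ContDiffOn ℝ ∞ v e.carrier) {z : ST d} (hz : z ∈ e.carrier) :
    advL e.carrier a (u + v) z = advL e.carrier a u z + advL e.carrier a v z := by
  simp only [advL, e.dx_add hu hv _ hz, Pi.add_apply, smul_add, Finset.sum_add_distrib]
  abel

theorem Element.advL_smul_right {a u : ST d → Sp d} (c : ℝ) (hu : ContDiffOn ℝ ∞ u e.carrier)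
    {z : ST d} (hz : z ∈ e.carrier) :
    advL e.carrier a (c • u) z = c • advL e.carrier a u z := by
  simp only [advL, e.dx_smul c hu _ hz, Pi.smul_apply, smul_add, Finset.smul_sum]
  simp only [smul_comm c]

/-- The spatial gradient of a vector field, as one vector. -/
def gradVec (S : Set (ST d)) (u : ST d → Sp d) (z : ST d) : PiLp 2 fun _ : Fin d => Sp d :=
  WithLp.toLp 2 fun i => dx S i u z

theorem inner_gradVec (S : Set (ST d)) (u v : ST d → Sp d) (z : ST d) :
    inner ℝ (gradVec S u z) (gradVec S v z) = gradDot S u v z := by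
  rw [PiLp.inner_apply]; rfl

theorem norm_gradVec_sq (S : Set (ST d)) (u : ST d → Sp d) (z : ST d) :
    ‖gradVec S u z‖ ^ 2 = gradDot S u u z := by
  rw [← inner_gradVec, real_inner_self_eq_norm_sq]

theorem Element.continuousOn_gradVec {u : ST d → Sp d} (hu : ContDiffOn ℝ ∞ u e.carrier) :
    ContinuousOn (gradVec e.carrier u) e.carrier :=
  (PiLp.continuous_toLp 2 _).comp_continuousOn <|
    continuousOn_pi.2 fun i => e.continuousOn_dx hu i

/-- Derivative of `|v|²`. -/
theorem Element.fderivWithin_norm_sq {v : ST d → Sp d} (hv : ContDiffOn ℝ ∞ v e.carrier)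
    {z : ST d} (hz : z ∈ e.carrier) (w : ST d) :
    fderivWithin ℝ (fun z => ‖v z‖ ^ 2) e.carrier z w =
      2 * inner ℝ (v z) (fderivWithin ℝ v e.carrier z w) := by
  rw [((hasFDerivWithinAt hv hz).norm_sq).fderivWithin (e.uniqueDiffOn_carrier z hz)]
  simp

/-- Product rule. -/
theorem Element.fderivWithin_mul {f g : ST d → ℝ} (hf : ContDiffOn ℝ ∞ f e.carrier)
    (hg : ContDiffOn ℝ ∞ g e.carrier) {z : ST d} (hz : z ∈ e.carrier) (w : ST d) :
    fderivWithin ℝ (fun z => f z * g z) e.carrier z w =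
      f z * fderivWithin ℝ g e.carrier z w + fderivWithin ℝ f e.carrier z w * g z := by
  have h : fderivWithin ℝ (fun z => f z * g z) e.carrier z = _ :=
    ((hasFDerivWithinAt hf hz).mul (hasFDerivWithinAt hg hz)).fderivWithin
      (e.uniqueDiffOn_carrier z hz)
  rw [h]
  simp [mul_comm]

theorem Element.fderivWithin_coord {v : ST d → Sp d} (hv : ContDiffOn ℝ ∞ v e.carrier)
    {z : ST d} (hz : z ∈ e.carrier) (i : Fin d) (w : ST d) :
    fderivWithin ℝ (fun z => v z i) e.carrier z w = fderivWithin ℝ v e.carrier z w i := by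
  have h : HasFDerivWithinAt (fun z => v z i)
      ((EuclideanSpace.proj i : Sp d →L[ℝ] ℝ).comp (fderivWithin ℝ v e.carrier z))
      e.carrier z :=
    (EuclideanSpace.proj i : Sp d →L[ℝ] ℝ).hasFDerivAt.comp_hasFDerivWithinAt z
      (hasFDerivWithinAt hv hz)
  rw [h.fderivWithin (e.uniqueDiffOn_carrier z hz)]
  rfl

end Calculus

/-! ### Integral identities for finite element functions -/

section Identities

variable {d : ℕ} {Ω : Set (Sp d)} {T : ℝ} {K : Mesh Ω T} {k : ℕ}
  (hΩo : IsOpen Ω) (hΩl : HasLipschitzBoundary Ω) (hT : 0 < T) (hΩb : Bornology.IsBounded Ω)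

/-- The lateral condition is imposed only for 0 < t < T, and continuity carries it to t = T. -/
theorem Mesh.velocity_eq_zero_final (hT : 0 < T) {v : ST d → Sp d} (hv : v ∈ K.Vh k) {x : Sp d}
    (hx : x ∈ frontier Ω) : v (x, T) = 0 := by
  have h1 : ∀ t ∈ Icc 0 T, (x, t) ∈ closure (stDom Ω T) := fun t ht => by
    rw [closure_stDom hT]; exact ⟨frontier_subset_closure hx, ht⟩
  have h2 : ContinuousOn (fun t : ℝ => v (x, t)) (Icc 0 T) :=
    hv.2.1.comp (by fun_prop) h1
  have h3 : EqOn (fun t : ℝ => v (x, t)) 0 (Icc 0 T) :=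
    Set.EqOn.of_subset_closure (s := Ioo 0 T) (fun t ht => hv.2.2.1 _ (Or.inl ⟨hx, ht⟩)) h2
      continuousOn_const Ioo_subset_Icc_self (by rw [closure_Ioo hT.ne])
  exact h3 ⟨hT.le, le_rfl⟩

include hΩo hΩl hT hΩb in
/-- A velocity with vanishing gradient is zero. -/
theorem Mesh.velocity_eq_zero_of_gradVec (hd : d ≠ 0) {v : ST d → Sp d} (hv : v ∈ K.Vh k)
    (h : ∀ j, ∀ z ∈ (K.elem j).carrier, gradVec (K.elem j).carrier v z = 0) : v = 0 := by
  let i : Fin d := ⟨0, Nat.pos_of_ne_zero hd⟩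
  have hlin : ContDiff ℝ ∞ fun z : ST d => z.1 i :=
    ((EuclideanSpace.proj i : Sp d →L[ℝ] ℝ).comp (ContinuousLinearMap.fst ℝ (Sp d) ℝ)).contDiff
  -- If ∂_i v = 0 then ∂_i(x_i|v|²) = |v|², and the integral of the left side vanishes by the
  -- lateral condition. One space direction is enough.
  have hG := (Mesh.PiecewiseSmooth.of_contDiff (K := K) hlin).mul
    (Mesh.velocity_norm_sq_piecewiseSmooth hv)
  have h1 := hG.integral_dx hΩo hΩl hT hΩb (fun z hz => by simp [hv.2.2.1 z (Or.inl hz)]) i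
  have h2 : ∀ j, ∫ z in (K.elem j).carrier,
      dx (K.elem j).carrier i (fun z => z.1 i * ‖v z‖ ^ 2) z =
      ∫ z in (K.elem j).carrier, ‖v z‖ ^ 2 := by
    intro j
    refine setIntegral_congr_fun (K.elem j).isCompact_carrier.measurableSet fun z hz => ?_
    have hvs := Mesh.velocity_contDiffOn hv j
    have h3 : fderivWithin ℝ v (K.elem j).carrier z (EuclideanSpace.single i 1, 0) = 0 :=
      congrArg (fun f : PiLp 2 fun _ : Fin d => Sp d => f i) (h j z hz)
    have h4 : fderivWithin ℝ (fun z : ST d => z.1 i) (K.elem j).carrier z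
        (EuclideanSpace.single i 1, 0) = 1 := by
      have h5 := ((EuclideanSpace.proj i : Sp d →L[ℝ] ℝ).comp
        (ContinuousLinearMap.fst ℝ (Sp d) ℝ)).hasFDerivWithinAt (s := (K.elem j).carrier) (x := z)
      have h6 := h5.fderivWithin ((K.elem j).uniqueDiffOn_carrier z hz)
      have h7 : (fun z : ST d => z.1 i) = ((EuclideanSpace.proj i : Sp d →L[ℝ] ℝ).comp
        (ContinuousLinearMap.fst ℝ (Sp d) ℝ)) := rfl
      rw [h7, h6]
      simp
    simp only [dx]
    rw [(K.elem j).fderivWithin_mul hlin.contDiffOn (hvs.norm_sq ℝ) hz,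
      (K.elem j).fderivWithin_norm_sq hvs hz, h3, h4]
    simp
  rw [Finset.sum_congr rfl fun j _ => h2 j, Finset.sum_eq_zero_iff_of_nonneg
    fun j _ => integral_nonneg fun z => by positivity] at h1
  exact Mesh.eq_zero_of_carrier (K := K) (fun j => (K.elem j).eq_zero_of_integral_sq
    (Mesh.velocity_contDiffOn hv j).continuousOn (h1 j (Finset.mem_univ j))) hv.2.2.2.2

theorem Mesh.integrableOn_carrier {g : ST d → ℝ} {j : Fin K.card}
    (hg : ContinuousOn g (K.elem j).carrier) : IntegrableOn g (K.elem j).carrier :=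
  hg.integrableOn_compact (K.elem j).isCompact_carrier

include hΩo hΩl hT hΩb in
/-- The convective term is skew symmetric up to the contribution of the final time. -/
theorem Mesh.integral_inner_advM {a v : ST d → Sp d} (ha : a ∈ K.Vh k) (hv : v ∈ K.Vh k) :
    ∑ j, ∫ z in (K.elem j).carrier, inner ℝ (v z) (advM (K.elem j).carrier a v z) =
      ∑ j, (1 / 2 : ℝ) * ∫ x in (K.elem j).top T, ‖v (x, T)‖ ^ 2 := by
  have hn := Mesh.velocity_norm_sq_piecewiseSmooth hv
  have h1 := hn.integral_dt hΩo hΩl hT (fun z hz => by simp [hv.2.2.1 z (Or.inr hz)])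
  have h2 : ∀ i, ∑ j, ∫ z in (K.elem j).carrier,
      dx (K.elem j).carrier i (fun z => a z i * ‖v z‖ ^ 2) z = 0 := fun i =>
    ((Mesh.velocity_piecewiseSmooth ha i).mul hn).integral_dx hΩo hΩl hT hΩb
      (fun z hz => by simp [hv.2.2.1 z (Or.inl hz)]) i
  have hcl : ContinuousOn (fun x : Sp d => ‖v (x, T)‖ ^ 2) (closure Ω) :=
    (hv.2.1.comp (by fun_prop) fun x hx => by
      rw [closure_stDom hT]; exact ⟨hx, hT.le, le_rfl⟩).norm.pow 2
  rw [← Finset.mul_sum, ← K.integral_top hΩo hT hcl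
    (fun x hx => by simp [Mesh.velocity_eq_zero_final hT hv hx]), ← h1]
  -- Pointwise v·M[a]v = ½∂_t|v|² + ½Σ∂_i(a_i|v|²): the term ½(∇·a)v is exactly what completes the
  -- divergence.
  have h3 : ∀ j, ∫ z in (K.elem j).carrier, inner ℝ (v z) (advM (K.elem j).carrier a v z) =
      (1 / 2 : ℝ) * (∫ z in (K.elem j).carrier, dt (K.elem j).carrier (fun z => ‖v z‖ ^ 2) z) +
      (1 / 2 : ℝ) * ∑ i, ∫ z in (K.elem j).carrier,
        dx (K.elem j).carrier i (fun z => a z i * ‖v z‖ ^ 2) z := by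
    intro j
    have hvs := Mesh.velocity_contDiffOn hv j
    have has := Mesh.velocity_contDiffOn ha j
    have c1 : IntegrableOn (dt (K.elem j).carrier fun z => ‖v z‖ ^ 2) (K.elem j).carrier :=
      Mesh.integrableOn_carrier ((K.elem j).continuousOn_dt (hn.smooth j))
    have c2 : ∀ i, IntegrableOn (dx (K.elem j).carrier i fun z => a z i * ‖v z‖ ^ 2)
        (K.elem j).carrier := fun i => Mesh.integrableOn_carrier ((K.elem j).continuousOn_dx
          (((Mesh.velocity_piecewiseSmooth ha i).mul hn).smooth j) i)
    rw [← integral_finsetSum _ fun i _ => c2 i, ← integral_const_mul, ← integral_const_mul,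
      ← integral_add (c1.const_mul _) ((integrable_finsetSum _ fun i _ => c2 i).const_mul _)]
    refine setIntegral_congr_fun (K.elem j).isCompact_carrier.measurableSet fun z hz => ?_
    simp only [dt, dx, advM, advL, div]
    rw [(K.elem j).fderivWithin_norm_sq hvs hz, inner_add_right, inner_add_right,
      inner_sum, inner_smul_right, real_inner_self_eq_norm_sq]
    have h4 : ∀ i, fderivWithin ℝ (fun z => a z i * ‖v z‖ ^ 2) (K.elem j).carrier z
        (EuclideanSpace.single i 1, 0) =
        2 * inner ℝ (v z) (a z i • fderivWithin ℝ v (K.elem j).carrier z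
          (EuclideanSpace.single i 1, 0)) +
        fderivWithin ℝ a (K.elem j).carrier z (EuclideanSpace.single i 1, 0) i * ‖v z‖ ^ 2 := by
      intro i
      rw [(K.elem j).fderivWithin_mul ((Mesh.velocity_piecewiseSmooth ha i).smooth j)
        (hn.smooth j) hz, (K.elem j).fderivWithin_norm_sq hvs hz,
        (K.elem j).fderivWithin_coord has hz, inner_smul_right]
      ring
    simp only [h4, Finset.sum_add_distrib, ← Finset.mul_sum, ← Finset.sum_mul]
    ring
  rw [Finset.sum_congr rfl fun j _ => h3 j, Finset.sum_add_distrib, ← Finset.mul_sum,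
    ← Finset.mul_sum, Finset.sum_comm, Finset.sum_congr rfl fun i _ => h2 i]
  simp

include hΩo hΩl hT hΩb in
/-- Divergences are orthogonal to pressures with vanishing elementwise gradient. -/
theorem Mesh.integral_div_mul {v : ST d → Sp d} {q : ST d → ℝ} (hv : v ∈ K.Vh k)
    (hq : q ∈ K.Qh k)
    (h : ∀ j, ∀ z ∈ (K.elem j).carrier, grad (K.elem j).carrier q z = 0) :
    ∑ j, ∫ z in (K.elem j).carrier, div (K.elem j).carrier v z * q z = 0 := by
  have hqs := Mesh.pressure_piecewiseSmooth hq
  have h2 : ∀ i, ∑ j, ∫ z in (K.elem j).carrier,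
      dx (K.elem j).carrier i (fun z => v z i * q z) z = 0 := fun i =>
    ((Mesh.velocity_piecewiseSmooth hv i).mul hqs).integral_dx hΩo hΩl hT hΩb
      (fun z hz => by simp [hv.2.2.1 z (Or.inl hz)]) i
  -- Because ∇q = 0, the product rule turns (∇·v)q into the divergence of qv.
  have h3 : ∀ j, ∫ z in (K.elem j).carrier, div (K.elem j).carrier v z * q z =
      ∑ i, ∫ z in (K.elem j).carrier, dx (K.elem j).carrier i (fun z => v z i * q z) z := by
    intro j
    rw [← integral_finsetSum _ fun i _ => Mesh.integrableOn_carrier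
      ((K.elem j).continuousOn_dx (((Mesh.velocity_piecewiseSmooth hv i).mul hqs).smooth j) i)]
    refine setIntegral_congr_fun (K.elem j).isCompact_carrier.measurableSet fun z hz => ?_
    simp only [div, Finset.sum_mul]
    refine Finset.sum_congr rfl fun i _ => ?_
    have h5 : fderivWithin ℝ q (K.elem j).carrier z (EuclideanSpace.single i 1, 0) = 0 :=
      congrArg (fun f : Sp d => f i) (h j z hz)
    simp only [dx]
    rw [(K.elem j).fderivWithin_mul ((Mesh.velocity_piecewiseSmooth hv i).smooth j)
        (hqs.smooth j) hz, (K.elem j).fderivWithin_coord (Mesh.velocity_contDiffOn hv j) hz, h5]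
    ring
  rw [Finset.sum_congr rfl fun j _ => h3 j, Finset.sum_comm,
    Finset.sum_congr rfl fun i _ => h2 i, Finset.sum_const_zero]

end Identities

/-! ### Continuous functions on compact sets as elements of `L²` -/

section L2

variable {X E : Type*} [TopologicalSpace X] [T2Space X] [MeasureSpace X] [BorelSpace X]
  [IsFiniteMeasureOnCompacts (volume : Measure X)] [NormedAddCommGroup E] [InnerProductSpace ℝ E]

omit [InnerProductSpace ℝ E] in
theorem memLp_of_continuousOn {S : Set X} (hS : IsCompact S) {f : X → E}
    (hf : ContinuousOn f S) : MemLp f 2 (volume.restrict S) := by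
  have : IsFiniteMeasure (volume.restrict S) := ⟨by simpa using hS.measure_lt_top⟩
  obtain ⟨C, hC⟩ := hS.exists_bound_of_continuousOn hf
  refine MemLp.of_bound (hf.aestronglyMeasurable_of_isCompact hS hS.measurableSet) C ?_
  exact (ae_restrict_iff' hS.measurableSet).2 (Filter.Eventually.of_forall hC)

/-- The class in `L²(S)` of a function which is continuous on the compact set `S`. -/
def embL2 (S : Set X) (hS : IsCompact S) (f : X → E) (hf : ContinuousOn f S) :
    Lp E 2 (volume.restrict S) := (memLp_of_continuousOn hS hf).toLp f

variable {S : Set X} {hS : IsCompact S}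

omit [InnerProductSpace ℝ E] in
theorem embL2_coe {f : X → E} (hf : ContinuousOn f S) :
    embL2 S hS f hf =ᵐ[volume.restrict S] f := MemLp.coeFn_toLp _

omit [InnerProductSpace ℝ E] in
theorem embL2_add {f g h : X → E} (hf : ContinuousOn f S) (hg : ContinuousOn g S)
    (hh : ContinuousOn h S) (H : ∀ x ∈ S, f x = g x + h x) :
    embL2 S hS f hf = embL2 S hS g hg + embL2 S hS h hh := by
  rw [embL2, embL2, embL2, ← MemLp.toLp_add]
  exact MemLp.toLp_congr _ _
    ((ae_restrict_iff' hS.measurableSet).2 (Filter.Eventually.of_forall H))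

theorem embL2_smul {f g : X → E} (c : ℝ) (hf : ContinuousOn f S) (hg : ContinuousOn g S)
    (H : ∀ x ∈ S, f x = c • g x) : embL2 S hS f hf = c • embL2 S hS g hg := by
  rw [embL2, embL2, ← MemLp.toLp_const_smul]
  exact MemLp.toLp_congr _ _
    ((ae_restrict_iff' hS.measurableSet).2 (Filter.Eventually.of_forall H))

theorem inner_embL2 {f g : X → E} (hf : ContinuousOn f S) (hg : ContinuousOn g S) :
    inner ℝ (embL2 S hS f hf) (embL2 S hS g hg) = ∫ x in S, inner ℝ (f x) (g x) := by
  rw [L2.inner_def]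
  refine integral_congr_ae ?_
  filter_upwards [embL2_coe (hS := hS) hf, embL2_coe (hS := hS) hg] with x h1 h2
  rw [h1, h2]

theorem norm_sq_embL2 {f : X → E} (hf : ContinuousOn f S) :
    ‖embL2 S hS f hf‖ ^ 2 = ∫ x in S, ‖f x‖ ^ 2 := by
  rw [← real_inner_self_eq_norm_sq, inner_embL2]
  simp only [real_inner_self_eq_norm_sq]

theorem norm_embL2 {f : X → E} (hf : ContinuousOn f S) :
    ‖embL2 S hS f hf‖ = √(∫ x in S, ‖f x‖ ^ 2) := by
  rw [← norm_sq_embL2 (hS := hS) hf, Real.sqrt_sq (norm_nonneg _)]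

variable {V W : Type*} [AddCommGroup V] [Module ℝ V] [AddCommGroup W] [Module ℝ W]

/-- Linear families of continuous functions, as a linear map into `L²(S)`. -/
def embLin (S : Set X) (hS : IsCompact S) (A : V → X → E) (hc : ∀ v, ContinuousOn (A v) S)
    (hadd : ∀ u v, ∀ x ∈ S, A (u + v) x = A u x + A v x)
    (hsmul : ∀ (c : ℝ) v, ∀ x ∈ S, A (c • v) x = c • A v x) :
    V →ₗ[ℝ] Lp E 2 (volume.restrict S) where
  toFun v := embL2 S hS (A v) (hc v)
  map_add' u v := embL2_add _ _ _ (hadd u v)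
  map_smul' c v := embL2_smul c _ _ (hsmul c v)

theorem embLin_apply (A : V → X → E) (hc : ∀ v, ContinuousOn (A v) S)
    (hadd : ∀ u v, ∀ x ∈ S, A (u + v) x = A u x + A v x)
    (hsmul : ∀ (c : ℝ) v, ∀ x ∈ S, A (c • v) x = c • A v x) (v : V) :
    embLin S hS A hc hadd hsmul v = embL2 S hS (A v) (hc v) := rfl

/-- Bilinear families of continuous functions, as a bilinear map into `L²(S)`. -/
def embBilin (S : Set X) (hS : IsCompact S) (A : V → W → X → E)
    (hc : ∀ v w, ContinuousOn (A v w) S)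
    (hadd : ∀ u v w, ∀ x ∈ S, A (u + v) w x = A u w x + A v w x)
    (hsmul : ∀ (c : ℝ) v w, ∀ x ∈ S, A (c • v) w x = c • A v w x)
    (hadd' : ∀ v w w', ∀ x ∈ S, A v (w + w') x = A v w x + A v w' x)
    (hsmul' : ∀ (c : ℝ) v w, ∀ x ∈ S, A v (c • w) x = c • A v w x) :
    V →ₗ[ℝ] W →ₗ[ℝ] Lp E 2 (volume.restrict S) :=
  LinearMap.mk₂ ℝ (fun v w => embL2 S hS (A v w) (hc v w))
    (fun u v w => embL2_add _ _ _ (hadd u v w)) (fun c v w => embL2_smul c _ _ (hsmul c v w))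
    (fun v w w' => embL2_add _ _ _ (hadd' v w w')) (fun c v w => embL2_smul c _ _ (hsmul' c v w))

end L2

/-! ### Lipschitz dependence of the convective speed on the field -/

section ConvSup

variable {d : ℕ} (e : Element d)

instance : CompactSpace e.carrier := isCompact_iff_compactSpace.1 e.isCompact_carrier

instance : Nonempty e.carrier := (e.core_nonempty.mono e.core_subset).to_subtype

theorem Element.convSup_nonneg (a : ST d → Sp d) : 0 ≤ e.convSup a :=
  Real.iSup_nonneg fun _ => Real.sqrt_nonneg _

/-- The slope of √(x² + 1) is at most 1. Squaring reduces this to y ≤ √(y² + 1). -/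
theorem sqrt_sq_add_one_le {x y : ℝ} (hy : 0 ≤ y) :
    √(x ^ 2 + 1) ≤ √(y ^ 2 + 1) + |x - y| := by
  refine Real.sqrt_le_iff.2 ⟨by positivity, ?_⟩
  have h1 : y ≤ √(y ^ 2 + 1) := Real.le_sqrt_of_sq_le (by linarith)
  have h2 : √(y ^ 2 + 1) ^ 2 = y ^ 2 + 1 := Real.sq_sqrt (by positivity)
  have h3 : y * (x - y) ≤ √(y ^ 2 + 1) * |x - y| :=
    (mul_le_mul_of_nonneg_left (le_abs_self _) hy).trans
      (mul_le_mul_of_nonneg_right h1 (abs_nonneg _))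
  have h4 : |x - y| ^ 2 = (x - y) ^ 2 := sq_abs _
  nlinarith

theorem Element.convSup_le {a b : ST d → Sp d} (hb : ContinuousOn b e.carrier) {M : ℝ}
    (h : ∀ z ∈ e.carrier, ‖a z - b z‖ ≤ M) : e.convSup a ≤ e.convSup b + M := by
  refine ciSup_le fun z => ?_
  have hbdd : BddAbove (range fun z : e.carrier => √(‖b z‖ ^ 2 + 1)) := by
    obtain ⟨C, hC⟩ := e.isCompact_carrier.exists_bound_of_continuousOn hb
    refine ⟨√(C ^ 2 + 1), ?_⟩
    rintro _ ⟨w, rfl⟩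
    have := hC w w.2
    exact Real.sqrt_le_sqrt (by gcongr)
  refine (sqrt_sq_add_one_le (norm_nonneg (b z))).trans (add_le_add (le_ciSup hbdd z) ?_)
  exact (abs_norm_sub_norm_le _ _).trans (h z z.2)

end ConvSup

/-! ### The stabilized finite element problem as an instance of the abstract setting -/

section Data

variable {d : ℕ} {Ω : Set (Sp d)} {T : ℝ} {K : Mesh Ω T} {k : ℕ}

theorem Mesh.smooth_velocity (v : K.velocity k) (j : Fin K.card) :
    ContDiffOn ℝ ∞ v.1 (K.elem j).carrier := Mesh.velocity_contDiffOn v.2 j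

theorem Mesh.smooth_pressure (q : K.pressure k) (j : Fin K.card) :
    ContDiffOn ℝ ∞ q.1 (K.elem j).carrier := (Mesh.pressure_piecewiseSmooth q.2).smooth j

theorem Element.continuousOn_top {e : Element d} {F : Type*} [TopologicalSpace F]
    {f : ST d → F} (hf : ContinuousOn f e.carrier) :
    ContinuousOn (fun x : Sp d => f (x, T)) (e.top T) :=
  hf.comp (by fun_prop) fun _ hx => hx

/-- Restriction of velocities to an element, as continuous functions. -/
def Mesh.restrictMap (j : Fin K.card) : K.velocity k →ₗ[ℝ] C((K.elem j).carrier, Sp d) where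
  toFun v := ⟨fun z => v.1 z, (K.smooth_velocity v j).continuousOn.domRestrict⟩
  map_add' _ _ := rfl
  map_smul' _ _ := rfl

theorem Mesh.abs_convSup_sub_le (j : Fin K.card) (a b : K.velocity k) :
    |(K.elem j).convSup a.1 - (K.elem j).convSup b.1| ≤ ‖Mesh.restrictMap j (a - b)‖ := by
  have h : ∀ z ∈ (K.elem j).carrier, ‖a.1 z - b.1 z‖ ≤ ‖Mesh.restrictMap j (a - b)‖ :=
    fun z hz => ContinuousMap.norm_coe_le_norm (Mesh.restrictMap j (a - b)) ⟨z, hz⟩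
  have h1 := (K.elem j).convSup_le (K.smooth_velocity b j).continuousOn h
  have h2 := (K.elem j).convSup_le (a := b.1) (K.smooth_velocity a j).continuousOn
    (fun z hz => norm_sub_rev (a.1 z) (b.1 z) ▸ h z hz)
  exact abs_sub_le_iff.2 ⟨by linarith, by linarith⟩

/-- The standing assumptions on the domain, the mesh and the parameters. -/
structure Mesh.Setting (K : Mesh Ω T) (k : ℕ) (P : Params) : Prop where
  isOpen : IsOpen Ω
  lipschitz : HasLipschitzBoundary Ω
  T_pos : 0 < T
  bounded : Bornology.IsBounded Ω
  dim_ne : d ≠ 0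
  ν_pos : 0 < P.ν
  c₁_gt : 2 < P.c₁
  c₂_pos : 0 < P.c₂
  c₃_pos : 0 < P.c₃
  c₄_pos : 0 < P.c₄
  CI_pos : 0 < P.CI
  inverse : IsInverseConst K k P.CI

/-- The data of the stabilized method. -/
def Mesh.Setting.data {P : Params} (h : K.Setting k P) :
    StabilizedData (K.velocity k) (K.pressure k)
      (fun j => Lp (Sp d) 2 (volume.restrict (K.elem j).carrier))
      (fun j => Lp (PiLp 2 fun _ : Fin d => Sp d) 2 (volume.restrict (K.elem j).carrier))
      (fun j => Lp ℝ 2 (volume.restrict (K.elem j).carrier))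
      (fun j => Lp (Sp d) 2 (volume.restrict ((K.elem j).top T)))
      (fun j => C((K.elem j).carrier, Sp d)) where
  val j := embLin (K.elem j).carrier (K.elem j).isCompact_carrier (fun v => v.1)
    (fun v => (K.smooth_velocity v j).continuousOn) (fun _ _ _ _ => rfl) (fun _ _ _ _ => rfl)
  grd j := embLin (K.elem j).carrier (K.elem j).isCompact_carrier
    (fun v => gradVec (K.elem j).carrier v.1)
    (fun v => (K.elem j).continuousOn_gradVec (K.smooth_velocity v j))
    (fun u v x hx => by
      ext1 i; exact (K.elem j).dx_add (K.smooth_velocity u j) (K.smooth_velocity v j) i hx)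
    (fun c v x hx => by ext1 i; exact (K.elem j).dx_smul c (K.smooth_velocity v j) i hx)
  dvg j := embLin (K.elem j).carrier (K.elem j).isCompact_carrier
    (fun v => div (K.elem j).carrier v.1)
    (fun v => (K.elem j).continuousOn_div (K.smooth_velocity v j))
    (fun u v x hx => (K.elem j).div_add (K.smooth_velocity u j) (K.smooth_velocity v j) hx)
    (fun c v x hx => (K.elem j).div_smul c (K.smooth_velocity v j) hx)
  lpl j := embLin (K.elem j).carrier (K.elem j).isCompact_carrier
    (fun v => lap (K.elem j).carrier v.1)
    (fun v => (K.elem j).continuousOn_lap (K.smooth_velocity v j))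
    (fun u v x hx => (K.elem j).lap_add (K.smooth_velocity u j) (K.smooth_velocity v j) hx)
    (fun c v x hx => (K.elem j).lap_smul c (K.smooth_velocity v j) hx)
  res j := embLin (K.elem j).carrier (K.elem j).isCompact_carrier
    (fun φ z => dt (K.elem j).carrier φ.1.1 z + grad (K.elem j).carrier φ.2.1 z)
    (fun φ => ((K.elem j).continuousOn_dt (K.smooth_velocity φ.1 j)).add
      ((K.elem j).continuousOn_grad (K.smooth_pressure φ.2 j)))
    (fun φ ψ x hx => by
      have h1 := (K.elem j).dt_add (K.smooth_velocity φ.1 j) (K.smooth_velocity ψ.1 j) hx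
      have h2 := (K.elem j).grad_add (K.smooth_pressure φ.2 j) (K.smooth_pressure ψ.2 j) hx
      simp only [Prod.fst_add, Prod.snd_add, Submodule.coe_add, h1, h2]
      abel)
    (fun c φ x hx => by
      have h1 := (K.elem j).dt_smul c (K.smooth_velocity φ.1 j) hx
      have h2 := (K.elem j).grad_smul c (K.smooth_pressure φ.2 j) hx
      simp only [Prod.smul_fst, Prod.smul_snd, Submodule.coe_smul, h1, h2, smul_add])
  adv j := embBilin (K.elem j).carrier (K.elem j).isCompact_carrier
    (fun a v => advL (K.elem j).carrier a.1 v.1)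
    (fun a v => (K.elem j).continuousOn_advL (K.smooth_velocity a j) (K.smooth_velocity v j))
    (fun a b v x hx =>
      (K.elem j).advL_add_left (K.smooth_velocity a j) (K.smooth_velocity b j) hx)
    (fun c a v x hx => (K.elem j).advL_smul_left c (K.smooth_velocity a j) hx)
    (fun a u v x hx =>
      (K.elem j).advL_add_right (K.smooth_velocity u j) (K.smooth_velocity v j) hx)
    (fun c a v x hx => (K.elem j).advL_smul_right c (K.smooth_velocity v j) hx)
  prs j := embLin (K.elem j).carrier (K.elem j).isCompact_carrier (fun q => q.1)
    (fun q => (K.smooth_pressure q j).continuousOn) (fun _ _ _ _ => rfl) (fun _ _ _ _ => rfl)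
  valT j := embLin ((K.elem j).top T) (K.elem j).isCompact_top (fun v x => v.1 (x, T))
    (fun v => Element.continuousOn_top (K.smooth_velocity v j).continuousOn)
    (fun _ _ _ _ => rfl) (fun _ _ _ _ => rfl)
  lplT j := embLin ((K.elem j).top T) (K.elem j).isCompact_top
    (fun v x => lap (K.elem j).carrier v.1 (x, T))
    (fun v => Element.continuousOn_top ((K.elem j).continuousOn_lap (K.smooth_velocity v j)))
    (fun u v x hx => (K.elem j).lap_add (K.smooth_velocity u j) (K.smooth_velocity v j) hx)
    (fun c v x hx => (K.elem j).lap_smul c (K.smooth_velocity v j) hx)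
  resT j := embLin ((K.elem j).top T) (K.elem j).isCompact_top
    (fun φ x => dt (K.elem j).carrier φ.1.1 (x, T) + grad (K.elem j).carrier φ.2.1 (x, T))
    (fun φ => (Element.continuousOn_top
        ((K.elem j).continuousOn_dt (K.smooth_velocity φ.1 j))).add
      (Element.continuousOn_top ((K.elem j).continuousOn_grad (K.smooth_pressure φ.2 j))))
    (fun φ ψ x hx => by
      have h1 := (K.elem j).dt_add (K.smooth_velocity φ.1 j) (K.smooth_velocity ψ.1 j) hx
      have h2 := (K.elem j).grad_add (K.smooth_pressure φ.2 j) (K.smooth_pressure ψ.2 j) hx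
      simp only [Prod.fst_add, Prod.snd_add, Submodule.coe_add, h1, h2]
      abel)
    (fun c φ x hx => by
      have h1 := (K.elem j).dt_smul c (K.smooth_velocity φ.1 j) hx
      have h2 := (K.elem j).grad_smul c (K.smooth_pressure φ.2 j) hx
      simp only [Prod.smul_fst, Prod.smul_snd, Submodule.coe_smul, h1, h2, smul_add])
  advT j := embBilin ((K.elem j).top T) (K.elem j).isCompact_top
    (fun a v x => advL (K.elem j).carrier a.1 v.1 (x, T))
    (fun a v => Element.continuousOn_top
      ((K.elem j).continuousOn_advL (K.smooth_velocity a j) (K.smooth_velocity v j)))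
    (fun a b v x hx =>
      (K.elem j).advL_add_left (K.smooth_velocity a j) (K.smooth_velocity b j) hx)
    (fun c a v x hx => (K.elem j).advL_smul_left c (K.smooth_velocity a j) hx)
    (fun a u v x hx =>
      (K.elem j).advL_add_right (K.smooth_velocity u j) (K.smooth_velocity v j) hx)
    (fun c a v x hx => (K.elem j).advL_smul_right c (K.smooth_velocity v j) hx)
  eval j := Mesh.restrictMap j
  spd j a := (K.elem j).convSup a.1
  ν := P.ν
  c₁ := P.c₁
  -- With κ = C_I/h_e and β = c₂/h_e the abstract parameters become τ_m and τ_c.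
  κ j := P.CI / (K.elem j).size
  β j := P.c₂ / (K.elem j).size
  γ₀ := P.c₃ * P.CI ^ 2 * P.ν
  γ₁ j := P.c₄ * (K.elem j).size
  ν_pos := h.ν_pos
  two_lt_c₁ := h.c₁_gt
  κ_pos j := div_pos h.CI_pos ((K.elem j).size_pos h.dim_ne)
  β_pos j := div_pos h.c₂_pos ((K.elem j).size_pos h.dim_ne)
  γ₀_nonneg := mul_nonneg (mul_nonneg h.c₃_pos.le (sq_nonneg _)) h.ν_pos.le
  γ₁_nonneg j := mul_nonneg h.c₄_pos.le ((K.elem j).size_pos h.dim_ne).le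
  spd_nonneg j a := (K.elem j).convSup_nonneg a.1
  spd_lip j a b := Mesh.abs_convSup_sub_le j a b
  norm_lpl_le j v := by
    rw [embLin_apply, embLin_apply, norm_embL2, norm_embL2]
    simp only [norm_gradVec_sq]
    exact (h.inverse v.1 v.2 j).2.1
  -- On the final face the two inverse inequalities are chained, whence κ².
  norm_lplT_le j v := by
    rw [embLin_apply, embLin_apply, norm_embL2, norm_embL2, pow_two, mul_assoc]
    exact (h.inverse v.1 v.2 j).2.2.2.trans (mul_le_mul_of_nonneg_left (h.inverse v.1 v.2 j).2.2.1
      (div_pos h.CI_pos ((K.elem j).size_pos h.dim_ne)).le)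
  grd_inj v hv := by
    refine Subtype.ext (Mesh.velocity_eq_zero_of_gradVec h.isOpen h.lipschitz h.T_pos
      h.bounded h.dim_ne v.2 fun j => ?_)
    have hc := (K.elem j).continuousOn_gradVec (K.smooth_velocity v j)
    have h1 := hv j
    rw [embLin_apply] at h1
    refine (K.elem j).eq_zero_of_integral_sq hc ?_
    rw [← norm_sq_embL2 (hS := (K.elem j).isCompact_carrier) hc, h1, norm_zero, sq, zero_mul]

end Data

/-! ### The forms and norms of the method in terms of the abstract data -/

section Identification

variable {d : ℕ} {Ω : Set (Sp d)} {T : ℝ} {K : Mesh Ω T} {k : ℕ} {P : Params}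

namespace Mesh

/-- The pair of functions represented by an element of `V_h × Q_h`. -/
def pair (φ : K.velocity k × K.pressure k) : (ST d → Sp d) × (ST d → ℝ) := (φ.1.1, φ.2.1)

theorem continuousOn_smul_lap (c : ℝ) (u : K.velocity k) (j : Fin K.card) :
    ContinuousOn (fun z => c • lap (K.elem j).carrier u.1 z) (K.elem j).carrier :=
  ((K.elem j).continuousOn_lap (K.smooth_velocity u j)).fun_const_smul c

theorem continuousOn_advM (a u : K.velocity k) (j : Fin K.card) :
    ContinuousOn (fun z => advM (K.elem j).carrier a.1 u.1 z) (K.elem j).carrier :=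
  ((K.elem j).continuousOn_dt (K.smooth_velocity u j)).add
    ((K.elem j).continuousOn_advL (K.smooth_velocity a j) (K.smooth_velocity u j))

theorem continuousOn_resid (a : K.velocity k) (φ : K.velocity k × K.pressure k)
    (j : Fin K.card) : ContinuousOn (fun z => advM (K.elem j).carrier a.1 φ.1.1 z +
      SpaceTimeVMS.grad (K.elem j).carrier φ.2.1 z) (K.elem j).carrier :=
  (continuousOn_advM a φ.1 j).add ((K.elem j).continuousOn_grad (K.smooth_pressure φ.2 j))

theorem continuousOn_resid_lap (c : ℝ) (a : K.velocity k) (φ : K.velocity k × K.pressure k)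
    (j : Fin K.card) : ContinuousOn (fun z => advM (K.elem j).carrier a.1 φ.1.1 z +
      c • lap (K.elem j).carrier φ.1.1 z + SpaceTimeVMS.grad (K.elem j).carrier φ.2.1 z)
      (K.elem j).carrier :=
  ((continuousOn_advM a φ.1 j).add (continuousOn_smul_lap c φ.1 j)).add
    ((K.elem j).continuousOn_grad (K.smooth_pressure φ.2 j))

namespace Setting

variable (h : K.Setting k P)

theorem val_apply (v : K.velocity k) (j : Fin K.card) :
    h.data.val j v = embL2 _ (K.elem j).isCompact_carrier v.1
      (K.smooth_velocity v j).continuousOn := rfl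

theorem grd_apply (v : K.velocity k) (j : Fin K.card) :
    h.data.grd j v = embL2 _ (K.elem j).isCompact_carrier (gradVec (K.elem j).carrier v.1)
      ((K.elem j).continuousOn_gradVec (K.smooth_velocity v j)) := rfl

theorem dvg_apply (v : K.velocity k) (j : Fin K.card) :
    h.data.dvg j v = embL2 _ (K.elem j).isCompact_carrier
      (SpaceTimeVMS.div (K.elem j).carrier v.1)
      ((K.elem j).continuousOn_div (K.smooth_velocity v j)) := rfl

theorem prs_apply (q : K.pressure k) (j : Fin K.card) :
    h.data.prs j q = embL2 _ (K.elem j).isCompact_carrier q.1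
      (K.smooth_pressure q j).continuousOn := rfl

theorem valT_apply (v : K.velocity k) (j : Fin K.card) :
    h.data.valT j v = embL2 _ (K.elem j).isCompact_top (fun x => v.1 (x, T))
      (Element.continuousOn_top (K.smooth_velocity v j).continuousOn) := rfl

theorem lpl_apply (v : K.velocity k) (j : Fin K.card) :
    h.data.lpl j v = embL2 _ (K.elem j).isCompact_carrier
      (fun z => lap (K.elem j).carrier v.1 z)
      ((K.elem j).continuousOn_lap (K.smooth_velocity v j)) := rfl

theorem lplT_apply (v : K.velocity k) (j : Fin K.card) :
    h.data.lplT j v = embL2 _ (K.elem j).isCompact_top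
      (fun x => lap (K.elem j).carrier v.1 (x, T)) (Element.continuousOn_top
        ((K.elem j).continuousOn_lap (K.smooth_velocity v j))) := rfl

theorem X_apply (a : K.velocity k) (φ : K.velocity k × K.pressure k) (j : Fin K.card) :
    h.data.X j a φ = embL2 _ (K.elem j).isCompact_carrier
      (fun z => advM (K.elem j).carrier a.1 φ.1.1 z +
        SpaceTimeVMS.grad (K.elem j).carrier φ.2.1 z) (continuousOn_resid a φ j) :=
  (embL2_add (continuousOn_resid a φ j)
    (((K.elem j).continuousOn_dt (K.smooth_velocity φ.1 j)).add
      ((K.elem j).continuousOn_grad (K.smooth_pressure φ.2 j)))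
    ((K.elem j).continuousOn_advL (K.smooth_velocity a j) (K.smooth_velocity φ.1 j))
    fun z _ => by simp only [advM, Pi.add_apply]; abel).symm

theorem XT_apply (a : K.velocity k) (φ : K.velocity k × K.pressure k) (j : Fin K.card) :
    h.data.XT j a φ = embL2 _ (K.elem j).isCompact_top
      (fun x => advM (K.elem j).carrier a.1 φ.1.1 (x, T) +
        SpaceTimeVMS.grad (K.elem j).carrier φ.2.1 (x, T))
      (Element.continuousOn_top (continuousOn_resid a φ j)) :=
  (embL2_add (Element.continuousOn_top (continuousOn_resid a φ j))
    (Element.continuousOn_top (((K.elem j).continuousOn_dt (K.smooth_velocity φ.1 j)).add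
      ((K.elem j).continuousOn_grad (K.smooth_pressure φ.2 j))))
    (Element.continuousOn_top
      ((K.elem j).continuousOn_advL (K.smooth_velocity a j) (K.smooth_velocity φ.1 j)))
    fun z _ => by simp only [advM, Pi.add_apply]; abel).symm

theorem X_add_lpl (c : ℝ) (a : K.velocity k) (φ : K.velocity k × K.pressure k)
    (j : Fin K.card) :
    h.data.X j a φ + c • h.data.lpl j φ.1 = embL2 _ (K.elem j).isCompact_carrier
      (fun z => advM (K.elem j).carrier a.1 φ.1.1 z +
      c • lap (K.elem j).carrier φ.1.1 z + SpaceTimeVMS.grad (K.elem j).carrier φ.2.1 z)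
      (continuousOn_resid_lap c a φ j) := by
  rw [lpl_apply, ← embL2_smul c (continuousOn_smul_lap c φ.1 j) _ fun _ _ => rfl, X_apply]
  exact (embL2_add _ _ _ fun z _ => by abel).symm

theorem XT_add_lplT (c : ℝ) (a : K.velocity k) (φ : K.velocity k × K.pressure k)
    (j : Fin K.card) :
    h.data.XT j a φ + c • h.data.lplT j φ.1 = embL2 _ (K.elem j).isCompact_top
      (fun x => advM (K.elem j).carrier a.1 φ.1.1 (x, T) +
      c • lap (K.elem j).carrier φ.1.1 (x, T) +
      SpaceTimeVMS.grad (K.elem j).carrier φ.2.1 (x, T))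
      (Element.continuousOn_top (continuousOn_resid_lap c a φ j)) := by
  rw [lplT_apply, ← embL2_smul c (Element.continuousOn_top (continuousOn_smul_lap c φ.1 j)) _
    fun _ _ => rfl, XT_apply]
  exact (embL2_add _ _ _ fun z _ => by abel).symm

theorem inner_val_X (a u v : K.velocity k) (j : Fin K.card) :
    inner ℝ (h.data.val j u) (h.data.X j a (v, 0)) =
      ∫ z in (K.elem j).carrier, inner ℝ (u.1 z) (advM (K.elem j).carrier a.1 v.1 z) := by
  rw [val_apply, X_apply, inner_embL2]
  have h0 : ∀ z, SpaceTimeVMS.grad (K.elem j).carrier ((0 : K.pressure k) : ST d → ℝ) z = 0 := by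
    intro z
    ext i
    simp [SpaceTimeVMS.grad, dx]
  simp only [h0, add_zero]

-- The global integrals use derivatives within the cylinder, the abstract data those within an
-- element. They agree on cores, which fill the cylinder up to a null set.
include h in
theorem fderivWithin_eq {F : Type*} [NormedAddCommGroup F] [NormedSpace ℝ F] (G : ST d → F)
    {j : Fin K.card} {z : ST d} (hz : z ∈ (K.elem j).core) :
    fderivWithin ℝ G (stDom Ω T) z = fderivWithin ℝ G (K.elem j).carrier z :=
  Mesh.fderivWithin_stDom h.isOpen h.lipschitz h.T_pos G hz

include h in
theorem integral_inner_advM_eq (a u v : K.velocity k) :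
    ∫ z in stDom Ω T, inner ℝ (u.1 z) (advM (stDom Ω T) a.1 v.1 z) =
      ∑ j, inner ℝ (h.data.val j u) (h.data.X j a (v, 0)) := by
  simp only [inner_val_X]
  refine (K.integral_stDom h.isOpen h.lipschitz h.T_pos (fun j => ?_) fun j z hz => ?_).2
  · exact (K.smooth_velocity u j).continuousOn.inner (continuousOn_advM a v j)
  · simp only [advM, advL, dt, dx, SpaceTimeVMS.div, h.fderivWithin_eq _ hz]

theorem integral_gradDot_eq (u v : K.velocity k) :
    ∫ z in stDom Ω T, gradDot (stDom Ω T) u.1 v.1 z =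
      ∑ j, inner ℝ (h.data.grd j u) (h.data.grd j v) := by
  have h1 : ∀ j, (inner ℝ (h.data.grd j u) (h.data.grd j v) : ℝ) =
      ∫ z in (K.elem j).carrier, gradDot (K.elem j).carrier u.1 v.1 z := fun j => by
    rw [grd_apply, grd_apply, inner_embL2]
    simp only [inner_gradVec]
  simp only [h1]
  refine (K.integral_stDom h.isOpen h.lipschitz h.T_pos (fun j => ?_) fun j z hz => ?_).2
  · exact continuousOn_finsetSum _ fun i _ =>
      ((K.elem j).continuousOn_dx (K.smooth_velocity u j) i).inner
        ((K.elem j).continuousOn_dx (K.smooth_velocity v j) i)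
  · simp only [gradDot, dx, h.fderivWithin_eq _ hz]

theorem inner_dvg_prs (v : K.velocity k) (q : K.pressure k) (j : Fin K.card) :
    (inner ℝ (h.data.dvg j v) (h.data.prs j q) : ℝ) =
      ∫ z in (K.elem j).carrier, SpaceTimeVMS.div (K.elem j).carrier v.1 z * q.1 z := by
  rw [dvg_apply, prs_apply, inner_embL2]
  simp [mul_comm]

theorem integral_div_mul_eq (v : K.velocity k) (q : K.pressure k) :
    ∫ z in stDom Ω T, SpaceTimeVMS.div (stDom Ω T) v.1 z * q.1 z =
      ∑ j, inner ℝ (h.data.dvg j v) (h.data.prs j q) := by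
  simp only [inner_dvg_prs]
  refine (K.integral_stDom h.isOpen h.lipschitz h.T_pos (fun j => ?_) fun j z hz => ?_).2
  · exact ((K.elem j).continuousOn_div (K.smooth_velocity v j)).mul
      (K.smooth_pressure q j).continuousOn
  · simp only [SpaceTimeVMS.div, dx, h.fderivWithin_eq _ hz]

include h in
theorem continuousOn_final {F : Type*} [TopologicalSpace F] {f : ST d → F}
    (hf : ContinuousOn f (closure (stDom Ω T))) :
    ContinuousOn (fun x : Sp d => f (x, T)) (closure Ω) :=
  hf.comp (by fun_prop) fun x hx => by
    rw [closure_stDom h.T_pos]; exact ⟨hx, h.T_pos.le, le_rfl⟩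

theorem integral_top_inner_eq (u v : K.velocity k) :
    ∫ x in Ω, inner ℝ (u.1 (x, T)) (v.1 (x, T)) =
      ∑ j, inner ℝ (h.data.valT j u) (h.data.valT j v) := by
  have h1 : ∀ j, (inner ℝ (h.data.valT j u) (h.data.valT j v) : ℝ) =
      ∫ x in (K.elem j).top T, inner ℝ (u.1 (x, T)) (v.1 (x, T)) := fun j => by
    rw [valT_apply, valT_apply, inner_embL2]
  simp only [h1]
  exact K.integral_top h.isOpen h.T_pos
    ((h.continuousOn_final u.2.2.1).inner (h.continuousOn_final v.2.2.1))
    fun x hx => by simp [Mesh.velocity_eq_zero_final h.T_pos v.2 hx]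

theorem ν_eq : h.data.ν = P.ν := rfl

theorem τ_eq (a : K.velocity k) (j : Fin K.card) :
    P.τm (K.elem j) a.1 = h.data.τ j a := by
  change _ = (P.c₁ * (P.CI / (K.elem j).size) ^ 2 * P.ν +
    P.c₂ / (K.elem j).size * (K.elem j).convSup a.1)⁻¹
  rw [Params.τm]
  congr 1
  ring

theorem τc_eq (a : K.velocity k) (j : Fin K.card) :
    P.τc (K.elem j) a.1 = h.data.τc j a := by
  change _ = P.c₃ * P.CI ^ 2 * P.ν + P.c₄ * (K.elem j).size * (K.elem j).convSup a.1
  rw [Params.τc]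
  ring

theorem Bh_eq (a : K.velocity k) (φ ψ : K.velocity k × K.pressure k) :
    Bh K P a.1 (pair φ) (pair ψ) = h.data.form a φ ψ := by
  have e1 : ∫ z in stDom Ω T, φ.2.1 z * SpaceTimeVMS.div (stDom Ω T) ψ.1.1 z =
      ∑ j, inner ℝ (h.data.prs j φ.2) (h.data.dvg j ψ.1) := by
    simp only [mul_comm (φ.2.1 _), real_inner_comm (h.data.dvg _ _) (h.data.prs _ _)]
    exact h.integral_div_mul_eq ψ.1 φ.2
  have e2 : ∀ j, (inner ℝ (h.data.X j a φ - P.ν • h.data.lpl j φ.1)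
      (h.data.X j a ψ + P.ν • h.data.lpl j ψ.1) : ℝ) = ∫ z in (K.elem j).carrier,
        inner ℝ
          (advM (K.elem j).carrier a.1 φ.1.1 z - P.ν • lap (K.elem j).carrier φ.1.1 z
            + SpaceTimeVMS.grad (K.elem j).carrier φ.2.1 z)
          (advM (K.elem j).carrier a.1 ψ.1.1 z + P.ν • lap (K.elem j).carrier ψ.1.1 z
            + SpaceTimeVMS.grad (K.elem j).carrier ψ.2.1 z) := fun j => by
    rw [sub_eq_add_neg, ← neg_smul, h.X_add_lpl, h.X_add_lpl, inner_embL2]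
    simp only [neg_smul, ← sub_eq_add_neg]
  have e3 : ∀ j, (inner ℝ (h.data.XT j a φ - P.ν • h.data.lplT j φ.1)
      (h.data.valT j ψ.1) : ℝ) = ∫ x in (K.elem j).top T,
        inner ℝ
          (advM (K.elem j).carrier a.1 φ.1.1 (x, T) - P.ν • lap (K.elem j).carrier φ.1.1 (x, T)
            + SpaceTimeVMS.grad (K.elem j).carrier φ.2.1 (x, T)) (ψ.1.1 (x, T)) := fun j => by
    rw [sub_eq_add_neg, ← neg_smul, h.XT_add_lplT, valT_apply, inner_embL2]
    simp only [neg_smul, ← sub_eq_add_neg]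
  have e4 : ∀ j, (inner ℝ (h.data.dvg j φ.1) (h.data.dvg j ψ.1) : ℝ) =
      ∫ z in (K.elem j).carrier, SpaceTimeVMS.div (K.elem j).carrier φ.1.1 z *
        SpaceTimeVMS.div (K.elem j).carrier ψ.1.1 z := fun j => by
    rw [dvg_apply, dvg_apply, inner_embL2]
    simp [mul_comm]
  simp only [Bh, pair]
  rw [h.integral_inner_advM_eq, h.integral_gradDot_eq, e1, h.integral_div_mul_eq,
    h.integral_top_inner_eq]
  simp only [← e2, ← e3, ← e4, h.τ_eq, h.τc_eq]
  exact (h.data.form_eq a φ ψ).symm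

theorem gradNorm_eq (u : K.velocity k) : gradNorm Ω T u.1 = ‖h.data.grad u‖ := by
  rw [gradNorm, h.integral_gradDot_eq]
  simp only [real_inner_self_eq_norm_sq]
  rw [← StabilizedData.norm_grad_sq, Real.sqrt_sq (norm_nonneg _)]

theorem triNorm_eq (a : K.velocity k) (φ : K.velocity k × K.pressure k) :
    triNorm K P a.1 (pair φ) = h.data.tri a φ := by
  rw [triNorm, StabilizedData.tri, StabilizedData.triSq_eq]
  have e1 : ∫ x in Ω, ‖φ.1.1 (x, T)‖ ^ 2 = ∑ j, ‖h.data.valT j φ.1‖ ^ 2 := by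
    simp only [← real_inner_self_eq_norm_sq]
    exact h.integral_top_inner_eq φ.1 φ.1
  have e2 : ∫ z in stDom Ω T, gradDot (stDom Ω T) φ.1.1 φ.1.1 z = ‖h.data.grad φ.1‖ ^ 2 := by
    rw [h.integral_gradDot_eq, StabilizedData.norm_grad_sq]
    simp only [real_inner_self_eq_norm_sq]
  have e3 : ∀ j, ‖h.data.X j a φ‖ ^ 2 = ∫ z in (K.elem j).carrier,
      ‖advM (K.elem j).carrier a.1 φ.1.1 z + SpaceTimeVMS.grad (K.elem j).carrier φ.2.1 z‖ ^ 2 :=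
    fun j => by rw [h.X_apply, norm_sq_embL2]
  simp only [pair, e1, e2, e3, h.ν_eq, h.τ_eq]

/-- The forcing on an element. -/
def force (_h : K.Setting k P) {f : ST d → Sp d} (hf : ContinuousOn f (closure (stDom Ω T)))
    (j : Fin K.card) : Lp (Sp d) 2 (volume.restrict (K.elem j).carrier) :=
  embL2 _ (K.elem j).isCompact_carrier f (hf.mono (K.carrier_subset j))

/-- The forcing on a final time face. -/
def forceT (_h : K.Setting k P) {f : ST d → Sp d} (hf : ContinuousOn f (closure (stDom Ω T)))
    (j : Fin K.card) : Lp (Sp d) 2 (volume.restrict ((K.elem j).top T)) :=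
  embL2 _ (K.elem j).isCompact_top (fun x => f (x, T))
    (Element.continuousOn_top (hf.mono (K.carrier_subset j)))

variable {f : ST d → Sp d} (hf : ContinuousOn f (closure (stDom Ω T)))

theorem lam_eq (a : K.velocity k) :
    lam K P f a.1 = h.data.lam (h.force hf) (h.forceT hf) a := by
  have e1 : ∫ z in stDom Ω T, ‖P.ν⁻¹ • f z‖ ^ 2 = ∑ j, ‖P.ν⁻¹ • h.force hf j‖ ^ 2 := by
    have hc : ∀ j, ContinuousOn (fun z => P.ν⁻¹ • f z) (K.elem j).carrier := fun j =>
      (hf.mono (K.carrier_subset j)).fun_const_smul _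
    have h1 : ∀ j, ‖P.ν⁻¹ • h.force hf j‖ ^ 2 =
        ∫ z in (K.elem j).carrier, ‖P.ν⁻¹ • f z‖ ^ 2 := fun j => by
      rw [force, ← embL2_smul P.ν⁻¹ (hc j) _ fun _ _ => rfl, norm_sq_embL2]
    simp only [h1]
    exact (K.integral_stDom h.isOpen h.lipschitz h.T_pos (fun j => (hc j).norm.pow 2)
      fun j z _ => rfl).2
  have e2 : ∀ j, ‖h.force hf j‖ ^ 2 = ∫ z in (K.elem j).carrier, ‖f z‖ ^ 2 :=
    fun j => by rw [force, norm_sq_embL2]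
  have e3 : ∀ j, ‖h.forceT hf j‖ ^ 2 = ∫ x in (K.elem j).top T, ‖f (x, T)‖ ^ 2 :=
    fun j => by rw [forceT, norm_sq_embL2]
  rw [lam, StabilizedData.lam, StabilizedData.lamSq_eq]
  simp only [e1, e2, e3, h.ν_eq, h.τ_eq]

theorem Lh_eq (a : K.velocity k) (ψ : K.velocity k × K.pressure k) :
    Lh K P f a.1 (pair ψ) = h.data.rhs (h.force hf) (h.forceT hf) a ψ := by
  have e1 : ∫ z in stDom Ω T, inner ℝ (f z) (ψ.1.1 z) =
      ∑ j, inner ℝ (h.force hf j) (h.data.val j ψ.1) := by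
    have h1 : ∀ j, (inner ℝ (h.force hf j) (h.data.val j ψ.1) : ℝ) =
        ∫ z in (K.elem j).carrier, inner ℝ (f z) (ψ.1.1 z) := fun j => by
      rw [force, val_apply, inner_embL2]
    simp only [h1]
    exact (K.integral_stDom h.isOpen h.lipschitz h.T_pos (fun j =>
      (hf.mono (K.carrier_subset j)).inner (K.smooth_velocity ψ.1 j).continuousOn)
      fun j z _ => rfl).2
  have e2 : ∀ j, (inner ℝ (h.force hf j) (h.data.X j a ψ - P.ν • h.data.lpl j ψ.1) : ℝ) =
      ∫ z in (K.elem j).carrier, inner ℝ (f z)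
          (advM (K.elem j).carrier a.1 ψ.1.1 z - P.ν • lap (K.elem j).carrier ψ.1.1 z
            + SpaceTimeVMS.grad (K.elem j).carrier ψ.2.1 z) := fun j => by
    rw [sub_eq_add_neg, ← neg_smul, h.X_add_lpl, force, inner_embL2]
    simp only [neg_smul, ← sub_eq_add_neg]
  have e3 : ∀ j, (inner ℝ (h.forceT hf j) (h.data.valT j ψ.1) : ℝ) =
      ∫ x in (K.elem j).top T, inner ℝ (f (x, T)) (ψ.1.1 (x, T)) := fun j => by
    rw [forceT, valT_apply, inner_embL2]
  rw [StabilizedData.rhs_eq, Lh, ← e1]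
  simp only [← h.τ_eq, h.ν_eq, e2, e3, pair]

theorem trace_bound {CΓ : ℝ} (htr : IsTraceConst K k CΓ) (j : Fin K.card) (a : K.velocity k)
    (φ : K.velocity k × K.pressure k) :
    ‖h.data.XT j a φ‖ ^ 2 ≤ CΓ * ‖h.data.X j a φ‖ ^ 2 := by
  rw [h.X_apply, h.XT_apply, norm_sq_embL2, norm_sq_embL2]
  exact htr a.1 a.2 φ.1.1 φ.1.2 φ.2.1 φ.2.2 j

theorem integration_by_parts (a u : K.velocity k) :
    ∑ j, inner ℝ (h.data.val j u) (h.data.X j a (u, 0)) =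
      ∑ j, (1 / 2 : ℝ) * ‖h.data.valT j u‖ ^ 2 := by
  have e1 : ∀ j, ‖h.data.valT j u‖ ^ 2 = ∫ x in (K.elem j).top T, ‖u.1 (x, T)‖ ^ 2 :=
    fun j => by rw [valT_apply, norm_sq_embL2]
  simp only [h.inner_val_X, e1]
  exact Mesh.integral_inner_advM h.isOpen h.lipschitz h.T_pos h.bounded a.2 u.2

/-- A continuous representative of the zero class vanishes at every point of the element. This
upgrades uniqueness of the pressure gradient from L² to pointwise, faces included. -/
theorem grad_eq_zero {q : K.pressure k} {j : Fin K.card} (hq : h.data.res j (0, q) = 0) :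
    ∀ z ∈ (K.elem j).carrier, SpaceTimeVMS.grad (K.elem j).carrier q.1 z = 0 := by
  have hc := (K.elem j).continuousOn_grad (K.smooth_pressure q j)
  refine (K.elem j).eq_zero_of_integral_sq hc ?_
  have h1 : h.data.res j (0, q) = embL2 _ (K.elem j).isCompact_carrier _ hc := by
    have h0 : ∀ z, dt (K.elem j).carrier ((0 : K.velocity k) : ST d → Sp d) z = 0 := by
      intro z
      simp [dt]
    refine MemLp.toLp_congr (memLp_of_continuousOn (K.elem j).isCompact_carrier
      (((K.elem j).continuousOn_dt (K.smooth_velocity (0 : K.velocity k) j)).add hc)) _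
      (Filter.Eventually.of_forall fun z => ?_)
    change dt (K.elem j).carrier ((0 : K.velocity k) : ST d → Sp d) z + _ = _
    rw [h0, zero_add]
  rw [← norm_sq_embL2 (hS := (K.elem j).isCompact_carrier) hc, ← h1, hq, norm_zero, sq, zero_mul]

theorem kernel_orthogonal (q : K.pressure k) (hq : ∀ j, h.data.res j (0, q) = 0)
    (v : K.velocity k) : ∑ j, inner ℝ (h.data.dvg j v) (h.data.prs j q) = 0 := by
  simp only [h.inner_dvg_prs]
  exact Mesh.integral_div_mul h.isOpen h.lipschitz h.T_pos h.bounded v.2 q.2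
    fun j => h.grad_eq_zero (hq j)

/-- Since h_e ≤ h_max, admissibility makes the convective part of 1/τ_m exceed 1/ε, which is how it
enters coercivity. -/
theorem one_lt_of_admissible {ε : ℝ} {a : K.velocity k} (ha : a.1 ∈ admissible K k P ε)
    (j : Fin K.card) : 1 < ε * (h.data.β j * h.data.spd j a) := by
  have h1 : (K.elem j).size ≤ K.maxSize := 
    le_ciSup (f := fun j => (K.elem j).size) (finite_range _).bddAbove j
  have h2 := h1.trans_lt (ha.2 j)
  have h3 := (K.elem j).size_pos h.dim_ne
  change 1 < ε * (P.c₂ / (K.elem j).size * (K.elem j).convSup a.1)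
  have h4 : ε * (P.c₂ / (K.elem j).size * (K.elem j).convSup a.1) =
      ε * P.c₂ * (K.elem j).convSup a.1 / (K.elem j).size := by ring
  rwa [h4, one_lt_div h3]

theorem isSolution_iff (a : K.velocity k) (φ : K.velocity k × K.pressure k) :
    IsSolution K k P f a.1 (pair φ) ↔
      ∀ ψ, h.data.form a φ ψ = h.data.rhs (h.force hf) (h.forceT hf) a ψ := by
  constructor
  · rintro ⟨-, hφ⟩ ψ
    rw [← h.Bh_eq, ← h.Lh_eq hf]
    exact hφ _ ⟨ψ.1.2, ψ.2.2⟩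
  · intro hφ
    refine ⟨⟨φ.1.2, φ.2.2⟩, fun ψ hψ => ?_⟩
    have := hφ (⟨ψ.1, hψ.1⟩, ⟨ψ.2, hψ.2⟩)
    rwa [← h.Bh_eq, ← h.Lh_eq hf] at this

end Setting

theorem exists_pair {φ : (ST d → Sp d) × (ST d → ℝ)} (hφ : φ ∈ K.Wh k) :
    ∃ φ' : K.velocity k × K.pressure k, pair φ' = φ :=
  ⟨(⟨φ.1, hφ.1⟩, ⟨φ.2, hφ.2⟩), rfl⟩

end Mesh

end Identification

end

end SpaceTimeVMS

/-! ### Assembly of the three assertions -/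

theorem mainTheorem5 (d : ℕ) (hd : d = 2 ∨ d = 3)
    (Ω : Set (SpaceTimeVMS.Sp d)) (hΩo : IsOpen Ω) (hΩb : Bornology.IsBounded Ω)
    (hΩl : SpaceTimeVMS.HasLipschitzBoundary Ω) (T : ℝ) (hT : 0 < T)
    (K : SpaceTimeVMS.Mesh Ω T) (k : ℕ) (hk : 1 ≤ k)
    (P : SpaceTimeVMS.Params) (hν : 0 < P.ν)
    (hc₁ : 2 < P.c₁) (hc₂ : 0 < P.c₂) (hc₃ : 0 < P.c₃) (hc₄ : 0 < P.c₄)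
    (hCI : 0 < P.CI) (hinv : SpaceTimeVMS.IsInverseConst K k P.CI)
    (CΓ : ℝ) (hCΓ : 0 < CΓ) (htr : SpaceTimeVMS.IsTraceConst K k CΓ)
    (ε : ℝ) (hε : 0 < ε) (hεΓ : ε < 2 / CΓ) :
    ∃ Cs > 0, ∃ Cb > 0,
      -- coercivity with the constant `Cs`
      (∀ a ∈ SpaceTimeVMS.admissible K k P ε, ∀ φ ∈ K.Wh k,
        Cs * SpaceTimeVMS.triNorm K P a φ ^ 2 ≤ SpaceTimeVMS.Bh K P a φ φ) ∧
      -- the problem is solvable, with a unique velocity and pressure gradient, and the solution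
      -- is bounded by `(Cb / Cs) λ(f)`
      (∀ f : SpaceTimeVMS.ST d → SpaceTimeVMS.Sp d,
        ContinuousOn f (closure (SpaceTimeVMS.stDom Ω T)) →
        BddAbove ((fun a => Cb / Cs * SpaceTimeVMS.lam K P f a) ''
          SpaceTimeVMS.admissible K k P ε) ∧
        ∀ a ∈ SpaceTimeVMS.admissible K k P ε,
          ∃ φ, SpaceTimeVMS.IsSolution K k P f a φ ∧
            SpaceTimeVMS.triNorm K P a φ ≤ Cb / Cs * SpaceTimeVMS.lam K P f a ∧
            ∀ φ', SpaceTimeVMS.IsSolution K k P f a φ' →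
              φ'.1 = φ.1 ∧ ∀ j, ∀ z ∈ (K.elem j).carrier,
                SpaceTimeVMS.grad (K.elem j).carrier φ'.2 z =
                  SpaceTimeVMS.grad (K.elem j).carrier φ.2 z) ∧
      -- the solution map sends the ball into itself and is Lipschitz continuous there
      ∀ R : ℝ, ∃ Ct ≥ 0, ∀ f : SpaceTimeVMS.ST d → SpaceTimeVMS.Sp d,
        ContinuousOn f (closure (SpaceTimeVMS.stDom Ω T)) →
        (∀ a ∈ SpaceTimeVMS.admissible K k P ε, Cb / Cs * SpaceTimeVMS.lam K P f a ≤ R) →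
        ∀ F : (SpaceTimeVMS.ST d → SpaceTimeVMS.Sp d) →
            (SpaceTimeVMS.ST d → SpaceTimeVMS.Sp d) × (SpaceTimeVMS.ST d → ℝ),
          (∀ a ∈ SpaceTimeVMS.admissible K k P ε, SpaceTimeVMS.IsSolution K k P f a (F a)) →
          (∀ a ∈ SpaceTimeVMS.admissible K k P ε,
            (∃ r, (a, r) ∈ SpaceTimeVMS.discreteBall K k P R) →
              F a ∈ SpaceTimeVMS.discreteBall K k P R ∧
                SpaceTimeVMS.triNorm K P a (F a) ≤ R) ∧
          ∀ a₁ ∈ SpaceTimeVMS.admissible K k P ε, ∀ a₂ ∈ SpaceTimeVMS.admissible K k P ε,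
            (∃ r, (a₁, r) ∈ SpaceTimeVMS.discreteBall K k P R) →
            (∃ r, (a₂, r) ∈ SpaceTimeVMS.discreteBall K k P R) →
              SpaceTimeVMS.triNorm K P a₁ (F a₁ - F a₂) ≤
                Ct / Cs * SpaceTimeVMS.gradNorm Ω T (a₁ - a₂) := by
  have h : K.Setting k P := ⟨hΩo, hΩl, hT, hΩb, by omega, hν, hc₁, hc₂, hc₃, hc₄, hCI, hinv⟩
  obtain ⟨Cs, hCs, hco⟩ := h.data.coercive hCΓ hε hεΓ (h.trace_bound htr) h.integration_by_parts
  obtain ⟨Cb, hCb, hrhs⟩ := h.data.rhs_le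
  have hco' : ∀ a : K.velocity k, a.1 ∈ SpaceTimeVMS.admissible K k P ε → ∀ φ,
      Cs * h.data.tri a φ ^ 2 ≤ h.data.form a φ φ := fun a ha φ =>
    hco a (h.one_lt_of_admissible ha) φ
  refine ⟨Cs, hCs, Cb, hCb, ?_, ?_, ?_⟩
  · intro a ha φ hφ
    obtain ⟨φ, rfl⟩ := SpaceTimeVMS.Mesh.exists_pair hφ
    have := hco' ⟨a, ha.1⟩ ha φ
    rwa [← h.triNorm_eq, ← h.Bh_eq] at this
  · intro f hf
    constructor
    · obtain ⟨C, hC⟩ := h.data.exists_lam_le (h.force hf) (h.forceT hf)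
      refine ⟨Cb / Cs * C, ?_⟩
      rintro _ ⟨a, ha, rfl⟩
      have := hC ⟨a, ha.1⟩
      rw [← h.lam_eq hf] at this
      exact mul_le_mul_of_nonneg_left this (div_pos hCb hCs).le
    · intro a ha
      obtain ⟨φ, hφ⟩ := h.data.exists_solution (a := ⟨a, ha.1⟩) hCs (hco' _ ha)
        h.kernel_orthogonal (h.force hf) (h.forceT hf)
      refine ⟨SpaceTimeVMS.Mesh.pair φ, (h.isSolution_iff hf ⟨a, ha.1⟩ φ).2 hφ, ?_, ?_⟩
      · have := h.data.tri_le_of_solution hCs (hco' _ ha) (hrhs _ _ _) hCb hφ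
        rwa [← h.triNorm_eq, ← h.lam_eq hf] at this
      · intro φ' hφ'
        obtain ⟨φ', rfl⟩ := SpaceTimeVMS.Mesh.exists_pair hφ'.1
        have hs := (h.isSolution_iff hf ⟨a, ha.1⟩ φ').1 hφ'
        obtain ⟨h1, h2⟩ := h.data.solution_unique hCs (hco' _ ha)
          (fun ψ => (hs ψ).trans (hφ ψ).symm)
        refine ⟨congrArg Subtype.val (sub_eq_zero.1 h1), fun j z hz => ?_⟩
        have h3 := h.grad_eq_zero (h2 j) z hz
        -- The second pressure is the first plus the difference, and the difference has zero
        -- gradient on the element.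
        have h4 := (K.elem j).grad_add (K.smooth_pressure (φ'.2 - φ.2) j)
          (K.smooth_pressure φ.2 j) hz
        rw [h3, zero_add] at h4
        rw [show SpaceTimeVMS.Mesh.pair φ = (φ.1.1, φ.2.1) from rfl, ← h4]
        congr 1
        exact (sub_add_cancel φ'.2.1 φ.2.1).symm
  · intro R
    -- For negative R the ball is empty and any constant will do.
    by_cases hR : 0 ≤ R
    swap
    · refine ⟨0, le_rfl, fun f hf hlam F hF => ?_⟩
      have hemp : ∀ a, ¬ ∃ r, (a, r) ∈ SpaceTimeVMS.discreteBall K k P R := by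
        rintro a ⟨r, -, b, -, hb⟩
        exact hR ((Real.sqrt_nonneg _).trans hb)
      exact ⟨fun a _ ha => absurd ha (hemp a), fun a _ _ _ ha => absurd ha (hemp a)⟩
    -- R/√ν bounds ‖∇a‖ on the ball, and (Cs/Cb)R is the bound on λ obtained from (Cb/Cs)λ ≤ R.
    obtain ⟨Ct, hCt, hlip⟩ := h.data.exists_lipschitz hCΓ hCs (h.trace_bound htr)
      ((√h.data.ν)⁻¹ * R) R (Cs / Cb * R) hR (mul_nonneg (div_pos hCs hCb).le hR)
    refine ⟨Ct, hCt, fun f hf hlam F hF => ?_⟩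
    -- The gradient part of the norm involves neither b nor the pressure, so membership in the ball
    -- bounds ∇a whatever b and r are.
    have hball : ∀ a (ha : a ∈ SpaceTimeVMS.admissible K k P ε),
        (∃ r, (a, r) ∈ SpaceTimeVMS.discreteBall K k P R) →
          ‖h.data.grad ⟨a, ha.1⟩‖ ≤ (√h.data.ν)⁻¹ * R := by
      rintro a ha ⟨r, har, b, hb, hbR⟩
      have h1 := h.data.norm_grad_le ⟨b, hb⟩ (⟨a, ha.1⟩, ⟨r, har.2⟩)
      rw [← h.triNorm_eq] at h1
      exact h1.trans (mul_le_mul_of_nonneg_left hbR (by positivity))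
    have hsol : ∀ a (ha : a ∈ SpaceTimeVMS.admissible K k P ε),
        ∃ φ, SpaceTimeVMS.Mesh.pair φ = F a ∧
        (∀ ψ, h.data.form ⟨a, ha.1⟩ φ ψ =
          h.data.rhs (h.force hf) (h.forceT hf) ⟨a, ha.1⟩ ψ) ∧
        h.data.tri ⟨a, ha.1⟩ φ ≤ R := by
      intro a ha
      obtain ⟨φ, hφ⟩ := SpaceTimeVMS.Mesh.exists_pair (hF a ha).1
      have h1 := hF a ha
      rw [← hφ] at h1
      have h2 := (h.isSolution_iff hf ⟨a, ha.1⟩ φ).1 h1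
      refine ⟨φ, hφ, h2, ?_⟩
      have h3 := h.data.tri_le_of_solution hCs (hco' _ ha) (hrhs _ _ _) hCb h2
      rw [← h.lam_eq hf] at h3
      exact h3.trans (hlam a ha)
    refine ⟨fun a ha _ => ?_, fun a₁ ha₁ a₂ ha₂ hr₁ hr₂ => ?_⟩
    · obtain ⟨φ, hφ, -, hR'⟩ := hsol a ha
      have h1 : SpaceTimeVMS.triNorm K P a (F a) ≤ R := by
        rw [← hφ]
        exact (h.triNorm_eq ⟨a, ha.1⟩ φ).trans_le hR'
      -- The field witnessing membership in the ball is a itself.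
      exact ⟨⟨(hF a ha).1, a, ha.1, h1⟩, h1⟩
    · obtain ⟨φ₁, hφ₁, hs₁, -⟩ := hsol a₁ ha₁
      obtain ⟨φ₂, hφ₂, hs₂, hR₂⟩ := hsol a₂ ha₂
      have hl : h.data.lam (h.force hf) (h.forceT hf) ⟨a₂, ha₂.1⟩ ≤ Cs / Cb * R := by
        have := hlam a₂ ha₂
        rw [div_mul_eq_mul_div, div_le_iff₀ hCs] at this
        rw [← h.lam_eq hf, div_mul_eq_mul_div, le_div_iff₀ hCb]
        linarith
      have := hlip (h.force hf) (h.forceT hf) ⟨a₁, ha₁.1⟩ ⟨a₂, ha₂.1⟩ (hball a₁ ha₁ hr₁)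
        (hball a₂ ha₂ hr₂) (hco' _ ha₁) hl φ₁ φ₂ hs₁ hs₂ hR₂
      rw [← h.triNorm_eq, ← h.gradNorm_eq] at this
      rw [← hφ₁, ← hφ₂]
      exact this
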